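/- Let $d,k\ge 1$ and let $\mathcal N=Cl^{(d)}_{1\to k}$ be the $1\to k$ universal qudit cloner: the channel obtained by tracing out the second factor of the isometry $|i\rangle\mapsto\sum_{j}\alpha_{ij}\,|e_i+j\rangle\otimes|R_j\rangle$, where $j$ ranges over $\{j\in\mathbb N^d:\sum_l j_l=k-1\}$, the $|n\rangle$ with $\sum_l n_l=k$ are the orthonormal occupation-number basis states of the symmetric subspace of $k$ qudits, $e_i$ is the $i$-th unit vector, the $|R_j\rangle$ are orthonormal, and $\alpha_{ij}=\sqrt{\frac{(k-1)!\,d!}{(k+d-1)!}}\sqrt{1+j_i}$. For a channel $\mathcal M^{A'\to B}$ and a finite ensemble $\{p(x),\phi_x^{AA'}\}$ of pure states ($A$ finite-dimensional), let $\sigma^{XAB}=\sum_x p(x)|x\rangle\langle x|^X\otimes\mathcal M(\phi_x^{AA'})$, let $\mathcal C_\sigma$ be the set of $(C,Q,E)\in\mathbb R^3$ with $$C+2Q\le I(AX;B)_\sigma,\qquad Q+E\le I(A\rangle BX)_\sigma,\qquad C+Q+E\le I(X;B)_\sigma+I(A\rangle BX)_\sigma,$$ and for $\nu,\lambda,\mu\ge0$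 put $$F_{\nu,\lambda,\mu}(\sigma)=\nu I(AX;B)_\sigma+\lambda I(A\rangle BX)_\sigma+\mu\bigl(I(X;B)_\sigma+I(A\rangle BX)_\sigma\bigr).$$ The quantum dynamic capacity formula is $\mathcal D_{\lambda,\mu}(\mathcal M)=\max_\sigma F_{1,\lambda,\mu}(\sigma)$. The CQE capacity region is $\mathcal C_{CQE}(\mathcal N)=\overline{\bigcup_{n\ge1}\frac1n\mathcal C^{(1)}_{CQE}(\mathcal N^{\otimes n})}$, where $\mathcal C^{(1)}_{CQE}(\mathcal M)=\bigcup_\sigma\mathcal C_\sigma$. For a probability vector $p=(p_0,\dots,p_{d-1})$, with $p_0=1-\mu_1-\dots-\mu_{d-1}$ and $p_j=\mu_j$ for $j\ge1$, a cyclic ensemble with parameters $p$ is a uniform ensemble of $d$ pure states $\psi_1,\dots,\psi_d$ on $AA'$ with $$\mathrm{Tr}_A\,\psi_x^{AA'}=\sum_{i=1}^d p_{(i-x)\bmod d}\,|i\rangle\langle i|^{A'}\qquad(x=1,\dots,d).$$ The following hold for $\mathcal N$. 1. For all $\lambda,\mu\ge0$ there is a $p$ such that cyclic ensembles with parameters $p$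 exist and each of them attains the maximum $\mathcal D_{\lambda,\mu}(\mathcal N)$ over all ensembles. 2. $\mathcal C_{CQE}(\mathcal N)$ is the convex hull of the union of the sets $\mathcal C_\sigma$ over all cyclic ensembles. 3. For every Pareto-optimal (componentwise maximal) point $r=(C,Q,E)$ of $\mathcal C_{CQE}(\mathcal N)$ there are $\nu,\lambda,\mu\ge0$, not all zero, such that $r$ lies in the convex hull of the sets $\mathcal C_\sigma$ of those cyclic ensembles whose parameters $p$ are such that every cyclic ensemble with parameters $p$ maximizes $F_{\nu,\lambda,\mu}$ over all ensembles. -/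

import Mathlib

open scoped Matrix ComplexConjugate Pointwise

namespace QCloner

noncomputable section

/-! ### Entropy -/

/-- The von Neumann entropy `-Tr (ρ log ρ)` (natural logarithm) of a density matrix: the sum of
`-z log z` over its eigenvalues, counted with multiplicity. -/
def entropy {n : Type*} [Fintype n] [DecidableEq n] (ρ : Matrix n n ℂ) : ℝ :=
  (ρ.charpoly.roots.map fun z => Real.negMulLog z.re).sum

/-- Partial trace over the second tensor factor. -/
def traceSnd {m n : Type*} [Fintype n] : Matrix (m × n) (m × n) ℂ →ₗ[ℂ] Matrix m m ℂ where
  toFun ρ := Matrix.of fun i i' => ∑ j, ρ (i, j) (i', j)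
  map_add' ρ τ := by ext; simp [Finset.sum_add_distrib]
  map_smul' c ρ := by ext; simp [Finset.mul_sum]

/-! ### Channels -/

/-- A linear map from matrices on `ℂ^ι` to matrices on `ℂ^κ`; a channel is such a map that is
completely positive and trace preserving. -/
abbrev Chan (ι κ : Type*) := Matrix ι ι ℂ →ₗ[ℂ] Matrix κ κ ℂ

/-- The channel `ρ ↦ Tr_E (V ρ V†)` with isometric extension `V : A' → B ⊗ E`. -/
def chanOfIsometry {ι κ ε : Type*} [Fintype ι] [Fintype ε]
    (V : Matrix (κ × ε) ι ℂ) : Chan ι κ :=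
  traceSnd ∘ₗ
    { toFun := fun ρ => V * ρ * Vᴴ
      map_add' := fun ρ τ => by rw [Matrix.mul_add, Matrix.add_mul]
      map_smul' := fun c ρ => by simp }

/-- The `n`-fold tensor power `N^{⊗ n}`, defined on matrix units by
`N^{⊗ n} (⨂ₜ |iₜ⟩⟨i'ₜ|) = ⨂ₜ N (|iₜ⟩⟨i'ₜ|)` and extended linearly. -/
def chanPow {ι κ : Type*} [Fintype ι] [DecidableEq ι] (N : Chan ι κ) (n : ℕ) :
    Chan (Fin n → ι) (Fin n → κ) where
  toFun ρ := Matrix.of fun b b' =>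
    ∑ i, ∑ i', ρ i i' * ∏ t, N (Matrix.single (i t) (i' t) 1) (b t) (b' t)
  map_add' ρ τ := by ext; simp [add_mul, Finset.sum_add_distrib]
  map_smul' c ρ := by ext; simp [mul_assoc, Finset.mul_sum]

/-! ### Classical-quantum states and information quantities -/

/-- An ensemble `{p(x), φ_x}`, `x ∈ X`, of pure states `φ_x` (unit vectors) of the bipartite
system `A A'`, where `A'` is the input system of a channel. -/
structure Ensemble (X A ι : Type*) [Fintype X] [Fintype A] [Fintype ι] where
  prob : X → ℝ
  prob_mem : prob ∈ stdSimplex ℝ X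
  state : X → A × ι → ℂ
  state_norm : ∀ x, ∑ i, ‖state x i‖ ^ 2 = 1

section Info

variable {X A ι κ : Type*} [Fintype X] [DecidableEq X] [Fintype A] [DecidableEq A]
  [Fintype ι] [Fintype κ] [DecidableEq κ]

/-- The state `σ^{XAB} = ∑ₓ p(x) |x⟩⟨x|^X ⊗ (id_A ⊗ N^{A' → B})(φ_x^{AA'})`. -/
def outState (N : Chan ι κ) (s : Ensemble X A ι) : Matrix (X × A × κ) (X × A × κ) ℂ :=
  Matrix.of fun u v =>
    if u.1 = v.1 then
      (s.prob u.1 : ℂ) *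
        N (Matrix.of fun i i' => s.state u.1 (u.2.1, i) * conj (s.state u.1 (v.2.1, i')))
          u.2.2 v.2.2
    else 0

/-- The marginal `σ^{XA}`. -/
def margXA (σ : Matrix (X × A × κ) (X × A × κ) ℂ) : Matrix (X × A) (X × A) ℂ :=
  Matrix.of fun u v => ∑ b, σ (u.1, u.2, b) (v.1, v.2, b)

/-- The marginal `σ^{XB}`. -/
def margXB (σ : Matrix (X × A × κ) (X × A × κ) ℂ) : Matrix (X × κ) (X × κ) ℂ :=
  Matrix.of fun u v => ∑ a, σ (u.1, a, u.2) (v.1, a, v.2)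

/-- The marginal `σ^X`. -/
def margX (σ : Matrix (X × A × κ) (X × A × κ) ℂ) : Matrix X X ℂ :=
  Matrix.of fun x x' => ∑ a, ∑ b, σ (x, a, b) (x', a, b)

/-- The marginal `σ^B`. -/
def margB (σ : Matrix (X × A × κ) (X × A × κ) ℂ) : Matrix κ κ ℂ :=
  Matrix.of fun b b' => ∑ x, ∑ a, σ (x, a, b) (x, a, b')

/-- The quantum mutual information `I(AX;B)_σ = H(AX) + H(B) - H(AXB)`. -/
def infoAXB (N : Chan ι κ) (s : Ensemble X A ι) : ℝ :=
  entropy (margXA (outState N s)) + entropy (margB (outState N s)) - entropy (outState N s)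

/-- The coherent information `I(A⟩BX)_σ = H(BX) - H(ABX)`. -/
def cohInfo (N : Chan ι κ) (s : Ensemble X A ι) : ℝ :=
  entropy (margXB (outState N s)) - entropy (outState N s)

/-- The Holevo information `I(X;B)_σ = H(X) + H(B) - H(XB)`. -/
def infoXB (N : Chan ι κ) (s : Ensemble X A ι) : ℝ :=
  entropy (margX (outState N s)) + entropy (margB (outState N s))
    - entropy (margXB (outState N s))

/-- The weighted sum `ν I(AX;B) + λ I(A⟩BX) + μ (I(X;B) + I(A⟩BX))`. -/
def weightedInfo (N : Chan ι κ) (ν lam μ : ℝ) (s : Ensemble X A ι) : ℝ :=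
  ν * infoAXB N s + lam * cohInfo N s + μ * (infoXB N s + cohInfo N s)

/-- The one-shot, one-state region: all rate triples `(C, Q, E)` with `C + 2Q ≤ I(AX;B)`,
`Q + E ≤ I(A⟩BX)` and `C + Q + E ≤ I(X;B) + I(A⟩BX)`. A negative rate stands for the
consumption of the resource. -/
def stateRegion (N : Chan ι κ) (s : Ensemble X A ι) : Set (ℝ × ℝ × ℝ) :=
  {r | r.1 + 2 * r.2.1 ≤ infoAXB N s ∧
       r.2.1 + r.2.2 ≤ cohInfo N s ∧
       r.1 + r.2.1 + r.2.2 ≤ infoXB N s + cohInfo N s}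

end Info

section Region

variable {ι κ : Type*} [Fintype ι] [Fintype κ] [DecidableEq κ]

/-- All values of the weighted sum over ensembles with an arbitrary finite alphabet `X` and an
arbitrary finite-dimensional system `A`. The quantum dynamic capacity formula `D_{λ,μ}(N)` is
the maximum of this set for `ν = 1`. -/
def weightedValues (N : Chan ι κ) (ν lam μ : ℝ) : Set ℝ :=
  {v | ∃ (m a : ℕ) (s : Ensemble (Fin m) (Fin a) ι), v = weightedInfo N ν lam μ s}

/-- The one-shot region: the union of the one-state regions over all ensembles. -/
def oneShotRegion (N : Chan ι κ) : Set (ℝ × ℝ × ℝ) :=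
  ⋃ (m : ℕ) (a : ℕ) (s : Ensemble (Fin m) (Fin a) ι), stateRegion N s

/-- The CQE capacity region: the closure of `⋃_{n ≥ 1} (1/n) C⁽¹⁾(N^{⊗ n})`. -/
def cqeRegion [DecidableEq ι] (N : Chan ι κ) : Set (ℝ × ℝ × ℝ) :=
  closure (⋃ n ∈ Set.Ici (1 : ℕ), (1 / (n : ℝ)) • oneShotRegion (chanPow N n))

end Region

/-! ### The universal qudit cloner -/

/-- Occupation numbers `n = (n_1, …, n_d)` with `n_1 + ⋯ + n_d = m`. They index the completely
symmetric orthonormal basis states `|n⟩` of `m` qudits. -/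
abbrev Occ (d m : ℕ) : Type :=
  {n : Fin d → ℕ // n ∈ Finset.piAntidiag (Finset.univ : Finset (Fin d)) m}

/-- The coefficient `α_{n j}` of the `N → M` universal qudit cloner. -/
def cloneCoeff (d N M : ℕ) (n j : Fin d → ℕ) : ℝ :=
  √((Nat.factorial (M - N) * Nat.factorial (N + d - 1) : ℝ) / Nat.factorial (M + d - 1)) *
    √(∏ i, (Nat.factorial (n i + j i) : ℝ) / (Nat.factorial (n i) * Nat.factorial (j i)))

/-- The isometry `|i⟩ ↦ ∑_j α_{e_i j} |e_i + j⟩_B ⊗ R_j` of the `1 → k` universal qudit cloner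
(`k ≥ 1`), where `j` ranges over the occupation numbers with sum `k - 1`, the auxiliary states
`R_j` are orthonormal, and the single-qudit state `|i⟩` has the occupation numbers `e_i`. -/
def clonerIsometry (d k : ℕ) : Matrix (Occ d k × Occ d (k - 1)) (Fin d) ℂ :=
  Matrix.of fun bj i =>
    if bj.1.1 = Pi.single i 1 + bj.2.1 then (cloneCoeff d 1 k (Pi.single i 1) bj.2.1 : ℂ) else 0

/-- The `1 → k` universal qudit cloner, from one qudit to the symmetric subspace of `k` qudits:
the auxiliary system of the cloning isometry is traced out. -/
def cloner (d k : ℕ) : Chan (Fin d) (Occ d k) := chanOfIsometry (clonerIsometry d k)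

/-! ### Cyclic ensembles -/

/-- The ensemble is uniform over `d` pure states `ψ_x` of `A A'`, `x = 0, …, d - 1`, whose reduced
states on `A'` are diagonal with the cyclic shifts of `p` as eigenvalues,
`Tr_A ψ_x = ∑ᵢ p (i - x) |i⟩⟨i|` with `i - x` modulo `d`. -/
def IsCyclic {d : ℕ} {A : Type*} [Fintype A] (p : Fin d → ℝ)
    (s : Ensemble (Fin d) A (Fin d)) : Prop :=
  (∀ x, s.prob x = 1 / (d : ℝ)) ∧
  ∀ x i i', ∑ a, s.state x (a, i) * conj (s.state x (a, i')) =
    if i = i' then ((p (i - x) : ℝ) : ℂ) else 0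

/-- The rate triples obtained from the cyclic ensembles with parameters `p`. -/
def cyclicRegion {d : ℕ} {κ : Type*} [Fintype κ] [DecidableEq κ] (N : Chan (Fin d) κ)
    (p : Fin d → ℝ) : Set (ℝ × ℝ × ℝ) :=
  ⋃ (a : ℕ) (s : Ensemble (Fin d) (Fin a) (Fin d)) (_ : IsCyclic p s), stateRegion N s

/-- Every cyclic ensemble with parameters `p` maximizes the weighted sum
`ν I(AX;B) + λ I(A⟩BX) + μ (I(X;B) + I(A⟩BX))` over all ensembles, and there is such a cyclic
ensemble. -/
def CyclicMaximizes {d : ℕ} {κ : Type*} [Fintype κ] [DecidableEq κ] (N : Chan (Fin d) κ)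
    (ν lam μ : ℝ) (p : Fin d → ℝ) : Prop :=
  (∃ (a : ℕ) (s : Ensemble (Fin d) (Fin a) (Fin d)), IsCyclic p s) ∧
  ∀ (a : ℕ) (s : Ensemble (Fin d) (Fin a) (Fin d)), IsCyclic p s →
    IsGreatest (weightedValues N ν lam μ) (weightedInfo N ν lam μ s)

end

end QCloner

/-!
The universal cloner `N` has two properties that single out the cyclic ensembles.

*It is covariant.* An isometry `V` with complementary channel `Nᶜ` sends a pure state of `A A'` to a
pure state of `A B E`, so that `H(AB) = H(E)`, and the three information quantities of an ensemble
depend only on the unnormalized reduced inputs `ρ_x = p(x) Tr_A φ_x`. For nonnegative weights their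
weighted sum is `(ν + μ) H(N(∑ ρ_x)) + ∑ condInfo ρ_x` (`weightedInfo_eq`), where `condInfo` is a
combination of `H(ρ)`, `H(N ρ)`, `H(Nᶜ ρ)` that is homogeneous of degree one and, by covariance
(`exists_cloner_conj`, `condInfo_conj`), depends only on the spectrum of `ρ`. The first term is at
most `(ν + μ) log dim B`. A cyclic ensemble reaches this value, because its average input is
maximally mixed, while all its members have the same spectrum `p`. Hence the maximum over all
ensembles is the maximum of a continuous function of `p` on the simplex. For the same reason the
information vector `cyclicInfo k p` of a cyclic ensemble depends on `p` alone, and one single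
ensemble realizes any time sharing between cyclic ensembles (`exists_infoVec_eq_sum`).

*It is a Hadamard channel.* Measuring the clones in a finite resolution of the identity by coherent
vectors `ψ^{⊗ k}` (`exists_coherent_resolution`) leaves the environment in a pure state known from
the outcome (`isHadamard_cloner`). For such a channel `condInfo` is additive: with the outcome `Y`
of the first channel, data processing gives `H(A₂'|A₁') ≤ H(A₂'|Y)`, `H(B₂|B₁) ≤ H(B₂|Y)` and
`H(E₂|Y) ≤ H(E₂|E₁)` (`exists_condInfo_prodIso_le`), so a bound for one channel use extends to `n`
uses (`condInfo_powIso_le`). The monotonicity of the conditional entropy comes from the data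
processing inequality of the relative entropy (`relEnt_krausMap_le`), which is written as an
integral of quadratic forms that decrease by the Kadison-Schwarz inequality. The resolution of the
identity comes from Gauss-Laguerre quadrature in the squared modulus, and roots of unity in the
phase, of each coordinate of `ψ` (`exists_gaussian_design`).

The rest is convex geometry in `ℝ³`. Up to the linear isomorphism `rateSums`, the convex hull of the
cyclic regions is the set of vectors below a point of the compact convex set `cyclicHull`. A rate
triple outside is separated from it by a functional with nonnegative weights, which is impossible in
the capacity region by additivity (`exists_le_of_mem_cqeRegion`). A Pareto-optimal point lies on a
supporting hyperplane with nonnegative weights, and only maximizers of this functional can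
contribute to it (`exists_weights_of_maximal`).
-/

namespace QCloner

open scoped ComplexOrder

noncomputable section

/-! ### Entropy of Hermitian matrices -/

section Entropy

variable {m n : Type*} [Fintype m] [Fintype n] [DecidableEq m] [DecidableEq n]

/-- Nonzero spectra of `A * B` and `B * A` agree, and zero eigenvalues carry no entropy. -/
theorem entropy_mul_comm (A : Matrix m n ℂ) (B : Matrix n m ℂ) :
    entropy (A * B) = entropy (B * A) := by
  have h := congrArg Polynomial.roots (Matrix.charpoly_mul_comm' A B)
  rw [Polynomial.roots_mul ((Polynomial.monic_X_pow _).mul (Matrix.charpoly_monic _)).ne_zero,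
    Polynomial.roots_mul ((Polynomial.monic_X_pow _).mul (Matrix.charpoly_monic _)).ne_zero,
    Polynomial.roots_X_pow, Polynomial.roots_X_pow] at h
  have h' := congrArg (fun s => (Multiset.map (fun z : ℂ => Real.negMulLog z.re) s).sum) h
  simpa [entropy, Multiset.nsmul_singleton] using h'

theorem entropy_diagonal (p : n → ℝ) :
    entropy (Matrix.diagonal fun i => (p i : ℂ)) = ∑ i, Real.negMulLog (p i) := by
  unfold entropy
  rw [Matrix.charpoly_diagonal]
  have h := Polynomial.roots_multiset_prod_X_sub_C
    ((Finset.univ : Finset n).val.map fun i => (p i : ℂ))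
  rw [Multiset.map_map] at h
  erw [h]
  rw [Multiset.map_map]
  rfl

/-- The entropy read off from a spectral decomposition; `U` may be a rectangular isometry. -/
theorem entropy_conj_diagonal (U : Matrix m n ℂ) (hU : Uᴴ * U = 1) (p : n → ℝ) :
    entropy (U * Matrix.diagonal (fun i => (p i : ℂ)) * Uᴴ) = ∑ i, Real.negMulLog (p i) := by
  rw [entropy_mul_comm, ← Matrix.mul_assoc, hU, Matrix.one_mul, entropy_diagonal]

theorem entropy_conj_isometry (U : Matrix m n ℂ) (hU : Uᴴ * U = 1) (M : Matrix n n ℂ) :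
    entropy (U * M * Uᴴ) = entropy M := by
  rw [entropy_mul_comm, ← Matrix.mul_assoc, hU, Matrix.one_mul]

theorem entropy_submatrix_equiv (e : m ≃ n) (M : Matrix n n ℂ) :
    entropy (M.submatrix e e) = entropy M := by
  have := Matrix.charpoly_reindex e.symm M
  rw [Matrix.reindex_apply, Equiv.symm_symm] at this
  rw [entropy, this, entropy]

theorem entropy_transpose (M : Matrix n n ℂ) : entropy Mᵀ = entropy M := by
  rw [entropy, Matrix.charpoly_transpose, entropy]

theorem exists_spectral {M : Matrix n n ℂ} (hM : M.IsHermitian) :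
    ∃ (U : Matrix n n ℂ) (p : n → ℝ), Uᴴ * U = 1 ∧ U * Uᴴ = 1 ∧
      M = U * Matrix.diagonal (fun i => (p i : ℂ)) * Uᴴ :=
  ⟨hM.eigenvectorUnitary, hM.eigenvalues, Unitary.coe_star_mul_self _, Unitary.coe_mul_star_self _,
    by
      conv_lhs => rw [hM.spectral_theorem, Unitary.conjStarAlgAut_apply]
      rfl⟩

theorem nonneg_of_conj_diagonal {U : Matrix n n ℂ} {p : n → ℝ} (hU : Uᴴ * U = 1)
    (h : (U * Matrix.diagonal (fun i => (p i : ℂ)) * Uᴴ).PosSemidef) (i : n) : 0 ≤ p i := by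
  have h2 := h.conjTranspose_mul_mul_same U
  have e : Uᴴ * (U * Matrix.diagonal (fun i => (p i : ℂ)) * Uᴴ) * U
      = Matrix.diagonal fun i => (p i : ℂ) := by
    rw [Matrix.mul_assoc, Matrix.mul_assoc _ Uᴴ, hU, Matrix.mul_one, ← Matrix.mul_assoc, hU,
      Matrix.one_mul]
  rw [e, Matrix.posSemidef_diagonal_iff] at h2
  exact_mod_cast h2 i

theorem trace_conj_diagonal {U : Matrix n n ℂ} (hU : Uᴴ * U = 1) (p : n → ℝ) :
    (U * Matrix.diagonal (fun i => (p i : ℂ)) * Uᴴ).trace = ((∑ i, p i : ℝ) : ℂ) := by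
  rw [Matrix.trace_mul_comm, ← Matrix.mul_assoc, hU, Matrix.one_mul, Matrix.trace_diagonal]
  push_cast; rfl

theorem exists_spectral_posSemidef {M : Matrix n n ℂ} (hM : M.PosSemidef) :
    ∃ (U : Matrix n n ℂ) (p : n → ℝ), Uᴴ * U = 1 ∧ U * Uᴴ = 1 ∧ (∀ i, 0 ≤ p i) ∧
      M = U * Matrix.diagonal (fun i => (p i : ℂ)) * Uᴴ := by
  obtain ⟨U, p, h1, h2, h3⟩ := exists_spectral hM.1
  exact ⟨U, p, h1, h2, nonneg_of_conj_diagonal h1 (h3 ▸ hM), h3⟩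

theorem exists_eq_mul_conjTranspose {M : Matrix n n ℂ} (hM : M.PosSemidef) :
    ∃ S : Matrix n n ℂ, M = S * Sᴴ := by
  obtain ⟨U, p, _, _, hp, rfl⟩ := exists_spectral_posSemidef hM
  refine ⟨U * Matrix.diagonal fun i => ((√(p i) : ℝ) : ℂ), ?_⟩
  rw [Matrix.conjTranspose_mul, Matrix.diagonal_conjTranspose,
    ← Matrix.mul_assoc (U * _), Matrix.mul_assoc U (Matrix.diagonal _) (Matrix.diagonal _),
    Matrix.diagonal_mul_diagonal]
  congr; ext i
  simp only [Pi.star_apply, Complex.star_def, Complex.conj_ofReal]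
  rw [← Complex.ofReal_mul, Real.mul_self_sqrt (hp i)]

/-- The block-diagonal matrix with blocks `M x`, the block label being the first index. -/
def blocks (M : m → Matrix n n ℂ) : Matrix (m × n) (m × n) ℂ :=
  Matrix.of fun u v => if u.1 = v.1 then M u.1 u.2 v.2 else 0

omit [Fintype m] [Fintype n] [DecidableEq n] in
theorem blocks_eq_submatrix (M : m → Matrix n n ℂ) :
    blocks M = (Matrix.blockDiagonal M).submatrix (Equiv.prodComm m n) (Equiv.prodComm m n) := by
  ext ⟨x, i⟩ ⟨y, j⟩
  simp [blocks, Matrix.blockDiagonal_apply]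

theorem posSemidef_blocks {M : m → Matrix n n ℂ} (hM : ∀ x, (M x).PosSemidef) :
    (blocks M).PosSemidef := by
  rw [blocks_eq_submatrix]
  refine Matrix.PosSemidef.submatrix ?_ _
  choose S hS using fun x => exists_eq_mul_conjTranspose (hM x)
  rw [funext hS, Matrix.blockDiagonal_mul, ← Matrix.blockDiagonal_conjTranspose]
  exact Matrix.posSemidef_self_mul_conjTranspose _

theorem entropy_blocks (M : m → Matrix n n ℂ) (hM : ∀ x, (M x).IsHermitian) :
    entropy (blocks M) = ∑ x, entropy (M x) := by
  choose U p h1 _ h3 using fun x => exists_spectral (hM x)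
  have e : M = fun x => U x * Matrix.diagonal (fun i => (p x i : ℂ)) * (U x)ᴴ := funext h3
  rw [blocks_eq_submatrix, entropy_submatrix_equiv]
  have e2 : Matrix.blockDiagonal M = Matrix.blockDiagonal U *
      Matrix.diagonal (fun i : n × m => ((p i.2 i.1 : ℝ) : ℂ)) * (Matrix.blockDiagonal U)ᴴ := by
    rw [Matrix.blockDiagonal_conjTranspose, ← Matrix.blockDiagonal_diagonal fun x i => (p x i : ℂ),
      ← Matrix.blockDiagonal_mul, ← Matrix.blockDiagonal_mul, e]
  rw [e2, entropy_conj_diagonal, Fintype.sum_prod_type_right]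
  · exact Finset.sum_congr rfl fun x _ => by
      conv_rhs => rw [h3 x, entropy_conj_diagonal _ (h1 x)]
  · rw [Matrix.blockDiagonal_conjTranspose, ← Matrix.blockDiagonal_mul]
    simp only [h1]
    exact Matrix.blockDiagonal_one

theorem entropy_smul (c : ℝ) {M : Matrix n n ℂ} (hM : M.IsHermitian) :
    entropy ((c : ℂ) • M) = c * entropy M + Real.negMulLog c * M.trace.re := by
  obtain ⟨U, p, h1, _, rfl⟩ := exists_spectral hM
  have e : (c : ℂ) • (U * Matrix.diagonal (fun i => (p i : ℂ)) * Uᴴ)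
      = U * Matrix.diagonal (fun i => ((c * p i : ℝ) : ℂ)) * Uᴴ := by
    rw [← Matrix.smul_mul, ← Matrix.mul_smul, ← Matrix.diagonal_smul]
    congr; ext i; simp
  rw [e, entropy_conj_diagonal _ h1, entropy_conj_diagonal _ h1, trace_conj_diagonal h1,
    Complex.ofReal_re, Finset.mul_sum, Finset.mul_sum, ← Finset.sum_add_distrib]
  exact Finset.sum_congr rfl fun i _ => by rw [Real.negMulLog_mul]; ring

omit [DecidableEq n] in
theorem sum_negMulLog_le_log_card (p : n → ℝ) (hp : ∀ i, 0 ≤ p i) (h1 : ∑ i, p i = 1) :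
    ∑ i, Real.negMulLog (p i) ≤ Real.log (Fintype.card n) := by
  have hne : Nonempty n := by
    by_contra h
    rw [not_nonempty_iff] at h
    simp at h1
  have hc : (0 : ℝ) < Fintype.card n := by exact_mod_cast Fintype.card_pos
  have h := Real.concaveOn_negMulLog.le_map_sum (t := Finset.univ)
    (w := fun _ : n => (1 : ℝ) / Fintype.card n) (p := p) (fun _ _ => by positivity)
    (by simp) (fun i _ => hp i)
  simp only [smul_eq_mul, ← Finset.mul_sum, h1, mul_one] at h
  rw [Real.negMulLog, one_div, Real.log_inv] at h
  have h' := mul_le_mul_of_nonneg_left h hc.le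
  rw [← mul_assoc, mul_inv_cancel₀ hc.ne', one_mul] at h'
  calc _ ≤ _ := h'
    _ = Real.log (Fintype.card n) := by field_simp

theorem entropy_le_log_card {M : Matrix n n ℂ} (hM : M.PosSemidef) (h1 : M.trace = 1) :
    entropy M ≤ Real.log (Fintype.card n) := by
  obtain ⟨U, p, hU, _, hp, rfl⟩ := exists_spectral_posSemidef hM
  rw [trace_conj_diagonal hU] at h1
  rw [entropy_conj_diagonal _ hU]
  exact sum_negMulLog_le_log_card p hp (by exact_mod_cast h1)

end Entropy

/-! ### Completely positive maps in Kraus form -/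

section Kraus

variable {r m n : Type*} [Fintype r] [Fintype m] [Fintype n]

/-- The completely positive map `ρ ↦ ∑ᵣ Kᵣ ρ Kᵣ†` with Kraus operators `K`. -/
def krausMap (K : r → Matrix m n ℂ) (ρ : Matrix n n ℂ) : Matrix m m ℂ :=
  ∑ i, K i * ρ * (K i)ᴴ

/-- The adjoint of `krausMap K` for the Hilbert-Schmidt inner product. -/
def krausAdj (K : r → Matrix m n ℂ) (X : Matrix m m ℂ) : Matrix n n ℂ :=
  ∑ i, (K i)ᴴ * X * K i

theorem posSemidef_krausMap (K : r → Matrix m n ℂ) {ρ : Matrix n n ℂ} (hρ : ρ.PosSemidef) :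
    (krausMap K ρ).PosSemidef :=
  Matrix.posSemidef_sum _ fun i _ => hρ.mul_mul_conjTranspose_same (K i)

omit [Fintype m] in
theorem krausMap_sub (K : r → Matrix m n ℂ) (ρ σ : Matrix n n ℂ) :
    krausMap K (ρ - σ) = krausMap K ρ - krausMap K σ := by
  simp [krausMap, Matrix.mul_sub, Matrix.sub_mul]

theorem trace_mul_krausMap (K : r → Matrix m n ℂ) (X : Matrix m m ℂ) (ρ : Matrix n n ℂ) :
    (X * krausMap K ρ).trace = (krausAdj K X * ρ).trace := by
  simp only [krausMap, krausAdj, Matrix.mul_sum, Matrix.sum_mul, Matrix.trace_sum]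
  refine Finset.sum_congr rfl fun i _ => ?_
  rw [← Matrix.mul_assoc, ← Matrix.mul_assoc, Matrix.trace_mul_comm]
  simp only [Matrix.mul_assoc]

omit [Fintype n] in
theorem krausAdj_conjTranspose (K : r → Matrix m n ℂ) (X : Matrix m m ℂ) :
    (krausAdj K X)ᴴ = krausAdj K Xᴴ := by
  simp [krausAdj, Matrix.conjTranspose_sum, Matrix.mul_assoc]

theorem trace_krausMap [DecidableEq m] [DecidableEq n] {K : r → Matrix m n ℂ}
    (hK : ∑ i, (K i)ᴴ * K i = 1) (ρ : Matrix n n ℂ) :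
    (krausMap K ρ).trace = ρ.trace := by
  have := trace_mul_krausMap K 1 ρ
  simpa [krausAdj, hK] using this

theorem re_trace_conj_nonneg {τ : Matrix n n ℂ} (hτ : τ.PosSemidef) (D : Matrix n m ℂ) :
    0 ≤ (Dᴴ * τ * D).trace.re := by
  have h := (hτ.conjTranspose_mul_mul_same D).trace_nonneg
  exact (Complex.nonneg_iff.mp h).1

/-- The Kadison-Schwarz inequality `Φ†(X) Φ†(X)† ≤ Φ†(X X†)`, tested against a positive `τ`. -/
theorem krausAdj_schwarz [DecidableEq n] {K : r → Matrix m n ℂ} (hK : ∑ i, (K i)ᴴ * K i = 1)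
    {τ : Matrix n n ℂ} (hτ : τ.PosSemidef) (X : Matrix m m ℂ) :
    (τ * (krausAdj K X * (krausAdj K X)ᴴ)).trace.re ≤ (τ * krausAdj K (X * Xᴴ)).trace.re := by
  set Z := krausAdj K X with hZ
  have key : ∑ i, ((K i)ᴴ * X - Z * (K i)ᴴ) * ((K i)ᴴ * X - Z * (K i)ᴴ)ᴴ
      = krausAdj K (X * Xᴴ) - Z * Zᴴ := by
    have e : ∀ i, ((K i)ᴴ * X - Z * (K i)ᴴ) * ((K i)ᴴ * X - Z * (K i)ᴴ)ᴴ
        = (K i)ᴴ * (X * Xᴴ) * K i - ((K i)ᴴ * X * K i) * Zᴴ - Z * ((K i)ᴴ * Xᴴ * K i)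
          + Z * ((K i)ᴴ * K i) * Zᴴ := by
      intro i
      simp only [Matrix.conjTranspose_sub, Matrix.conjTranspose_mul,
        Matrix.conjTranspose_conjTranspose]
      simp only [Matrix.sub_mul, Matrix.mul_sub, Matrix.mul_assoc]
      abel
    simp only [e]
    rw [Finset.sum_add_distrib, Finset.sum_sub_distrib, Finset.sum_sub_distrib, ← Finset.sum_mul,
      ← Finset.mul_sum, ← Finset.sum_mul, ← Finset.mul_sum, hK, Matrix.mul_one]
    have h1 : ∑ i, (K i)ᴴ * X * K i = Z := rfl
    have h2 : ∑ i, (K i)ᴴ * Xᴴ * K i = Zᴴ := (krausAdj_conjTranspose K X).symm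
    rw [h1, h2]
    change krausAdj K (X * Xᴴ) - _ - _ + _ = _
    abel
  have h3 : 0 ≤ (τ * (krausAdj K (X * Xᴴ) - Z * Zᴴ)).trace.re := by
    rw [← key, Matrix.mul_sum, Matrix.trace_sum, Complex.re_sum]
    refine Finset.sum_nonneg fun i _ => ?_
    rw [← Matrix.mul_assoc, Matrix.trace_mul_comm, ← Matrix.mul_assoc]
    exact re_trace_conj_nonneg hτ _
  rw [Matrix.mul_sub, Matrix.trace_sub, Complex.sub_re] at h3
  linarith

end Kraus

/-! ### Monotonicity of the relative entropy -/

section RelEnt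

variable {r m n : Type*} [Fintype r] [Fintype m] [Fintype n] [DecidableEq m] [DecidableEq n]

/-- The concave quadratic form in `X` whose supremum is the quadratic relative entropy
`⟨ρ - σ, ((1 - s) L_ρ + s R_σ)⁻¹ (ρ - σ)⟩`. -/
def testForm (ρ σ : Matrix n n ℂ) (s : ℝ) (X : Matrix n n ℂ) : ℝ :=
  2 * (Xᴴ * (ρ - σ)).trace.re - (1 - s) * (Xᴴ * ρ * X).trace.re - s * (Xᴴ * X * σ).trace.re

omit [DecidableEq m] in
/-- Pulling a test operator back along the adjoint map increases the quadratic form, by the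
Kadison-Schwarz inequality for both positive terms. -/
theorem testForm_krausMap_le {K : r → Matrix m n ℂ} (hK : ∑ i, (K i)ᴴ * K i = 1)
    {ρ σ : Matrix n n ℂ} (hρ : ρ.PosSemidef) (hσ : σ.PosSemidef) {s : ℝ} (h0 : 0 ≤ s)
    (h1 : s ≤ 1) (X : Matrix m m ℂ) :
    testForm (krausMap K ρ) (krausMap K σ) s X ≤ testForm ρ σ s (krausAdj K X) := by
  have e1 : (Xᴴ * (krausMap K ρ - krausMap K σ)).trace
      = ((krausAdj K X)ᴴ * (ρ - σ)).trace := by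
    rw [← krausMap_sub, trace_mul_krausMap, krausAdj_conjTranspose]
  have e2 : ((krausAdj K X)ᴴ * ρ * krausAdj K X).trace.re ≤ (Xᴴ * krausMap K ρ * X).trace.re := by
    have h := krausAdj_schwarz hK hρ X
    rw [Matrix.mul_assoc, Matrix.trace_mul_comm, Matrix.mul_assoc, Matrix.mul_assoc Xᴴ,
      Matrix.trace_mul_comm Xᴴ, Matrix.mul_assoc, Matrix.trace_mul_comm (krausMap K ρ),
      trace_mul_krausMap, Matrix.trace_mul_comm _ ρ]
    exact h
  have e3 : ((krausAdj K X)ᴴ * krausAdj K X * σ).trace.re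
      ≤ (Xᴴ * X * krausMap K σ).trace.re := by
    have h := krausAdj_schwarz hK hσ Xᴴ
    rw [krausAdj_conjTranspose, Matrix.conjTranspose_conjTranspose] at h
    rw [krausAdj_conjTranspose, trace_mul_krausMap, Matrix.trace_mul_comm _ σ,
      Matrix.trace_mul_comm _ σ]
    exact h
  unfold testForm
  rw [e1]
  have := mul_le_mul_of_nonneg_left e2 (sub_nonneg.mpr h1)
  have := mul_le_mul_of_nonneg_left e3 h0
  linarith

/-- The quadratic relative entropy in terms of the eigenvalues `p`, `q` of the two operators and
the squared overlaps `w` of their eigenvectors. -/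
def quadRel (w : n → n → ℝ) (p q : n → ℝ) (s : ℝ) : ℝ :=
  ∑ i, ∑ j, w i j * ((p i - q j) ^ 2 / ((1 - s) * p i + s * q j))

theorem testForm_spectral {U V : Matrix n n ℂ} (hU : Uᴴ * U = 1) (hV : Vᴴ * V = 1)
    (p q : n → ℝ) (s : ℝ) (Z : Matrix n n ℂ) :
    testForm (U * Matrix.diagonal (fun i => (p i : ℂ)) * Uᴴ)
        (V * Matrix.diagonal (fun i => (q i : ℂ)) * Vᴴ) s (U * Z * Vᴴ)
      = ∑ i, ∑ j, (2 * (p i - q j) * (conj (Z i j) * (Uᴴ * V) i j).re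
          - ((1 - s) * p i + s * q j) * Complex.normSq (Z i j)) := by
  set P := Matrix.diagonal (fun i => (p i : ℂ))
  set Q := Matrix.diagonal (fun i => (q i : ℂ))
  have e1 : ((U * Z * Vᴴ)ᴴ * (U * P * Uᴴ - V * Q * Vᴴ)).trace
      = (Zᴴ * (P * (Uᴴ * V)) - Zᴴ * (Uᴴ * V * Q)).trace := by
    simp only [Matrix.conjTranspose_mul, Matrix.conjTranspose_conjTranspose, Matrix.mul_sub,
      Matrix.trace_sub]
    congr 1
    · rw [Matrix.mul_assoc, Matrix.trace_mul_comm]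
      simp only [Matrix.mul_assoc]
      rw [← Matrix.mul_assoc Uᴴ U, hU, Matrix.one_mul]
    · rw [Matrix.mul_assoc, Matrix.trace_mul_comm]
      simp only [Matrix.mul_assoc]
      rw [hV, Matrix.mul_one]
  have e2 : ((U * Z * Vᴴ)ᴴ * (U * P * Uᴴ) * (U * Z * Vᴴ)).trace = (Zᴴ * (P * Z)).trace := by
    simp only [Matrix.conjTranspose_mul, Matrix.conjTranspose_conjTranspose, Matrix.mul_assoc]
    rw [Matrix.trace_mul_comm]
    simp only [Matrix.mul_assoc]
    rw [← Matrix.mul_assoc Uᴴ U, hU, Matrix.one_mul, ← Matrix.mul_assoc Uᴴ U, hU, Matrix.one_mul,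
      hV, Matrix.mul_one]
  have e3 : ((U * Z * Vᴴ)ᴴ * (U * Z * Vᴴ) * (V * Q * Vᴴ)).trace = (Zᴴ * (Z * Q)).trace := by
    simp only [Matrix.conjTranspose_mul, Matrix.conjTranspose_conjTranspose, Matrix.mul_assoc]
    rw [Matrix.trace_mul_comm]
    simp only [Matrix.mul_assoc]
    rw [← Matrix.mul_assoc Uᴴ U, hU, Matrix.one_mul, hV, Matrix.mul_one, ← Matrix.mul_assoc Vᴴ V,
      hV, Matrix.one_mul]
  unfold testForm
  rw [e1, e2, e3, Matrix.trace_sub, Matrix.trace, Matrix.trace, Matrix.trace, Matrix.trace]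
  simp only [Matrix.diag_apply, Matrix.mul_apply (M := Zᴴ), P, Q, Matrix.diagonal_mul,
    Matrix.mul_diagonal, Matrix.conjTranspose_apply, Complex.sub_re, Complex.re_sum,
    Finset.mul_sum, ← Finset.sum_sub_distrib]
  rw [Finset.sum_comm]
  refine Finset.sum_congr rfl fun i _ => Finset.sum_congr rfl fun j _ => ?_
  simp only [Complex.normSq_apply, Complex.mul_re, Complex.mul_im, Complex.ofReal_re,
    Complex.ofReal_im, Complex.star_def, Complex.conj_re, Complex.conj_im]
  ring

theorem testForm_le_quadRel {U V : Matrix n n ℂ} (hU : Uᴴ * U = 1) (hV : Vᴴ * V = 1)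
    {p q : n → ℝ} (hp : ∀ i, 0 ≤ p i) (hq : ∀ i, 0 ≤ q i) {s : ℝ} (h0 : 0 < s) (h1 : s < 1)
    (X : Matrix n n ℂ) :
    testForm (U * Matrix.diagonal (fun i => (p i : ℂ)) * Uᴴ)
        (V * Matrix.diagonal (fun i => (q i : ℂ)) * Vᴴ) s X
      ≤ quadRel (fun i j => Complex.normSq ((Uᴴ * V) i j)) p q s := by
  have hX : X = U * (Uᴴ * X * V) * Vᴴ := by
    have hU' := mul_eq_one_comm.mp hU
    have hV' := mul_eq_one_comm.mp hV
    simp only [Matrix.mul_assoc]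
    rw [hV', Matrix.mul_one, ← Matrix.mul_assoc, hU', Matrix.one_mul]
  rw [hX, testForm_spectral hU hV]
  refine Finset.sum_le_sum fun i _ => Finset.sum_le_sum fun j _ => ?_
  generalize (Uᴴ * X * V) i j = z
  have hc : 0 ≤ (1 - s) * p i + s * q j :=
    add_nonneg (mul_nonneg (by linarith) (hp i)) (mul_nonneg h0.le (hq j))
  rcases hc.eq_or_lt with hc | hc
  · have hpi : p i = 0 := by
      nlinarith [hp i, hq j, mul_nonneg (sub_nonneg.mpr h1.le) (hp i), mul_nonneg h0.le (hq j)]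
    have hqj : q j = 0 := by
      nlinarith [hp i, hq j, mul_nonneg (sub_nonneg.mpr h1.le) (hp i), mul_nonneg h0.le (hq j)]
    simp [hpi, hqj]
  · rw [← mul_div_assoc, le_div_iff₀ hc]
    set c := (1 - s) * p i + s * q j
    beta_reduce
    generalize (Uᴴ * V) i j = w
    simp only [Complex.normSq_apply, Complex.mul_re, Complex.conj_re, Complex.conj_im]
    nlinarith [sq_nonneg (c * z.re - (p i - q j) * w.re),
      sq_nonneg (c * z.im - (p i - q j) * w.im)]

/-- The supremum in `testForm_le_quadRel` is attained; where the denominator vanishes, division by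
zero gives the value `0` that is needed. -/
theorem exists_testForm_eq_quadRel {U V : Matrix n n ℂ} (hU : Uᴴ * U = 1) (hV : Vᴴ * V = 1)
    (p q : n → ℝ) (s : ℝ) :
    ∃ X, quadRel (fun i j => Complex.normSq ((Uᴴ * V) i j)) p q s
      = testForm (U * Matrix.diagonal (fun i => (p i : ℂ)) * Uᴴ)
        (V * Matrix.diagonal (fun i => (q i : ℂ)) * Vᴴ) s X := by
  refine ⟨U * (Matrix.of fun i j =>
    (((p i - q j) / ((1 - s) * p i + s * q j) : ℝ) : ℂ) * (Uᴴ * V) i j) * Vᴴ, ?_⟩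
  rw [testForm_spectral hU hV]
  refine Finset.sum_congr rfl fun i _ => Finset.sum_congr rfl fun j _ => ?_
  rw [Matrix.of_apply]
  beta_reduce
  generalize (Uᴴ * V) i j = w
  set c := (1 - s) * p i + s * q j
  simp only [Complex.normSq_apply, Complex.mul_re, Complex.mul_im, Complex.conj_re,
    Complex.conj_im, Complex.ofReal_re, Complex.ofReal_im]
  rcases eq_or_ne c 0 with hc | hc
  · simp [hc]
  · field_simp
    ring

/-- The relative entropy `D(ρ‖σ) - Tr ρ + Tr σ` in terms of the eigenvalues `p`, `q` of the two
operators and the squared overlaps `w` of their eigenvectors. -/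
def relEnt (w : n → n → ℝ) (p q : n → ℝ) : ℝ :=
  ∑ i, ∑ j, w i j * (p i * Real.log (p i) - p i * Real.log (q j) - p i + q j)

/-- The function of `s` that increases from `s = 0` to `s = 1` by the relative entropy and whose
derivative is `s` times the quadratic relative entropy. -/
def relPath (w : n → n → ℝ) (p q : n → ℝ) (s : ℝ) : ℝ :=
  ∑ i, ∑ j, w i j * (((1 - s) * p i + s * q j) - p i * Real.log ((1 - s) * p i + s * q j))

omit [DecidableEq n] in
theorem relPath_one_sub_zero (w : n → n → ℝ) (p q : n → ℝ) :
    relPath w p q 1 - relPath w p q 0 = relEnt w p q := by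
  simp only [relPath, relEnt, ← Finset.sum_sub_distrib]
  refine Finset.sum_congr rfl fun i _ => Finset.sum_congr rfl fun j _ => ?_
  simp
  ring

omit [DecidableEq n] in
theorem continuousOn_relPath {w : n → n → ℝ} {p q : n → ℝ} (hp : ∀ i, 0 ≤ p i)
    (hq : ∀ i, 0 ≤ q i) (hs : ∀ i j, q j = 0 → p i = 0 ∨ w i j = 0) :
    ContinuousOn (relPath w p q) (Set.Icc 0 1) := by
  refine continuousOn_finsetSum _ fun i _ => continuousOn_finsetSum _ fun j _ => ?_
  rcases eq_or_ne (w i j) 0 with h | h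
  · simp only [h, zero_mul]; exact continuousOn_const
  rcases eq_or_ne (p i) 0 with h' | h'
  · simp only [h', zero_mul]; fun_prop
  have hpi := lt_of_le_of_ne (hp i) h'.symm
  have hqj : 0 < q j := lt_of_le_of_ne (hq j) fun h0 => by
    rcases hs i j h0.symm with h1 | h1 <;> contradiction
  have hc : ∀ s ∈ Set.Icc (0 : ℝ) 1, (1 - s) * p i + s * q j ≠ 0 := by
    intro s hs
    have : 0 < (1 - s) * p i + s * q j := by
      rcases hs.2.eq_or_lt with h | h
      · rw [h]; simpa using hqj
      · exact add_pos_of_pos_of_nonneg (mul_pos (by linarith) hpi) (mul_nonneg hs.1 hqj.le)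
    exact this.ne'
  refine continuousOn_const.mul (ContinuousOn.sub (by fun_prop) (continuousOn_const.mul ?_))
  exact ContinuousOn.log (by fun_prop) hc

omit [DecidableEq n] in
theorem hasDerivAt_relPath {w : n → n → ℝ} {p q : n → ℝ} (hp : ∀ i, 0 ≤ p i)
    (hq : ∀ i, 0 ≤ q i) {s : ℝ} (h0 : 0 < s) (h1 : s < 1) :
    HasDerivAt (relPath w p q) (s * quadRel w p q s) s := by
  unfold relPath quadRel
  simp only [Finset.mul_sum]
  refine HasDerivAt.fun_sum fun i _ => HasDerivAt.fun_sum fun j _ => ?_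
  rw [mul_left_comm]
  refine HasDerivAt.const_mul _ ?_
  have hl : HasDerivAt (fun s => (1 - s) * p i + s * q j) (q j - p i) s := by
    have h := (((hasDerivAt_id s).const_sub 1).mul_const (p i)).add
      ((hasDerivAt_id s).mul_const (q j))
    convert! h using 1
    ring
  have hc : 0 ≤ (1 - s) * p i + s * q j :=
    add_nonneg (mul_nonneg (by linarith) (hp i)) (mul_nonneg h0.le (hq j))
  rcases hc.eq_or_lt with hc | hc
  · have hpi : p i = 0 := by
      nlinarith [hp i, hq j, mul_nonneg (sub_nonneg.mpr h1.le) (hp i), mul_nonneg h0.le (hq j)]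
    have hqj : q j = 0 := by
      nlinarith [hp i, hq j, mul_nonneg (sub_nonneg.mpr h1.le) (hp i), mul_nonneg h0.le (hq j)]
    simp only [hpi, hqj]
    simpa using hasDerivAt_const s (0 : ℝ)
  · convert! hl.sub ((hl.log hc.ne').const_mul (p i)) using 1
    have hc' := hc.ne'
    rw [mul_div_assoc', mul_div_assoc', eq_sub_iff_add_eq, ← add_div, div_eq_iff hc']
    ring

/-- **Data processing**: the relative entropy does not increase under a completely positive trace
preserving map. The quadratic relative entropies do not increase, since a test operator for the
outputs is pulled back to one for the inputs, and integrating over `s` gives the claim. -/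
theorem relEnt_krausMap_le {K : r → Matrix m n ℂ} (hK : ∑ i, (K i)ᴴ * K i = 1)
    {U V : Matrix n n ℂ} (hU : Uᴴ * U = 1) (hV : Vᴴ * V = 1)
    {p q : n → ℝ} (hp : ∀ i, 0 ≤ p i) (hq : ∀ i, 0 ≤ q i)
    (hs : ∀ i j, q j = 0 → p i = 0 ∨ Complex.normSq ((Uᴴ * V) i j) = 0)
    {U' V' : Matrix m m ℂ} (hU' : U'ᴴ * U' = 1) (hV' : V'ᴴ * V' = 1)
    {p' q' : m → ℝ} (hp' : ∀ i, 0 ≤ p' i) (hq' : ∀ i, 0 ≤ q' i)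
    (hs' : ∀ i j, q' j = 0 → p' i = 0 ∨ Complex.normSq ((U'ᴴ * V') i j) = 0)
    (hρ : krausMap K (U * Matrix.diagonal (fun i => (p i : ℂ)) * Uᴴ)
      = U' * Matrix.diagonal (fun i => (p' i : ℂ)) * U'ᴴ)
    (hσ : krausMap K (V * Matrix.diagonal (fun i => (q i : ℂ)) * Vᴴ)
      = V' * Matrix.diagonal (fun i => (q' i : ℂ)) * V'ᴴ) :
    relEnt (fun i j => Complex.normSq ((U'ᴴ * V') i j)) p' q'
      ≤ relEnt (fun i j => Complex.normSq ((Uᴴ * V) i j)) p q := by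
  have hpos : ∀ (W : Matrix n n ℂ) (t : n → ℝ), (∀ i, 0 ≤ t i) →
      (W * Matrix.diagonal (fun i => (t i : ℂ)) * Wᴴ).PosSemidef := fun W t ht =>
    (Matrix.posSemidef_diagonal_iff.mpr fun i => by exact_mod_cast ht i).mul_mul_conjTranspose_same
      W
  have hQ : ∀ s ∈ Set.Ioo (0 : ℝ) 1,
      quadRel (fun i j => Complex.normSq ((U'ᴴ * V') i j)) p' q' s
        ≤ quadRel (fun i j => Complex.normSq ((Uᴴ * V) i j)) p q s := by
    intro s hs
    obtain ⟨X, hX⟩ := exists_testForm_eq_quadRel hU' hV' p' q' s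
    rw [hX, ← hρ, ← hσ]
    exact (testForm_krausMap_le hK (hpos U p hp) (hpos V q hq) hs.1.le hs.2.le X).trans
      (testForm_le_quadRel hU hV hp hq hs.1 hs.2 _)
  rw [← relPath_one_sub_zero, ← relPath_one_sub_zero]
  have hmono : MonotoneOn (fun s => relPath (fun i j => Complex.normSq ((Uᴴ * V) i j)) p q s
      - relPath (fun i j => Complex.normSq ((U'ᴴ * V') i j)) p' q' s) (Set.Icc 0 1) := by
    refine monotoneOn_of_deriv_nonneg (convex_Icc 0 1)
      ((continuousOn_relPath hp hq hs).sub (continuousOn_relPath hp' hq' hs')) ?_ ?_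
    · intro s hs
      rw [interior_Icc] at hs
      exact ((hasDerivAt_relPath hp hq hs.1 hs.2).sub
        (hasDerivAt_relPath hp' hq' hs.1 hs.2)).differentiableAt.differentiableWithinAt
    · intro s hs
      rw [interior_Icc] at hs
      have hd := (hasDerivAt_relPath (w := fun i j => Complex.normSq ((Uᴴ * V) i j))
        hp hq hs.1 hs.2).sub (hasDerivAt_relPath
          (w := fun i j => Complex.normSq ((U'ᴴ * V') i j)) hp' hq' hs.1 hs.2)
      have := hd.deriv
      erw [this]
      rw [← mul_sub]
      exact mul_nonneg hs.1.le (sub_nonneg.mpr (hQ s hs))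
  have := hmono (Set.left_mem_Icc.mpr zero_le_one) (Set.right_mem_Icc.mpr zero_le_one) zero_le_one
  simp only at this
  linarith

end RelEnt

/-! ### Monotonicity of the conditional entropy -/

section CondEntropy

open scoped Kronecker

variable {r a b c y : Type*} [Fintype r] [Fintype a] [Fintype b] [Fintype c] [Fintype y]
  [DecidableEq a] [DecidableEq b] [DecidableEq c] [DecidableEq y]

omit [Fintype a] [DecidableEq a] [DecidableEq c] in
theorem traceSnd_apply (ρ : Matrix (a × c) (a × c) ℂ) (i i' : a) :
    traceSnd ρ i i' = ∑ l, ρ (i, l) (i', l) := rfl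

omit [DecidableEq a] [DecidableEq c] in
theorem trace_traceSnd (ρ : Matrix (a × c) (a × c) ℂ) : (traceSnd ρ).trace = ρ.trace := by
  simp [Matrix.trace, traceSnd_apply, Fintype.sum_prod_type]

omit [Fintype a] [DecidableEq a] [DecidableEq c] in
theorem posSemidef_traceSnd {ρ : Matrix (a × c) (a × c) ℂ} (hρ : ρ.PosSemidef) :
    (traceSnd ρ).PosSemidef := by
  have e : traceSnd ρ = ∑ l, ρ.submatrix (fun i => (i, l)) (fun i => (i, l)) := by
    ext i i'
    simp [traceSnd_apply, Matrix.sum_apply]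
  rw [e]
  exact Matrix.posSemidef_sum _ fun l _ => hρ.submatrix _

omit [Fintype b] [DecidableEq a] [DecidableEq b] in
theorem kronecker_one_mul_apply {v : Type*} (A : Matrix b a ℂ) (ρ : Matrix (a × c) v ℂ)
    (i : b) (l : c) (u : v) :
    ((A ⊗ₖ (1 : Matrix c c ℂ)) * ρ) (i, l) u = ∑ j, A i j * ρ (j, l) u := by
  simp [Matrix.mul_apply, Fintype.sum_prod_type, Matrix.one_apply]

omit [Fintype b] [DecidableEq a] [DecidableEq b] in
theorem mul_kronecker_one_apply {v : Type*} (A : Matrix a b ℂ) (ρ : Matrix v (a × c) ℂ)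
    (i : b) (l : c) (u : v) :
    (ρ * (A ⊗ₖ (1 : Matrix c c ℂ))) u (i, l) = ∑ j, ρ u (j, l) * A j i := by
  simp [Matrix.mul_apply, Fintype.sum_prod_type, Matrix.one_apply]

omit [Fintype b] [DecidableEq a] [DecidableEq b] in
theorem traceSnd_kronecker_conj (A : Matrix b a ℂ) (B : Matrix a b ℂ)
    (ρ : Matrix (a × c) (a × c) ℂ) :
    traceSnd ((A ⊗ₖ (1 : Matrix c c ℂ)) * ρ * (B ⊗ₖ (1 : Matrix c c ℂ)))
      = A * traceSnd ρ * B := by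
  ext i i'
  rw [traceSnd_apply]
  simp only [mul_kronecker_one_apply, kronecker_one_mul_apply]
  simp only [Matrix.mul_apply, traceSnd_apply, Finset.mul_sum, Finset.sum_mul]
  rw [Finset.sum_comm]
  refine Finset.sum_congr rfl fun j _ => ?_
  rw [Finset.sum_comm]

omit [Fintype b] [DecidableEq a] [DecidableEq b] in
theorem traceSnd_krausMap (K : r → Matrix b a ℂ) (ρ : Matrix (a × c) (a × c) ℂ) :
    traceSnd (krausMap (fun i => K i ⊗ₖ (1 : Matrix c c ℂ)) ρ) = krausMap K (traceSnd ρ) := by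
  simp only [krausMap, map_sum]
  refine Finset.sum_congr rfl fun i _ => ?_
  rw [Matrix.conjTranspose_kronecker, Matrix.conjTranspose_one, traceSnd_kronecker_conj]

omit [Fintype b] [DecidableEq a] [DecidableEq b] in
theorem krausMap_kronecker_one (K : r → Matrix b a ℂ) (τ : Matrix a a ℂ) :
    krausMap (fun i => K i ⊗ₖ (1 : Matrix c c ℂ)) (τ ⊗ₖ 1) = krausMap K τ ⊗ₖ 1 := by
  simp only [krausMap, Matrix.conjTranspose_kronecker, ← Matrix.mul_kronecker_mul,
    Matrix.conjTranspose_one, Matrix.mul_one]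
  ext ⟨i, l⟩ ⟨j, l'⟩
  simp [Matrix.sum_apply, Finset.sum_mul]

/-- The negative conditional entropy `H(A) - H(AC)` is, up to a trace, the relative entropy of `ρ`
with respect to `ρ_A ⊗ 1`. -/
theorem exists_relEnt_eq_condEntropy {ρ : Matrix (a × c) (a × c) ℂ} (hρ : ρ.PosSemidef) :
    ∃ (U V : Matrix (a × c) (a × c) ℂ) (p q : a × c → ℝ), Uᴴ * U = 1 ∧ Vᴴ * V = 1 ∧
      (∀ i, 0 ≤ p i) ∧ (∀ i, 0 ≤ q i) ∧
      (∀ i j, q j = 0 → p i = 0 ∨ Complex.normSq ((Uᴴ * V) i j) = 0) ∧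
      ρ = U * Matrix.diagonal (fun i => (p i : ℂ)) * Uᴴ ∧
      traceSnd ρ ⊗ₖ (1 : Matrix c c ℂ) = V * Matrix.diagonal (fun i => (q i : ℂ)) * Vᴴ ∧
      relEnt (fun i j => Complex.normSq ((Uᴴ * V) i j)) p q
        = entropy (traceSnd ρ) - entropy ρ + (Fintype.card c - 1) * ρ.trace.re := by
  obtain ⟨U, p, hU, hU', hp, hρe⟩ := exists_spectral_posSemidef hρ
  obtain ⟨T, t, hT, hT', ht, hτe⟩ := exists_spectral_posSemidef (posSemidef_traceSnd hρ)
  set V : Matrix (a × c) (a × c) ℂ := T ⊗ₖ (1 : Matrix c c ℂ) with hVdef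
  have hVV : Vᴴ * V = 1 := by
    rw [hVdef, Matrix.conjTranspose_kronecker, ← Matrix.mul_kronecker_mul, hT]; simp
  have hVV' : V * Vᴴ = 1 := mul_eq_one_comm.mp hVV
  set w : a × c → a × c → ℝ := fun i j => Complex.normSq ((Uᴴ * V) i j) with hw
  have hrow : ∀ i, ∑ j, w i j = 1 := by
    intro i
    have h : ((Uᴴ * V) * (Uᴴ * V)ᴴ) i i = 1 := by
      rw [Matrix.conjTranspose_mul, Matrix.conjTranspose_conjTranspose, Matrix.mul_assoc,
        ← Matrix.mul_assoc V, hVV', Matrix.one_mul, hU, Matrix.one_apply_eq]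
    rw [Matrix.mul_apply] at h
    simp only [Matrix.conjTranspose_apply, Complex.star_def, Complex.mul_conj] at h
    exact_mod_cast h
  have hcol : ∀ j, ∑ i, w i j = 1 := by
    intro j
    have h : ((Uᴴ * V)ᴴ * (Uᴴ * V)) j j = 1 := by
      rw [Matrix.conjTranspose_mul, Matrix.conjTranspose_conjTranspose, Matrix.mul_assoc,
        ← Matrix.mul_assoc U, hU', Matrix.one_mul, hVV, Matrix.one_apply_eq]
    rw [Matrix.mul_apply] at h
    simp only [Matrix.conjTranspose_apply, Complex.star_def, mul_comm (conj _),
      Complex.mul_conj] at h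
    exact_mod_cast h
  -- in the basis `V` the diagonal of `ρ` has the marginal `t`
  have hmarg : ∀ j, ∑ l, ∑ i, w i (j, l) * p i = t j := by
    intro j
    have h1 : traceSnd (Vᴴ * ρ * V) j j = (t j : ℂ) := by
      rw [hVdef, Matrix.conjTranspose_kronecker, Matrix.conjTranspose_one,
        traceSnd_kronecker_conj, hτe]
      rw [Matrix.mul_assoc, Matrix.mul_assoc (T * _), hT, Matrix.mul_one, ← Matrix.mul_assoc, hT,
        Matrix.one_mul, Matrix.diagonal_apply_eq]
    have h2 : Vᴴ * ρ * V = (Uᴴ * V)ᴴ * Matrix.diagonal (fun i => (p i : ℂ)) * (Uᴴ * V) := by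
      rw [Matrix.conjTranspose_mul, Matrix.conjTranspose_conjTranspose, hρe]
      simp only [Matrix.mul_assoc]
    rw [h2, traceSnd_apply] at h1
    have h3 : ∀ l, ((Uᴴ * V)ᴴ * Matrix.diagonal (fun i => (p i : ℂ)) * (Uᴴ * V)) (j, l) (j, l)
        = ((∑ i, w i (j, l) * p i : ℝ) : ℂ) := by
      intro l
      rw [Matrix.mul_apply]
      push_cast
      refine Finset.sum_congr rfl fun i _ => ?_
      rw [Matrix.mul_diagonal, Matrix.conjTranspose_apply, hw]
      simp only [Complex.star_def, Complex.normSq_eq_conj_mul_self]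
      ring
    simp only [h3] at h1
    exact_mod_cast h1
  have hw0 : ∀ i j, 0 ≤ w i j := fun i j => Complex.normSq_nonneg _
  refine ⟨U, V, p, fun v => t v.1, hU, hVV, hp, fun v => ht v.1, ?_, hρe, ?_, ?_⟩
  · rintro i ⟨j, l⟩ hj
    have h := hmarg j
    simp only at hj
    rw [hj, Finset.sum_eq_zero_iff_of_nonneg
      fun l _ => Finset.sum_nonneg fun i _ => mul_nonneg (hw0 _ _) (hp i)] at h
    have h' := h l (Finset.mem_univ l)
    rw [Finset.sum_eq_zero_iff_of_nonneg fun i _ => mul_nonneg (hw0 _ _) (hp i)] at h'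
    exact (mul_eq_zero.mp (h' i (Finset.mem_univ i))).symm
  · rw [hτe, hVdef, Matrix.conjTranspose_kronecker, Matrix.conjTranspose_one]
    have e : Matrix.diagonal (fun v : a × c => (t v.1 : ℂ))
        = Matrix.diagonal (fun i => (t i : ℂ)) ⊗ₖ (1 : Matrix c c ℂ) := by
      rw [← Matrix.diagonal_one, Matrix.diagonal_kronecker_diagonal]
      simp
    rw [e, ← Matrix.mul_kronecker_mul, ← Matrix.mul_kronecker_mul]
    simp
  · have et : ρ.trace.re = ∑ i, p i := by
      rw [hρe, trace_conj_diagonal hU, Complex.ofReal_re]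
    have et' : ρ.trace.re = ∑ j, t j := by
      rw [← trace_traceSnd, hτe, trace_conj_diagonal hT, Complex.ofReal_re]
    have eρ : entropy ρ = ∑ i, Real.negMulLog (p i) := by
      rw [hρe, entropy_conj_diagonal _ hU]
    have eτ : entropy (traceSnd ρ) = ∑ j, Real.negMulLog (t j) := by
      rw [hτe, entropy_conj_diagonal _ hT]
    have s1 : ∑ i, ∑ j, w i j * (p i * Real.log (p i) - p i) = -entropy ρ - ρ.trace.re := by
      simp only [← Finset.sum_mul, hrow, one_mul]
      rw [eρ, et, ← Finset.sum_neg_distrib, ← Finset.sum_sub_distrib]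
      exact Finset.sum_congr rfl fun i _ => by rw [Real.negMulLog]; ring
    have s2 : ∑ i, ∑ j : a × c, w i j * t j.1 = Fintype.card c * ρ.trace.re := by
      rw [Finset.sum_comm]
      simp only [← Finset.sum_mul, hcol, one_mul]
      rw [Fintype.sum_prod_type, et']
      simp [Finset.mul_sum]
    have s3 : ∑ i, ∑ j : a × c, w i j * (p i * Real.log (t j.1)) = - entropy (traceSnd ρ) := by
      rw [Finset.sum_comm, Fintype.sum_prod_type, eτ, ← Finset.sum_neg_distrib]
      refine Finset.sum_congr rfl fun j _ => ?_
      simp only [← mul_assoc, ← Finset.sum_mul, hmarg]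
      rw [Real.negMulLog]; ring
    have s4 : relEnt w p (fun v => t v.1)
        = ∑ i, ∑ j, w i j * (p i * Real.log (p i) - p i)
          + ∑ i, ∑ j : a × c, w i j * t j.1
          - ∑ i, ∑ j : a × c, w i j * (p i * Real.log (t j.1)) := by
      simp only [relEnt, ← Finset.sum_add_distrib, ← Finset.sum_sub_distrib]
      exact Finset.sum_congr rfl fun i _ => Finset.sum_congr rfl fun j _ => by ring
    rw [s4, s1, s2, s3]
    ring

/-- Processing the conditioning system `A` does not decrease the conditional entropy `H(C|A)`. -/
theorem condEntropy_le_krausMap {K : r → Matrix b a ℂ} (hK : ∑ i, (K i)ᴴ * K i = 1)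
    {ρ : Matrix (a × c) (a × c) ℂ} (hρ : ρ.PosSemidef) :
    entropy ρ - entropy (traceSnd ρ)
      ≤ entropy (krausMap (fun i => K i ⊗ₖ (1 : Matrix c c ℂ)) ρ)
        - entropy (krausMap K (traceSnd ρ)) := by
  have hK' : ∑ i, (K i ⊗ₖ (1 : Matrix c c ℂ))ᴴ * (K i ⊗ₖ (1 : Matrix c c ℂ)) = 1 := by
    simp only [Matrix.conjTranspose_kronecker, ← Matrix.mul_kronecker_mul,
      Matrix.conjTranspose_one, Matrix.mul_one]
    have : ∑ i, ((K i)ᴴ * K i) ⊗ₖ (1 : Matrix c c ℂ) = (∑ i, (K i)ᴴ * K i) ⊗ₖ 1 := by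
      ext ⟨i, l⟩ ⟨j, l'⟩
      simp [Matrix.sum_apply, Finset.sum_mul]
    rw [this, hK, Matrix.one_kronecker_one]
  obtain ⟨U, V, p, q, hU, hV, hp, hq, hs, h1, h2, h3⟩ := exists_relEnt_eq_condEntropy hρ
  obtain ⟨U', V', p', q', hU', hV', hp', hq', hs', h1', h2', h3'⟩ :=
    exists_relEnt_eq_condEntropy
      (posSemidef_krausMap (fun i => K i ⊗ₖ (1 : Matrix c c ℂ)) hρ)
  have h := relEnt_krausMap_le hK' hU hV hp hq hs hU' hV' hp' hq' hs' (h1 ▸ h1')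
    (by rw [← h2, ← h2', krausMap_kronecker_one, traceSnd_krausMap])
  rw [h3, h3', traceSnd_krausMap, trace_krausMap hK'] at h
  linarith

/-- The unnormalized state `(⟨m̄| ⊗ 1) ρ (|m̄⟩ ⊗ 1)` of the second system. -/
def slice (m : a → ℂ) (ρ : Matrix (a × c) (a × c) ℂ) : Matrix c c ℂ :=
  Matrix.of fun l l' => ∑ i, ∑ i', m i * ρ (i, l) (i', l') * conj (m i')

/-- The operator `⟨m̄| ⊗ 1`. -/
def rowKron (m : a → ℂ) : Matrix c (a × c) ℂ :=
  Matrix.of fun l v => if l = v.2 then m v.1 else 0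

omit [DecidableEq a] in
theorem slice_eq (m : a → ℂ) (ρ : Matrix (a × c) (a × c) ℂ) :
    slice m ρ = (rowKron m : Matrix c (a × c) ℂ) * ρ * (rowKron m : Matrix c (a × c) ℂ)ᴴ := by
  ext l l'
  simp only [slice, Matrix.of_apply, Matrix.mul_apply, Fintype.sum_prod_type, rowKron,
    Matrix.conjTranspose_apply, Finset.sum_mul, apply_ite star, star_zero, mul_ite, mul_zero,
    ite_mul, zero_mul, Finset.sum_ite_eq, Finset.mem_univ, if_true, Complex.star_def]
  rw [Finset.sum_comm]

omit [DecidableEq a] in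
theorem posSemidef_slice (m : a → ℂ) {ρ : Matrix (a × c) (a × c) ℂ} (hρ : ρ.PosSemidef) :
    (slice m ρ).PosSemidef := by
  rw [slice_eq]
  exact hρ.mul_mul_conjTranspose_same _

omit [DecidableEq c] [DecidableEq y] in
theorem sum_trace_slice {W : Matrix y a ℂ} (hW : Wᴴ * W = 1) (ρ : Matrix (a × c) (a × c) ℂ) :
    ∑ x, (slice (W x) ρ).trace = ρ.trace := by
  have h : ∀ i i', ∑ x, W x i * conj (W x i') = if i = i' then 1 else 0 := by
    intro i i'
    have := congrFun (congrFun hW i') i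
    rw [Matrix.mul_apply, Matrix.one_apply] at this
    simp only [Matrix.conjTranspose_apply, Complex.star_def] at this
    simp only [mul_comm (W _ i), this, eq_comm]
  calc ∑ x, (slice (W x) ρ).trace
      = ∑ l, ∑ i, ∑ i', ρ (i, l) (i', l) * ∑ x, W x i * conj (W x i') := by
        simp only [Matrix.trace, Matrix.diag_apply, slice, Matrix.of_apply, Finset.mul_sum]
        rw [Finset.sum_comm]
        refine Finset.sum_congr rfl fun l _ => ?_
        rw [Finset.sum_comm]
        refine Finset.sum_congr rfl fun i _ => ?_
        rw [Finset.sum_comm]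
        exact Finset.sum_congr rfl fun i' _ => Finset.sum_congr rfl fun x _ => by ring
    _ = ρ.trace := by
        simp only [h, mul_ite, mul_one, mul_zero, Finset.sum_ite_eq, Finset.mem_univ, if_true]
        rw [Matrix.trace, Fintype.sum_prod_type, Finset.sum_comm]
        rfl

omit [Fintype y] [DecidableEq c] in
theorem traceSnd_blocks (M : y → Matrix c c ℂ) :
    traceSnd (blocks M) = Matrix.diagonal fun x => (M x).trace := by
  ext x x'
  rw [traceSnd_apply, Matrix.diagonal_apply]
  by_cases h : x = x' <;> simp [blocks, h, Matrix.trace]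

omit [DecidableEq c] in
theorem entropy_diagonal_trace {M : y → Matrix c c ℂ} (hM : ∀ x, (M x).PosSemidef) :
    entropy (Matrix.diagonal fun x => (M x).trace)
      = ∑ x, Real.negMulLog (M x).trace.re := by
  rw [← entropy_diagonal]
  congr
  ext x
  have := (Complex.nonneg_iff.mp (hM x).trace_nonneg).2
  exact Complex.ext rfl (by simpa using this.symm)

/-- `H(C|A) ≤ H(C|Y)` when `Y` is the outcome of a measurement of `A` with the rank-one elements
`|W̄_y⟩⟨W̄_y|`. -/
theorem condEntropy_le_measure {W : Matrix y a ℂ} (hW : Wᴴ * W = 1)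
    {ρ : Matrix (a × c) (a × c) ℂ} (hρ : ρ.PosSemidef) :
    entropy ρ - entropy (traceSnd ρ)
      ≤ ∑ x, entropy (slice (W x) ρ) - ∑ x, Real.negMulLog (slice (W x) ρ).trace.re := by
  set K : y → Matrix y a ℂ := fun x => Matrix.of fun x' i => if x' = x then W x i else 0 with hKdef
  have hK : ∑ x, (K x)ᴴ * K x = 1 := by
    rw [← hW]
    ext i i'
    simp [Matrix.sum_apply, Matrix.mul_apply, K]
  have hmap : krausMap (fun x => K x ⊗ₖ (1 : Matrix c c ℂ)) ρ
      = blocks fun x => slice (W x) ρ := by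
    ext ⟨x, l⟩ ⟨x', l'⟩
    simp only [krausMap, Matrix.sum_apply, Matrix.conjTranspose_kronecker,
      Matrix.conjTranspose_one, mul_kronecker_one_apply, kronecker_one_mul_apply, K,
      Matrix.of_apply, Matrix.conjTranspose_apply, blocks, slice]
    by_cases h : x = x'
    · subst h
      rw [Finset.sum_eq_single x]
      · simp only [if_true, Finset.sum_mul, Complex.star_def]
        rw [Finset.sum_comm]
      · intro b _ hb
        simp [hb.symm]
      · simp
    · rw [if_neg h]
      refine Finset.sum_eq_zero fun b _ => ?_
      by_cases hb : x = b
      · have : x' ≠ b := fun h' => h (hb.trans h'.symm)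
        simp [this]
      · simp [hb]
  have hps : ∀ x, (slice (W x) ρ).PosSemidef := fun x => posSemidef_slice _ hρ
  have h := condEntropy_le_krausMap hK hρ
  rw [← traceSnd_krausMap, hmap, entropy_blocks _ fun x => (hps x).1, traceSnd_blocks,
    entropy_diagonal_trace hps] at h
  exact h

/-- `H(C|Y) ≤ H(C|E)` when `E` is prepared in the pure state `u_y` depending on a classical
register `Y`. -/
theorem condEntropy_le_prepare {u : y → a → ℂ} (hu : ∀ x, ∑ i, u x i * conj (u x i) = 1)
    {τ : y → Matrix c c ℂ} (hτ : ∀ x, (τ x).PosSemidef) :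
    ∑ x, entropy (τ x) - ∑ x, Real.negMulLog (τ x).trace.re
      ≤ entropy (Matrix.of fun v v' : a × c => ∑ x, u x v.1 * conj (u x v'.1) * τ x v.2 v'.2)
        - entropy (Matrix.of fun i i' => ∑ x, u x i * conj (u x i') * (τ x).trace) := by
  set K : y → Matrix a y ℂ := fun x => Matrix.of fun i x' => if x' = x then u x i else 0 with hKdef
  have hK : ∑ x, (K x)ᴴ * K x = 1 := by
    ext x x'
    simp only [K, Matrix.sum_apply, Matrix.mul_apply, Matrix.conjTranspose_apply,
      Matrix.of_apply, Matrix.one_apply]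
    by_cases h : x = x'
    · subst h
      rw [Finset.sum_eq_single x]
      · simpa [mul_comm] using hu x
      · intro b _ hb
        simp [hb.symm]
      · simp
    · rw [if_neg h]
      refine Finset.sum_eq_zero fun b _ => Finset.sum_eq_zero fun i _ => ?_
      by_cases hb : x = b
      · have : x' ≠ b := fun h' => h (hb.trans h'.symm)
        simp [this]
      · simp [hb]
  have hmap : krausMap (fun x => K x ⊗ₖ (1 : Matrix c c ℂ)) (blocks τ)
      = Matrix.of fun v v' : a × c => ∑ x, u x v.1 * conj (u x v'.1) * τ x v.2 v'.2 := by
    ext ⟨i, l⟩ ⟨i', l'⟩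
    simp only [krausMap, Matrix.sum_apply, Matrix.conjTranspose_kronecker,
      Matrix.conjTranspose_one, mul_kronecker_one_apply, kronecker_one_mul_apply, K,
      Matrix.of_apply, Matrix.conjTranspose_apply, blocks]
    refine Finset.sum_congr rfl fun x _ => ?_
    simp [apply_ite]
    ring
  have h := condEntropy_le_krausMap hK (posSemidef_blocks hτ)
  rw [← traceSnd_krausMap, hmap, entropy_blocks _ fun x => (hτ x).1, traceSnd_blocks,
    entropy_diagonal_trace hτ] at h
  refine h.trans_eq ?_
  congr 2
  ext i i'
  simp only [traceSnd_apply, Matrix.of_apply, Matrix.trace, Matrix.diag_apply, Finset.mul_sum]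
  rw [Finset.sum_comm]

end CondEntropy

/-! ### Isometric channels, complements and tensor products -/

section Channels

open scoped Kronecker

variable {ι κ ε ι₁ κ₁ ε₁ ι₂ κ₂ ε₂ : Type*} [Fintype ι] [Fintype κ] [Fintype ε]
  [Fintype ι₁] [Fintype κ₁] [Fintype ε₁] [Fintype ι₂] [Fintype κ₂] [Fintype ε₂]
  [DecidableEq ι] [DecidableEq κ] [DecidableEq ε] [DecidableEq ι₁] [DecidableEq κ₁]
  [DecidableEq ε₁] [DecidableEq ι₂] [DecidableEq κ₂] [DecidableEq ε₂]

/-- The complementary channel, which keeps the environment instead of the output. -/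
def envChan (V : Matrix (κ × ε) ι ℂ) : Chan ι ε :=
  chanOfIsometry (V.submatrix Prod.swap id)

/-- The Kraus operators `⟨e| V` of the channel with isometric extension `V`. -/
def krausOps (V : Matrix (κ × ε) ι ℂ) (e : ε) : Matrix κ ι ℂ :=
  Matrix.of fun b i => V (b, e) i

omit [Fintype κ] [DecidableEq ι] [DecidableEq κ] [DecidableEq ε] in
theorem chanOfIsometry_eq_krausMap (V : Matrix (κ × ε) ι ℂ) (ρ : Matrix ι ι ℂ) :
    chanOfIsometry V ρ = krausMap (krausOps V) ρ := by
  ext b b'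
  simp [chanOfIsometry, traceSnd_apply, krausMap, Matrix.sum_apply, Matrix.mul_apply, krausOps]

omit [Fintype κ] [DecidableEq ι] [DecidableEq κ] [DecidableEq ε] in
theorem chanOfIsometry_apply (V : Matrix (κ × ε) ι ℂ) (ρ : Matrix ι ι ℂ) (b b' : κ) :
    chanOfIsometry V ρ b b' = ∑ e, ∑ i, ∑ i', V (b, e) i * ρ i i' * conj (V (b', e) i') := by
  simp only [chanOfIsometry_eq_krausMap, krausMap, Matrix.sum_apply, Matrix.mul_apply, krausOps,
    Matrix.of_apply, Matrix.conjTranspose_apply, Finset.sum_mul, Complex.star_def]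
  exact Finset.sum_congr rfl fun e _ => Finset.sum_comm

omit [Fintype ε] [DecidableEq ι] [DecidableEq κ] [DecidableEq ε] in
theorem envChan_apply (V : Matrix (κ × ε) ι ℂ) (ρ : Matrix ι ι ℂ) (e e' : ε) :
    envChan V ρ e e' = ∑ b, ∑ i, ∑ i', V (b, e) i * ρ i i' * conj (V (b, e') i') := by
  rw [envChan, chanOfIsometry_apply]
  rfl

omit [Fintype ι] [DecidableEq κ] [DecidableEq ε] in
theorem isometry_swap {V : Matrix (κ × ε) ι ℂ} (hV : Vᴴ * V = 1) :
    (V.submatrix Prod.swap id : Matrix (ε × κ) ι ℂ)ᴴ * V.submatrix Prod.swap id = 1 := by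
  rw [← hV]
  ext i i'
  simp only [Matrix.mul_apply, Fintype.sum_prod_type, Matrix.conjTranspose_apply,
    Matrix.submatrix_apply, Prod.swap, id]
  exact Finset.sum_comm

omit [Fintype ι] [DecidableEq κ] [DecidableEq ε] in
theorem sum_krausOps {V : Matrix (κ × ε) ι ℂ} (hV : Vᴴ * V = 1) :
    ∑ e, (krausOps V e)ᴴ * krausOps V e = 1 := by
  rw [← hV]
  ext i i'
  simp only [Matrix.sum_apply, Matrix.mul_apply, Fintype.sum_prod_type, Matrix.conjTranspose_apply,
    krausOps, Matrix.of_apply]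
  exact Finset.sum_comm

omit [DecidableEq ε] in
theorem trace_chanOfIsometry {V : Matrix (κ × ε) ι ℂ} (hV : Vᴴ * V = 1) (ρ : Matrix ι ι ℂ) :
    (chanOfIsometry V ρ).trace = ρ.trace := by
  rw [chanOfIsometry_eq_krausMap, trace_krausMap (sum_krausOps hV)]

omit [DecidableEq κ] in
theorem trace_envChan {V : Matrix (κ × ε) ι ℂ} (hV : Vᴴ * V = 1) (ρ : Matrix ι ι ℂ) :
    (envChan V ρ).trace = ρ.trace :=
  trace_chanOfIsometry (isometry_swap hV) ρ

omit [DecidableEq ι] [DecidableEq κ] [DecidableEq ε] in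
theorem posSemidef_chanOfIsometry (V : Matrix (κ × ε) ι ℂ) {ρ : Matrix ι ι ℂ}
    (hρ : ρ.PosSemidef) : (chanOfIsometry V ρ).PosSemidef := by
  rw [chanOfIsometry_eq_krausMap]
  exact posSemidef_krausMap _ hρ

omit [DecidableEq ι] [DecidableEq κ] [DecidableEq ε] in
theorem posSemidef_envChan (V : Matrix (κ × ε) ι ℂ) {ρ : Matrix ι ι ℂ}
    (hρ : ρ.PosSemidef) : (envChan V ρ).PosSemidef :=
  posSemidef_chanOfIsometry _ hρ

/-- The isometric extension `V₁ ⊗ V₂` of the tensor product of two channels. -/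
def prodIso (V₁ : Matrix (κ₁ × ε₁) ι₁ ℂ) (V₂ : Matrix (κ₂ × ε₂) ι₂ ℂ) :
    Matrix ((κ₁ × κ₂) × (ε₁ × ε₂)) (ι₁ × ι₂) ℂ :=
  Matrix.of fun u i => V₁ (u.1.1, u.2.1) i.1 * V₂ (u.1.2, u.2.2) i.2

omit [Fintype ι₁] [Fintype ι₂] [DecidableEq κ₁] [DecidableEq ε₁] [DecidableEq κ₂]
  [DecidableEq ε₂] in
theorem isometry_prodIso {V₁ : Matrix (κ₁ × ε₁) ι₁ ℂ} {V₂ : Matrix (κ₂ × ε₂) ι₂ ℂ}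
    (h₁ : V₁ᴴ * V₁ = 1) (h₂ : V₂ᴴ * V₂ = 1) : (prodIso V₁ V₂)ᴴ * prodIso V₁ V₂ = 1 := by
  have e : (prodIso V₁ V₂)ᴴ * prodIso V₁ V₂ = (V₁ᴴ * V₁) ⊗ₖ (V₂ᴴ * V₂) := by
    ext ⟨i, j⟩ ⟨i', j'⟩
    simp only [Matrix.mul_apply, Matrix.kroneckerMap_apply, Fintype.sum_prod_type,
      Matrix.conjTranspose_apply, prodIso, Matrix.of_apply, star_mul', Finset.sum_mul,
      Finset.mul_sum]
    rw [Finset.sum_comm]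
    refine Finset.sum_congr rfl fun b _ => ?_
    conv_rhs => rw [Finset.sum_comm]
    refine Finset.sum_congr rfl fun b' _ => ?_
    rw [Finset.sum_comm]
    exact Finset.sum_congr rfl fun e _ => Finset.sum_congr rfl fun e' _ => by ring
  rw [e, h₁, h₂, Matrix.one_kronecker_one]

omit [Fintype κ₁] [Fintype κ₂] [DecidableEq ι₁] [DecidableEq κ₁] [DecidableEq ε₁]
  [DecidableEq ι₂] [DecidableEq κ₂] [DecidableEq ε₂] in
theorem chanOfIsometry_prodIso_apply (V₁ : Matrix (κ₁ × ε₁) ι₁ ℂ) (V₂ : Matrix (κ₂ × ε₂) ι₂ ℂ)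
    (ρ : Matrix (ι₁ × ι₂) (ι₁ × ι₂) ℂ) (b b' : κ₁) (c c' : κ₂) :
    chanOfIsometry (prodIso V₁ V₂) ρ (b, c) (b', c') = ∑ e, ∑ i, ∑ i', V₁ (b, e) i *
      conj (V₁ (b', e) i') * chanOfIsometry V₂ (Matrix.of fun j j' => ρ (i, j) (i', j')) c c' := by
  simp only [chanOfIsometry_apply, prodIso, Matrix.of_apply, Fintype.sum_prod_type, map_mul,
    Finset.mul_sum]
  refine Finset.sum_congr rfl fun e _ => ?_
  rw [Finset.sum_comm]
  refine Finset.sum_congr rfl fun i _ => ?_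
  conv_rhs => rw [Finset.sum_comm]
  refine Finset.sum_congr rfl fun f _ => ?_
  rw [Finset.sum_comm]
  refine Finset.sum_congr rfl fun i' _ => Finset.sum_congr rfl fun j _ =>
    Finset.sum_congr rfl fun j' _ => by ring

omit [DecidableEq ι₁] [DecidableEq κ₁] [DecidableEq ε₁] [DecidableEq ε₂] [Fintype κ₁] in
theorem traceSnd_prodIso (V₁ : Matrix (κ₁ × ε₁) ι₁ ℂ) {V₂ : Matrix (κ₂ × ε₂) ι₂ ℂ}
    (h₂ : V₂ᴴ * V₂ = 1) (ρ : Matrix (ι₁ × ι₂) (ι₁ × ι₂) ℂ) :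
    traceSnd (chanOfIsometry (prodIso V₁ V₂) ρ) = chanOfIsometry V₁ (traceSnd ρ) := by
  ext b b'
  rw [traceSnd_apply, chanOfIsometry_apply]
  simp only [chanOfIsometry_prodIso_apply]
  rw [Finset.sum_comm]
  refine Finset.sum_congr rfl fun e _ => ?_
  rw [Finset.sum_comm]
  refine Finset.sum_congr rfl fun i _ => ?_
  rw [Finset.sum_comm]
  refine Finset.sum_congr rfl fun i' _ => ?_
  rw [← Finset.mul_sum]
  have h := trace_chanOfIsometry h₂ (Matrix.of fun j j' => ρ (i, j) (i', j'))
  simp only [Matrix.trace, Matrix.diag_apply] at h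
  rw [h, traceSnd_apply]
  simp only [Matrix.of_apply]
  ring

omit [DecidableEq ι₁] [DecidableEq κ₁] [DecidableEq ε₁] [DecidableEq κ₂] [Fintype ε₁] in
theorem traceSnd_envChan_prodIso (V₁ : Matrix (κ₁ × ε₁) ι₁ ℂ) {V₂ : Matrix (κ₂ × ε₂) ι₂ ℂ}
    (h₂ : V₂ᴴ * V₂ = 1) (ρ : Matrix (ι₁ × ι₂) (ι₁ × ι₂) ℂ) :
    traceSnd (envChan (prodIso V₁ V₂) ρ) = envChan V₁ (traceSnd ρ) :=
  traceSnd_prodIso (V₁.submatrix Prod.swap id) (isometry_swap h₂) ρ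

/-- The isometric extension of the `n`-fold tensor power of a channel. -/
def powIso (V : Matrix (κ × ε) ι ℂ) (n : ℕ) :
    Matrix ((Fin n → κ) × (Fin n → ε)) (Fin n → ι) ℂ :=
  Matrix.of fun u i => ∏ t, V (u.1 t, u.2 t) (i t)

omit [Fintype κ] [DecidableEq κ] [DecidableEq ε] in
theorem chanPow_chanOfIsometry (V : Matrix (κ × ε) ι ℂ) (n : ℕ) :
    chanPow (chanOfIsometry V) n = chanOfIsometry (powIso V n) := by
  refine LinearMap.ext fun ρ => ?_
  ext b b'
  have h : ∀ i i' b b', chanOfIsometry V (Matrix.single i i' 1) b b'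
      = ∑ e, V (b, e) i * conj (V (b', e) i') := by
    intro i i' b b'
    rw [chanOfIsometry_apply]
    refine Finset.sum_congr rfl fun e _ => ?_
    rw [Finset.sum_eq_single i, Finset.sum_eq_single i']
    · simp
    · intro j _ hj; simp [hj.symm]
    · simp
    · intro j _ hj; simp [hj.symm]
    · simp
  rw [chanOfIsometry_apply]
  simp only [chanPow, LinearMap.coe_mk, AddHom.coe_mk, Matrix.of_apply, h, powIso,
    Finset.prod_univ_sum, Fintype.piFinset_univ, map_prod, Finset.prod_mul_distrib,
    Finset.mul_sum]
  conv_rhs => rw [Finset.sum_comm]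
  refine Finset.sum_congr rfl fun i _ => ?_
  conv_rhs => rw [Finset.sum_comm]
  exact Finset.sum_congr rfl fun i' _ => Finset.sum_congr rfl fun e _ => by ring

/-- A channel is a Hadamard channel if its environment can be prepared from the outcome `y` of a
rank-one measurement `W` of its output: given the outcome, the environment is left in a pure state
`u y` that does not depend on the input. -/
def IsHadamard (V : Matrix (κ × ε) ι ℂ) : Prop :=
  ∃ (Y : Type) (_ : Fintype Y) (_ : DecidableEq Y) (W : Matrix Y κ ℂ) (m : Matrix Y ι ℂ)
    (u : Y → ε → ℂ), Wᴴ * W = 1 ∧ (∀ y, ∑ e, u y e * conj (u y e) = 1) ∧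
      ∀ y e i, ∑ b, W y b * V (b, e) i = m y i * u y e

omit [Fintype ι] [DecidableEq ε] in
/-- The measurement `W` of the output amounts to a measurement `m` of the input. -/
theorem isometry_hadamard {V : Matrix (κ × ε) ι ℂ} (hV : Vᴴ * V = 1) {Y : Type*} [Fintype Y]
    {W : Matrix Y κ ℂ} (hW : Wᴴ * W = 1) {m : Matrix Y ι ℂ} {u : Y → ε → ℂ}
    (hu : ∀ y, ∑ e, u y e * conj (u y e) = 1)
    (h : ∀ y e i, ∑ b, W y b * V (b, e) i = m y i * u y e) : mᴴ * m = 1 := by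
  have h1 : ∀ e, W * krausOps V e = Matrix.of fun y i => m y i * u y e := by
    intro e; ext y i; simp [Matrix.mul_apply, krausOps, h]
  have h2 : ∑ e, (W * krausOps V e)ᴴ * (W * krausOps V e) = 1 := by
    rw [← sum_krausOps hV]
    refine Finset.sum_congr rfl fun e _ => ?_
    rw [Matrix.conjTranspose_mul, Matrix.mul_assoc, ← Matrix.mul_assoc Wᴴ, hW, Matrix.one_mul]
  rw [← h2]
  ext i i'
  simp only [h1, Matrix.sum_apply, Matrix.mul_apply, Matrix.conjTranspose_apply, Matrix.of_apply]
  rw [Finset.sum_comm]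
  refine Finset.sum_congr rfl fun y _ => ?_
  rw [← mul_one (star (m y i) * m y i'), ← hu y, Finset.mul_sum]
  exact Finset.sum_congr rfl fun e _ => by simp; ring

omit [DecidableEq ι₁] [DecidableEq κ₁] [DecidableEq ε₁] [DecidableEq ε₂] in
/-- The state of the second output, given an outcome at the first one, is the output of the second
channel on the state left by the corresponding outcome at the first input. -/
theorem slice_chanOfIsometry_prodIso {V₁ : Matrix (κ₁ × ε₁) ι₁ ℂ} (V₂ : Matrix (κ₂ × ε₂) ι₂ ℂ)
    {w : κ₁ → ℂ} {m : ι₁ → ℂ} {u : ε₁ → ℂ} (hu : ∑ e, u e * conj (u e) = 1)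
    (h : ∀ e i, ∑ b, w b * V₁ (b, e) i = m i * u e) (ρ : Matrix (ι₁ × ι₂) (ι₁ × ι₂) ℂ) :
    slice w (chanOfIsometry (prodIso V₁ V₂) ρ) = chanOfIsometry V₂ (slice m ρ) := by
  have h1 : ∀ e : ε₁ × ε₂, (rowKron w : Matrix κ₂ (κ₁ × κ₂) ℂ) * krausOps (prodIso V₁ V₂) e
      = u e.1 • (krausOps V₂ e.2 * (rowKron m : Matrix ι₂ (ι₁ × ι₂) ℂ)) := by
    intro e
    refine Matrix.ext fun b v => ?_
    obtain ⟨i, j⟩ := v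
    have h3 : ((krausOps V₂ e.2 : Matrix κ₂ ι₂ ℂ) * (rowKron m : Matrix ι₂ (ι₁ × ι₂) ℂ)) b (i, j)
        = V₂ (b, e.2) j * m i := by
      simp [Matrix.mul_apply, rowKron, krausOps]
    rw [Matrix.smul_apply]
    erw [h3]
    simp only [Matrix.mul_apply, rowKron, Fintype.sum_prod_type, Matrix.of_apply, krausOps,
      prodIso, ite_mul, zero_mul, Finset.sum_ite_eq, Finset.mem_univ, if_true, ← mul_assoc,
      ← Finset.sum_mul, h, smul_eq_mul]
    ring
  rw [slice_eq, slice_eq, chanOfIsometry_eq_krausMap, chanOfIsometry_eq_krausMap, krausMap,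
    krausMap, Matrix.mul_sum, Matrix.sum_mul, Fintype.sum_prod_type, Finset.sum_comm]
  refine Finset.sum_congr rfl fun e _ => ?_
  have h2 : ∀ e₁, (rowKron w : Matrix κ₂ (κ₁ × κ₂) ℂ) * (krausOps (prodIso V₁ V₂) (e₁, e) * ρ *
      (krausOps (prodIso V₁ V₂) (e₁, e))ᴴ) * (rowKron w : Matrix κ₂ (κ₁ × κ₂) ℂ)ᴴ
      = (u e₁ * conj (u e₁)) • (krausOps V₂ e * ((rowKron m : Matrix ι₂ (ι₁ × ι₂) ℂ) * ρ *
        (rowKron m : Matrix ι₂ (ι₁ × ι₂) ℂ)ᴴ) * (krausOps V₂ e)ᴴ) := by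
    intro e₁
    rw [← Matrix.mul_assoc, ← Matrix.mul_assoc, Matrix.mul_assoc _ _ᴴ _ᴴ,
      ← Matrix.conjTranspose_mul, h1, Matrix.conjTranspose_smul, Matrix.conjTranspose_mul]
    simp only [Matrix.smul_mul, Matrix.mul_smul, smul_smul, Matrix.mul_assoc, Complex.star_def]
    rw [mul_comm (conj (u e₁))]
  simp only [h2, ← Finset.sum_smul, hu, one_smul]

omit [DecidableEq ι] [DecidableEq κ] in
theorem trace_mul_mul_conjTranspose (X : Matrix ι ι ℂ) (A B : Matrix κ ι ℂ) :
    (A * X * Bᴴ).trace = ∑ b, ∑ i, ∑ i', A b i * conj (B b i') * X i i' := by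
  simp only [Matrix.trace, Matrix.diag_apply, Matrix.mul_apply, Matrix.conjTranspose_apply,
    Finset.sum_mul, Complex.star_def]
  refine Finset.sum_congr rfl fun b _ => ?_
  rw [Finset.sum_comm]
  exact Finset.sum_congr rfl fun i _ => Finset.sum_congr rfl fun i' _ => by ring

omit [Fintype ε₁] [Fintype ε₂] [DecidableEq ι₁] [DecidableEq ε₁] [DecidableEq ι₂] [DecidableEq κ₂]
  [DecidableEq ε₂] in
/-- The joint environment state is that of the second channel, given the outcome, together with a
state of the first environment prepared from the outcome. -/
theorem envChan_prodIso_apply {V₁ : Matrix (κ₁ × ε₁) ι₁ ℂ} (V₂ : Matrix (κ₂ × ε₂) ι₂ ℂ)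
    {Y : Type*} [Fintype Y] {W : Matrix Y κ₁ ℂ} (hW : Wᴴ * W = 1) {m : Matrix Y ι₁ ℂ}
    {u : Y → ε₁ → ℂ} (h : ∀ y e i, ∑ b, W y b * V₁ (b, e) i = m y i * u y e)
    (ρ : Matrix (ι₁ × ι₂) (ι₁ × ι₂) ℂ) :
    envChan (prodIso V₁ V₂) ρ = Matrix.of fun v v' : ε₁ × ε₂ =>
      ∑ y, u y v.1 * conj (u y v'.1) * envChan V₂ (slice (m y) ρ) v.2 v'.2 := by
  have hm : ∀ e, W * krausOps V₁ e = Matrix.of fun y i => m y i * u y e := by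
    intro e; ext y i; simp [Matrix.mul_apply, krausOps, h]
  ext ⟨e, f⟩ ⟨e', f'⟩
  have hV : ∀ X : Matrix ι₁ ι₁ ℂ, ∑ b, ∑ i, ∑ i', V₁ (b, e) i * conj (V₁ (b, e') i') * X i i'
      = ∑ y, u y e * conj (u y e') * ∑ i, ∑ i', m y i * conj (m y i') * X i i' := by
    intro X
    have h2 := trace_mul_mul_conjTranspose X (krausOps V₁ e) (krausOps V₁ e')
    have h3 : (krausOps V₁ e * X * (krausOps V₁ e')ᴴ).trace
        = ((W * krausOps V₁ e) * X * (W * krausOps V₁ e')ᴴ).trace := by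
      rw [Matrix.conjTranspose_mul, ← Matrix.mul_assoc, Matrix.trace_mul_comm _ Wᴴ]
      simp only [← Matrix.mul_assoc]
      rw [hW, Matrix.one_mul]
    refine h2.symm.trans (h3.trans ?_)
    rw [hm, hm, trace_mul_mul_conjTranspose]
    simp only [Matrix.of_apply, Finset.mul_sum, map_mul]
    exact Finset.sum_congr rfl fun y _ => Finset.sum_congr rfl fun i _ =>
      Finset.sum_congr rfl fun i' _ => by ring
  rw [envChan]
  erw [chanOfIsometry_prodIso_apply (V₁.submatrix Prod.swap id) (V₂.submatrix Prod.swap id)]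
  rw [Matrix.of_apply]
  refine (hV (Matrix.of fun i i' => _)).trans ?_
  refine Finset.sum_congr rfl fun y _ => ?_
  congr 1
  have hs : slice (m y) ρ = ∑ i, ∑ i', (m y i * conj (m y i')) •
      (Matrix.of fun j j' => ρ (i, j) (i', j') : Matrix ι₂ ι₂ ℂ) := by
    ext j j'
    simp only [slice, Matrix.of_apply, Matrix.sum_apply, Matrix.smul_apply, smul_eq_mul]
    exact Finset.sum_congr rfl fun i _ => Finset.sum_congr rfl fun i' _ => by ring
  rw [hs]
  simp only [map_sum, map_smul, Matrix.sum_apply, Matrix.smul_apply, smul_eq_mul, Matrix.of_apply]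
  rfl

/-- The part `ν H(A') + λ H(B) - (ν + λ + μ) H(E) + μ η(Tr ρ)`, with `η(t) = -t log t`, of the
weighted sum of information quantities that is contributed by a single unnormalized input `ρ`. The
last term makes it homogeneous of degree one in `ρ`. -/
def condInfo (V : Matrix (κ × ε) ι ℂ) (ν lam μ : ℝ) (ρ : Matrix ι ι ℂ) : ℝ :=
  ν * entropy ρ + lam * entropy (chanOfIsometry V ρ)
    - (ν + lam + μ) * entropy (envChan V ρ) + μ * Real.negMulLog ρ.trace.re

/-- A Hadamard channel used together with another channel: the information splits into that of the
first channel and that of the second one, given the outcome of the measurement that determines the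
environment of the first channel. -/
theorem exists_condInfo_prodIso_le {V₁ : Matrix (κ₁ × ε₁) ι₁ ℂ} {V₂ : Matrix (κ₂ × ε₂) ι₂ ℂ}
    (h₁ : V₁ᴴ * V₁ = 1) (h₂ : V₂ᴴ * V₂ = 1) (hH : IsHadamard V₁) {ν lam μ : ℝ} (hν : 0 ≤ ν)
    (hlam : 0 ≤ lam) (hμ : 0 ≤ μ) {ρ : Matrix (ι₁ × ι₂) (ι₁ × ι₂) ℂ} (hρ : ρ.PosSemidef) :
    ∃ (Y : Type) (_ : Fintype Y) (τ : Y → Matrix ι₂ ι₂ ℂ), (∀ y, (τ y).PosSemidef) ∧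
      ∑ y, (τ y).trace = ρ.trace ∧
      condInfo (prodIso V₁ V₂) ν lam μ ρ
        ≤ condInfo V₁ ν lam μ (traceSnd ρ) + ∑ y, condInfo V₂ ν lam μ (τ y) := by
  obtain ⟨Y, _, _, W, m, u, hW, hu, h⟩ := hH
  have hm := isometry_hadamard h₁ hW hu h
  have hτ : ∀ y, (slice (m y) ρ).PosSemidef := fun y => posSemidef_slice _ hρ
  refine ⟨Y, inferInstance, fun y => slice (m y) ρ, hτ, sum_trace_slice hm ρ, ?_⟩
  -- `Y` is obtained by measuring the first input or the first output, and the first environment is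
  -- prepared from `Y`
  have hA := condEntropy_le_measure hm hρ
  have hB := condEntropy_le_measure hW (posSemidef_chanOfIsometry (prodIso V₁ V₂) hρ)
  simp only [slice_chanOfIsometry_prodIso V₂ (hu _) (h _), traceSnd_prodIso V₁ h₂,
    trace_chanOfIsometry h₂] at hB
  have hE := condEntropy_le_prepare hu fun y => posSemidef_envChan V₂ (hτ y)
  have hE2 : (Matrix.of fun i i' => ∑ y, u y i * conj (u y i') *
      (envChan V₂ (slice (m y) ρ)).trace) = envChan V₁ (traceSnd ρ) := by
    rw [← traceSnd_envChan_prodIso V₁ h₂, envChan_prodIso_apply V₂ hW h]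
    ext e e'
    simp only [traceSnd_apply, Matrix.of_apply, Matrix.trace, Matrix.diag_apply, Finset.mul_sum]
    rw [Finset.sum_comm]
  rw [← envChan_prodIso_apply V₂ hW h, hE2] at hE
  simp only [trace_envChan h₂] at hE
  simp only [condInfo, Finset.sum_add_distrib, Finset.sum_sub_distrib, ← Finset.mul_sum,
    trace_traceSnd]
  have i1 := mul_le_mul_of_nonneg_left hA hν
  have i2 := mul_le_mul_of_nonneg_left hB hlam
  have i3 := mul_le_mul_of_nonneg_left hE (add_nonneg (add_nonneg hν hlam) hμ)
  have i4 : 0 ≤ μ * Real.negMulLog ρ.trace.re - μ * Real.negMulLog ρ.trace.re := by simp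
  linarith

omit [Fintype κ] [Fintype κ₁] [DecidableEq ι] [DecidableEq κ] [DecidableEq ε] [DecidableEq ι₁]
  [DecidableEq κ₁] [DecidableEq ε₁] in
theorem chanOfIsometry_submatrix (V : Matrix (κ × ε) ι ℂ) (f : κ₁ → κ) (g : ε₁ ≃ ε) (h : ι₁ ≃ ι)
    (ρ : Matrix ι ι ℂ) :
    chanOfIsometry (V.submatrix (Prod.map f g) h) (ρ.submatrix h h)
      = (chanOfIsometry V ρ).submatrix f f := by
  ext b b'
  simp only [chanOfIsometry_apply, Matrix.submatrix_apply, Prod.map_apply]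
  refine g.sum_comp (fun e => ∑ i, ∑ i', V (f b, e) (h i) * ρ (h i) (h i') *
    conj (V (f b', e) (h i'))) |>.trans <| Finset.sum_congr rfl fun e _ => ?_
  refine h.sum_comp (fun i => ∑ i', V (f b, e) i * ρ i (h i') *
    conj (V (f b', e) (h i'))) |>.trans <| Finset.sum_congr rfl fun i _ => ?_
  exact h.sum_comp (fun i' => V (f b, e) i * ρ i i' * conj (V (f b', e) i'))

omit [Fintype ε] [Fintype ε₁] [DecidableEq ι] [DecidableEq κ] [DecidableEq ε] [DecidableEq ι₁]
  [DecidableEq κ₁] [DecidableEq ε₁] in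
theorem envChan_submatrix (V : Matrix (κ × ε) ι ℂ) (f : κ₁ ≃ κ) (g : ε₁ → ε) (h : ι₁ ≃ ι)
    (ρ : Matrix ι ι ℂ) :
    envChan (V.submatrix (Prod.map f g) h) (ρ.submatrix h h) = (envChan V ρ).submatrix g g :=
  chanOfIsometry_submatrix (V.submatrix Prod.swap id) g f h ρ

/-- Relabelling the basis states does not change the entropies. -/
theorem condInfo_submatrix (V : Matrix (κ × ε) ι ℂ) (f : κ₁ ≃ κ) (g : ε₁ ≃ ε) (h : ι₁ ≃ ι)
    (ν lam μ : ℝ) (ρ : Matrix ι ι ℂ) :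
    condInfo (V.submatrix (Prod.map f g) h) ν lam μ (ρ.submatrix h h) = condInfo V ν lam μ ρ := by
  have hT : (ρ.submatrix h h).trace = ρ.trace := h.sum_comp fun i => ρ i i
  rw [condInfo, chanOfIsometry_submatrix, envChan_submatrix, hT, entropy_submatrix_equiv,
    entropy_submatrix_equiv, entropy_submatrix_equiv, condInfo]

omit [Fintype ι] [Fintype κ] [Fintype ε] [DecidableEq ι] [DecidableEq κ] [DecidableEq ε] in
theorem powIso_succ (V : Matrix (κ × ε) ι ℂ) (n : ℕ) :
    powIso V (n + 1) = (prodIso V (powIso V n)).submatrix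
      (Prod.map (Fin.consEquiv fun _ => κ).symm (Fin.consEquiv fun _ => ε).symm)
      (Fin.consEquiv fun _ => ι).symm := by
  ext u i
  simp [powIso, prodIso, Fin.prod_univ_succ, Fin.consEquiv, Fin.tail]

omit [Fintype ι] [DecidableEq κ] [DecidableEq ε] in
theorem isometry_powIso {V : Matrix (κ × ε) ι ℂ} (hV : Vᴴ * V = 1) (n : ℕ) :
    (powIso V n)ᴴ * powIso V n = 1 := by
  induction n with
  | zero =>
    ext i i'
    simp [Matrix.mul_apply, powIso, Matrix.one_apply, Subsingleton.elim i i']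
  | succ n ih =>
    have e : (Prod.map (Fin.consEquiv fun _ => κ).symm (Fin.consEquiv fun _ => ε).symm :
        (Fin (n + 1) → κ) × (Fin (n + 1) → ε) → (κ × (Fin n → κ)) × (ε × (Fin n → ε)))
        = Equiv.prodCongr (Fin.consEquiv fun _ => κ).symm (Fin.consEquiv fun _ => ε).symm := rfl
    rw [powIso_succ, e, Matrix.conjTranspose_submatrix, Matrix.submatrix_mul_equiv,
      isometry_prodIso hV ih, Matrix.submatrix_one_equiv]

theorem entropy_of_unique {n : Type*} [Fintype n] [DecidableEq n] [Unique n] {M : Matrix n n ℂ}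
    (hM : M.PosSemidef) : entropy M = Real.negMulLog M.trace.re := by
  have e : M = Matrix.diagonal fun i => ((M i i).re : ℂ) := by
    ext i j
    rw [Subsingleton.elim j i, Matrix.diagonal_apply_eq]
    have h := (Complex.nonneg_iff.mp (hM.diag_nonneg (i := i))).2
    exact Complex.ext rfl (by simpa using h.symm)
  conv_lhs => rw [e, entropy_diagonal]
  simp [Matrix.trace]

/-- **Additivity**: for a Hadamard channel a bound per input carries over to the tensor powers. -/
theorem condInfo_powIso_le {V : Matrix (κ × ε) ι ℂ} (hV : Vᴴ * V = 1) (hH : IsHadamard V)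
    {ν lam μ : ℝ} (hν : 0 ≤ ν) (hlam : 0 ≤ lam) (hμ : 0 ≤ μ) {γ : ℝ}
    (hγ : ∀ ρ : Matrix ι ι ℂ, ρ.PosSemidef → condInfo V ν lam μ ρ ≤ γ * ρ.trace.re) (n : ℕ) :
    ∀ ρ : Matrix (Fin n → ι) (Fin n → ι) ℂ, ρ.PosSemidef →
      condInfo (powIso V n) ν lam μ ρ ≤ n * γ * ρ.trace.re := by
  induction n with
  | zero =>
    intro ρ hρ
    have hi := isometry_powIso hV 0
    rw [condInfo, entropy_of_unique hρ, entropy_of_unique (posSemidef_chanOfIsometry _ hρ),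
      entropy_of_unique (posSemidef_envChan _ hρ), trace_chanOfIsometry hi, trace_envChan hi]
    refine le_of_eq ?_
    push_cast
    ring
  | succ n ih =>
    intro ρ hρ
    set h := (Fin.consEquiv fun _ : Fin (n + 1) => ι).symm
    have hρ' : (ρ.submatrix h.symm h.symm).PosSemidef := hρ.submatrix _
    have e : ρ = (ρ.submatrix h.symm h.symm).submatrix h h := by ext; simp
    have ht : (ρ.submatrix h.symm h.symm).trace = ρ.trace := h.symm.sum_comp fun i => ρ i i
    rw [powIso_succ, e, condInfo_submatrix _ (Fin.consEquiv fun _ => κ).symm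
      (Fin.consEquiv fun _ => ε).symm h, ← e]
    obtain ⟨Y, _, τ, hτ, hτ', hle⟩ := exists_condInfo_prodIso_le hV (isometry_powIso hV n) hH
      hν hlam hμ hρ'
    refine hle.trans ((add_le_add (hγ _ (posSemidef_traceSnd hρ'))
      (Finset.sum_le_sum fun y _ => ih _ (hτ y))).trans_eq ?_)
    rw [trace_traceSnd, ← Finset.mul_sum, ← Complex.re_sum, hτ', ht]
    push_cast
    ring

end Channels

/-! ### A finite family of coherent states resolving the identity -/

section Quadrature

/-- The bidiagonal factor `L` of the truncated Jacobi matrix `T = L Lᴴ` of the Laguerre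
polynomials. -/
def laguerreFactor (k : ℕ) : Matrix (Fin (k + 1)) (Fin (k + 1)) ℂ :=
  Matrix.of fun n j => if n.1 = j.1 then ((√(j.1 + 1) : ℝ) : ℂ)
    else if n.1 = j.1 + 1 then ((√(j.1 + 1) : ℝ) : ℂ) else 0

/-- The coordinates `m! (m choose n)` of the monomial `x ^ m` with respect to the Laguerre
polynomials, up to signs. -/
def laguerreCoord (k m : ℕ) (n : Fin (k + 1)) : ℂ := (m.factorial * m.choose n.1 : ℕ)

theorem laguerreFactor_conjTranspose_mulVec {k m : ℕ} (hm : m ≤ k) :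
    (laguerreFactor k)ᴴ *ᵥ laguerreCoord k m
      = fun j => ((√(j.1 + 1) : ℝ) : ℂ) * (m.factorial * (m + 1).choose (j.1 + 1) : ℕ) := by
  ext j
  have h1 : ∀ n : Fin (k + 1), (laguerreFactor k)ᴴ j n * laguerreCoord k m n
      = (fun n : ℕ => (if n = j.1 then ((√(j.1 + 1) : ℝ) : ℂ) * (m.factorial * m.choose n : ℕ)
          else 0) + if n = j.1 + 1 then ((√(j.1 + 1) : ℝ) : ℂ) * (m.factorial * m.choose n : ℕ)
          else 0) n.1 := by
    intro n
    simp only [Matrix.conjTranspose_apply, laguerreFactor, Matrix.of_apply, laguerreCoord]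
    by_cases h : n.1 = j.1
    · simp [h]
    · by_cases h' : n.1 = j.1 + 1 <;> simp [h, h']
  rw [Matrix.mulVec, dotProduct, Finset.sum_congr rfl fun n _ => h1 n,
    Fin.sum_univ_eq_sum_range (fun n : ℕ => (if n = j.1 then ((√(j.1 + 1) : ℝ) : ℂ) *
      (m.factorial * m.choose n : ℕ) else 0) + if n = j.1 + 1 then ((√(j.1 + 1) : ℝ) : ℂ) *
      (m.factorial * m.choose n : ℕ) else 0), Finset.sum_add_distrib, Finset.sum_ite_eq',
    Finset.sum_ite_eq', if_pos (Finset.mem_range.mpr j.2)]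
  by_cases h : j.1 + 1 < k + 1
  · rw [if_pos (Finset.mem_range.mpr h), Nat.choose_succ_succ]
    push_cast
    ring
  · rw [if_neg (by simpa using h), Nat.choose_succ_succ, Nat.choose_eq_zero_of_lt
      (by omega : m < j.1 + 1)]
    simp

/-- Multiplication by `x` on the monomials of degree less than `k + 1`, where the truncation of the
Jacobi matrix has no effect on the coordinates up to `k`. -/
theorem laguerre_mulVec {k m : ℕ} (hm : m ≤ k) :
    (laguerreFactor k * (laguerreFactor k)ᴴ) *ᵥ laguerreCoord k m = laguerreCoord k (m + 1) := by
  rw [← Matrix.mulVec_mulVec, laguerreFactor_conjTranspose_mulVec hm]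
  ext n
  set f : ℕ → ℂ := fun j => (((j + 1) * (m.factorial * (m + 1).choose (j + 1)) : ℕ) : ℂ) with hf
  have h1 : ∀ j : Fin (k + 1), laguerreFactor k n j *
        (((√(j.1 + 1) : ℝ) : ℂ) * (m.factorial * (m + 1).choose (j.1 + 1) : ℕ))
      = (fun j : ℕ => (if n.1 = j then f j else 0) + if n.1 = j + 1 then f j else 0) j.1 := by
    intro j
    have hs : ((√(j.1 + 1) : ℝ) : ℂ) * ((√(j.1 + 1) : ℝ) : ℂ) = ((j.1 + 1 : ℕ) : ℂ) := by
      rw [← Complex.ofReal_mul, Real.mul_self_sqrt (by positivity)]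
      push_cast; ring
    simp only [laguerreFactor, Matrix.of_apply, hf]
    by_cases h : n.1 = j.1
    · simp only [h, if_true]
      rw [← mul_assoc, hs]
      simp
    · by_cases h' : n.1 = j.1 + 1
      · rw [if_neg h, if_pos h', if_neg h, if_pos h', ← mul_assoc, hs]
        push_cast
        ring
      · simp [h, h']
  rw [Matrix.mulVec, dotProduct, Finset.sum_congr rfl fun n _ => h1 n,
    Fin.sum_univ_eq_sum_range (fun j : ℕ => (if n.1 = j then f j else 0) +
      if n.1 = j + 1 then f j else 0), Finset.sum_add_distrib, Finset.sum_ite_eq,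
    if_pos (Finset.mem_range.mpr n.2)]
  have h2 : ∑ j ∈ Finset.range (k + 1), (if n.1 = j + 1 then f j else 0)
      = ((n.1 * (m.factorial * (m + 1).choose n.1) : ℕ) : ℂ) := by
    rcases hn : n.1 with _ | l
    · simp
    · have : l < k + 1 := by have := n.2; omega
      simp only [Nat.succ_inj, Finset.sum_ite_eq, Finset.mem_range, this, if_true, hf]
  rw [h2, hf, laguerreCoord, ← Nat.cast_add]
  congr 1
  have h3 := Nat.add_one_mul_choose_eq m n.1
  have h4 := Nat.choose_mul_succ_eq m n.1
  rw [Nat.factorial_succ]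
  rcases Nat.lt_or_ge (m + 1) n.1 with h | h
  · rw [Nat.choose_eq_zero_of_lt h, Nat.choose_eq_zero_of_lt (by omega : m + 1 < n.1 + 1)]
    simp
  · obtain ⟨c, hc⟩ := Nat.exists_eq_add_of_le h
    have h5 : m + 1 - n.1 = c := by omega
    rw [h5] at h4
    calc (n.1 + 1) * (m.factorial * (m + 1).choose (n.1 + 1)) +
          n.1 * (m.factorial * (m + 1).choose n.1)
        = m.factorial * ((m + 1).choose (n.1 + 1) * (n.1 + 1)) +
          n.1 * (m.factorial * (m + 1).choose n.1) := by ring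
      _ = m.factorial * ((m + 1).choose n.1 * (n.1 + c)) := by rw [← h3, mul_comm (m + 1), h4]; ring
      _ = _ := by rw [← hc]; ring

/-- Gauss-Laguerre quadrature: a finitely supported measure on `[0, ∞)` has the moments `m!` of the
exponential distribution for `m ≤ k`. It is the spectral measure of the truncated Jacobi matrix at
the first basis vector. -/
theorem exists_laguerre_quadrature (k : ℕ) :
    ∃ w x : Fin (k + 1) → ℝ, (∀ i, 0 ≤ w i) ∧ (∀ i, 0 ≤ x i) ∧
      ∀ m ≤ k, ∑ i, w i * x i ^ m = m.factorial := by
  obtain ⟨U, x, hU, _, hx, hT⟩ :=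
    exists_spectral_posSemidef (Matrix.posSemidef_self_mul_conjTranspose (laguerreFactor k))
  refine ⟨fun i => Complex.normSq (U 0 i), x, fun i => Complex.normSq_nonneg _, hx, ?_⟩
  intro m hm
  set T := laguerreFactor k * (laguerreFactor k)ᴴ
  have h0 : laguerreCoord k 0 = Pi.single 0 1 := by
    ext n
    rcases Fin.eq_zero_or_eq_succ n with h | ⟨l, h⟩
    · subst h; simp [laguerreCoord]
    · subst h; simp [laguerreCoord]
  have h1 : ∀ m ≤ k, T ^ m *ᵥ laguerreCoord k 0 = laguerreCoord k m := by
    intro m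
    induction m with
    | zero => simp
    | succ m ih =>
      intro hm
      rw [pow_succ', ← Matrix.mulVec_mulVec, ih (by omega), laguerre_mulVec (by omega)]
  -- all coordinates of `x ^ m` are `m! (m choose n)`, and the one at `n = 0` is `m!`
  have h2 : (T ^ m) 0 0 = (m.factorial : ℂ) := by
    have := congrFun (h1 m hm) 0
    rw [h0, Matrix.mulVec_single_one] at this
    simpa [laguerreCoord] using this
  have h3 : T ^ m = U * Matrix.diagonal (fun i => ((x i ^ m : ℝ) : ℂ)) * Uᴴ := by
    clear hm h2
    induction m with
    | zero => simpa using (mul_eq_one_comm.mp hU).symm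
    | succ m ih =>
      rw [pow_succ, ih, hT, ← Matrix.mul_assoc, ← Matrix.mul_assoc, Matrix.mul_assoc _ Uᴴ U, hU,
        Matrix.mul_one, Matrix.mul_assoc U, Matrix.diagonal_mul_diagonal]
      congr 3; ext i; push_cast; ring
  rw [h3, Matrix.mul_apply] at h2
  simp only [Matrix.mul_diagonal, Matrix.conjTranspose_apply] at h2
  have h4 : ∀ i, U 0 i * ((x i ^ m : ℝ) : ℂ) * star (U 0 i)
      = ((Complex.normSq (U 0 i) * x i ^ m : ℝ) : ℂ) := by
    intro i
    rw [Complex.ofReal_mul, ← Complex.mul_conj, Complex.star_def]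
    ring
  simp only [h4] at h2
  exact_mod_cast h2

theorem sum_root_of_unity {k a b : ℕ} {ω : ℂ} (hω : IsPrimitiveRoot ω (k + 1)) (ha : a ≤ k)
    (hb : b ≤ k) :
    ∑ t : Fin (k + 1), (ω ^ t.1) ^ a * conj ((ω ^ t.1) ^ b)
      = if a = b then ((k + 1 : ℕ) : ℂ) else 0 := by
  have hn : conj ω = ω⁻¹ := by
    have : ‖ω‖ = 1 := hω.norm'_eq_one (Nat.succ_ne_zero k)
    rw [Complex.inv_def, Complex.normSq_eq_norm_sq, this]; simp
  have hω0 : ω ≠ 0 := hω.ne_zero (Nat.succ_ne_zero k)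
  have h1 : ∀ t : ℕ, (ω ^ t) ^ a * conj ((ω ^ t) ^ b) = (ω ^ a * (ω ^ b)⁻¹) ^ t := by
    intro t
    rw [map_pow, map_pow, hn, mul_pow, inv_pow, inv_pow, inv_pow]
    simp only [← pow_mul, mul_comm t]
  simp only [h1]
  rw [Fin.sum_univ_eq_sum_range (fun t => (ω ^ a * (ω ^ b)⁻¹) ^ t)]
  by_cases h : a = b
  · subst h
    simp [mul_inv_cancel₀ (pow_ne_zero a hω0)]
  · rw [if_neg h]
    have hz : ω ^ a * (ω ^ b)⁻¹ ≠ 1 := by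
      intro h'
      rw [mul_inv_eq_one₀ (pow_ne_zero b hω0)] at h'
      exact h (hω.pow_inj (by omega) (by omega) h')
    rw [geom_sum_eq hz, mul_pow, inv_pow, ← pow_mul, ← pow_mul, mul_comm a, mul_comm b, pow_mul,
      pow_mul, hω.pow_eq_one]
    simp

/-- A finitely supported measure on `ℂ ^ d` has the moments of degree at most `k` in each coordinate
and its conjugate of a standard complex Gaussian. -/
theorem exists_gaussian_design (d k : ℕ) :
    ∃ (Y : Type) (_ : Fintype Y) (_ : DecidableEq Y) (w : Y → ℝ) (ψ : Y → Fin d → ℂ),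
      (∀ y, 0 ≤ w y) ∧ ∀ b b' : Fin d → ℕ, (∀ i, b i ≤ k) → (∀ i, b' i ≤ k) →
        ∑ y, (w y : ℂ) * ((∏ i, ψ y i ^ b i) * conj (∏ i, ψ y i ^ b' i))
          = if b = b' then ((∏ i, (b i).factorial : ℕ) : ℂ) else 0 := by
  obtain ⟨w, x, hw, hx, hm⟩ := exists_laguerre_quadrature k
  obtain ⟨ω, hω⟩ : ∃ ω : ℂ, IsPrimitiveRoot ω (k + 1) :=
    ⟨_, Complex.isPrimitiveRoot_exp (k + 1) (Nat.succ_ne_zero k)⟩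
  set z : Fin (k + 1) × Fin (k + 1) → ℂ := fun v => ((√(x v.1) : ℝ) : ℂ) * ω ^ v.2.1
  set v : Fin (k + 1) × Fin (k + 1) → ℝ := fun u => w u.1 / (k + 1 : ℕ)
  have hone : ∀ a b : ℕ, a ≤ k → b ≤ k → ∑ u, (v u : ℂ) * (z u ^ a * conj (z u ^ b))
      = if a = b then (a.factorial : ℂ) else 0 := by
    intro a b ha hb
    have e : ∀ u : Fin (k + 1) × Fin (k + 1), (v u : ℂ) * (z u ^ a * conj (z u ^ b))
        = ((w u.1 / (k + 1 : ℕ) * (√(x u.1) ^ a * √(x u.1) ^ b) : ℝ) : ℂ)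
          * ((ω ^ u.2.1) ^ a * conj ((ω ^ u.2.1) ^ b)) := by
      intro u
      simp only [z, v, mul_pow, map_mul, map_pow, Complex.conj_ofReal]
      push_cast
      ring
    simp only [e]
    rw [Fintype.sum_prod_type]
    simp only [← Finset.mul_sum, sum_root_of_unity hω ha hb]
    by_cases h : a = b
    · subst h
      have hk : ((k + 1 : ℕ) : ℝ) ≠ 0 := by positivity
      simp only [if_true]
      rw [← Complex.ofReal_natCast a.factorial, ← hm a ha, Complex.ofReal_sum]
      refine Finset.sum_congr rfl fun i _ => ?_
      rw [← mul_pow, Real.mul_self_sqrt (hx i), ← Complex.ofReal_natCast, ← Complex.ofReal_mul]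
      congr 1
      field_simp
    · simp [h]
  refine ⟨Fin d → Fin (k + 1) × Fin (k + 1), inferInstance, inferInstance,
    fun y => ∏ i, v (y i), fun y i => z (y i), ?_, ?_⟩
  · exact fun y => Finset.prod_nonneg fun i _ => div_nonneg (hw _) (by positivity)
  · intro b b' hb hb'
    have e : ∀ y : Fin d → Fin (k + 1) × Fin (k + 1), ((∏ i, v (y i) : ℝ) : ℂ) *
        ((∏ i, z (y i) ^ b i) * conj (∏ i, z (y i) ^ b' i))
        = ∏ i, ((v (y i) : ℂ) * (z (y i) ^ b i * conj (z (y i) ^ b' i))) := by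
      intro y
      rw [map_prod, Complex.ofReal_prod, ← Finset.prod_mul_distrib, ← Finset.prod_mul_distrib]
    simp only [e]
    rw [← Fintype.piFinset_univ, ← Finset.prod_univ_sum (fun _ => Finset.univ)
      (fun i u => (v u : ℂ) * (z u ^ b i * conj (z u ^ b' i)))]
    simp only [hone _ _ (hb _) (hb' _)]
    by_cases h : b = b'
    · subst h; simp
    · rw [if_neg h]
      obtain ⟨i, hi⟩ := Function.ne_iff.mp h
      exact Finset.prod_eq_zero (Finset.mem_univ i) (if_neg hi)

end Quadrature

/-! ### The cloning channel -/

section Cloner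

variable {d k : ℕ}

theorem sum_occ {m : ℕ} (b : Occ d m) : ∑ i, b.1 i = m :=
  (Finset.mem_piAntidiag.mp b.2).1

theorem occ_le {m : ℕ} (b : Occ d m) (i : Fin d) : b.1 i ≤ m :=
  (Finset.single_le_sum (fun _ _ => Nat.zero_le _) (Finset.mem_univ i)).trans_eq (sum_occ b)

theorem mem_occ {m : ℕ} {f : Fin d → ℕ} (h : ∑ i, f i = m) :
    f ∈ Finset.piAntidiag (Finset.univ : Finset (Fin d)) m :=
  Finset.mem_piAntidiag.mpr ⟨h, fun _ _ => Finset.mem_univ _⟩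

/-- The occupation numbers `e_i + j`. -/
def addUnit (hk : 1 ≤ k) (i : Fin d) (j : Occ d (k - 1)) : Occ d k :=
  ⟨Pi.single i 1 + j.1, mem_occ (by
    simp only [Pi.add_apply, Finset.sum_add_distrib, sum_occ, Finset.sum_pi_single',
      Finset.mem_univ, if_true]
    omega)⟩

theorem addUnit_injective (hk : 1 ≤ k) (i : Fin d) :
    Function.Injective (addUnit (d := d) hk i) := by
  intro j j' h
  exact Subtype.ext (add_left_cancel (congrArg Subtype.val h))

theorem addUnit_apply_self (hk : 1 ≤ k) (i : Fin d) (j : Occ d (k - 1)) :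
    (addUnit hk i j).1 i = j.1 i + 1 := by
  simp [addUnit, add_comm]

theorem exists_addUnit (hk : 1 ≤ k) {i : Fin d} {b : Occ d k} (h : b.1 i ≠ 0) :
    ∃ j, b = addUnit hk i j := by
  have e : b.1 = Pi.single i 1 + (b.1 - Pi.single i 1) := by
    ext l
    simp only [Pi.add_apply, Pi.sub_apply, Pi.single_apply]
    split_ifs with h'
    · subst h'; omega
    · omega
  refine ⟨⟨b.1 - Pi.single i 1, mem_occ ?_⟩, Subtype.ext e⟩
  have h1 := sum_occ b
  rw [e] at h1
  simp only [Pi.add_apply, Finset.sum_add_distrib, Finset.sum_pi_single',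
      Finset.mem_univ, if_true] at h1
  simp only [Pi.sub_apply] at h1 ⊢
  omega

/-- The occupation number `b_i`, as a sum over the ways to write `b = e_i + j`. -/
theorem sum_addUnit {R : Type*} [Semiring R] (hk : 1 ≤ k) (i : Fin d) (b : Occ d k) :
    ∑ j, (if b = addUnit hk i j then (j.1 i : R) + 1 else 0) = b.1 i := by
  by_cases h : b.1 i = 0
  · rw [h, Nat.cast_zero]
    refine Finset.sum_eq_zero fun j _ => if_neg ?_
    rintro rfl
    simp [addUnit_apply_self] at h
  · obtain ⟨j, rfl⟩ := exists_addUnit hk h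
    simp [(addUnit_injective hk i).eq_iff, addUnit_apply_self]

/-- The normalization `√((k-1)! d! / (k+d-1)!)` of the cloning amplitudes. -/
def cloneAmp (d k : ℕ) : ℝ :=
  √((Nat.factorial (k - 1) * Nat.factorial (1 + d - 1) : ℝ) / Nat.factorial (k + d - 1))

theorem cloneCoeff_eq (i : Fin d) (j : Fin d → ℕ) :
    cloneCoeff d 1 k (Pi.single i 1) j
      = cloneAmp d k * √(∏ l, (Nat.factorial ((Pi.single i 1 : Fin d → ℕ) l + j l) : ℝ)
          / Nat.factorial (j l)) := by
  unfold cloneCoeff cloneAmp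
  congr 2
  refine Finset.prod_congr rfl fun l _ => ?_
  have : (Nat.factorial ((Pi.single i 1 : Fin d → ℕ) l) : ℝ) = 1 := by
    rw [Pi.single_apply]; split_ifs <;> simp
  rw [this, one_mul]

theorem cloneCoeff_mul_self (i : Fin d) (j : Fin d → ℕ) :
    cloneCoeff d 1 k (Pi.single i 1) j * cloneCoeff d 1 k (Pi.single i 1) j
      = cloneAmp d k ^ 2 * (j i + 1) := by
  have h : ∏ l, (Nat.factorial ((Pi.single i 1 : Fin d → ℕ) l + j l) : ℝ) / Nat.factorial (j l)
      = j i + 1 := by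
    rw [Finset.prod_eq_single i]
    · rw [Pi.single_eq_same, add_comm 1, Nat.factorial_succ]
      have : (Nat.factorial (j i) : ℝ) ≠ 0 := by positivity
      push_cast
      field_simp
    · intro l _ hl
      rw [Pi.single_eq_of_ne hl, zero_add]
      exact div_self (by positivity)
    · simp
  rw [cloneCoeff_eq, h, mul_mul_mul_comm, Real.mul_self_sqrt (by positivity), sq]

theorem clonerIsometry_apply (hk : 1 ≤ k) (b : Occ d k) (j : Occ d (k - 1)) (i : Fin d) :
    clonerIsometry d k (b, j) i
      = if b = addUnit hk i j then (cloneCoeff d 1 k (Pi.single i 1) j.1 : ℂ) else 0 := by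
  simp only [clonerIsometry, Matrix.of_apply, addUnit, Subtype.ext_iff]

theorem eq_of_addUnit_eq (hk : 1 ≤ k) {i i' : Fin d} {j : Occ d (k - 1)}
    (h : addUnit hk i j = addUnit hk i' j) : i = i' := by
  have h1 := congrFun (add_right_cancel (congrArg Subtype.val h)) i
  by_contra hne
  simp [hne] at h1

theorem clonerIsometry_mul_conj (hk : 1 ≤ k) (b b' : Occ d k) (j j' : Occ d (k - 1)) (i : Fin d) :
    clonerIsometry d k (b, j) i * conj (clonerIsometry d k (b', j') i)
      = if b = addUnit hk i j ∧ b' = addUnit hk i j' then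
        (cloneCoeff d 1 k (Pi.single i 1) j.1 * cloneCoeff d 1 k (Pi.single i 1) j'.1 : ℂ)
        else 0 := by
  rw [clonerIsometry_apply hk, clonerIsometry_apply hk]
  by_cases h : b = addUnit hk i j <;> by_cases h' : b' = addUnit hk i j' <;> simp [h, h']

theorem cloner_diagonal (hk : 1 ≤ k) (p : Fin d → ℂ) :
    cloner d k (Matrix.diagonal p)
      = Matrix.diagonal fun b => (cloneAmp d k : ℂ) ^ 2 * ∑ i, p i * b.1 i := by
  ext b b'
  rw [cloner, chanOfIsometry_apply]
  have h1 : ∀ e i, ∑ i', clonerIsometry d k (b, e) i * Matrix.diagonal p i i' *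
      conj (clonerIsometry d k (b', e) i') = if b = b' then
        (cloneAmp d k : ℂ) ^ 2 * (p i * if b = addUnit hk i e then ((e.1 i : ℂ) + 1) else 0)
        else 0 := by
    intro e i
    rw [Finset.sum_eq_single i]
    · rw [Matrix.diagonal_apply_eq, mul_right_comm, clonerIsometry_mul_conj hk]
      by_cases h : b = b'
      · subst h
        by_cases h' : b = addUnit hk i e
        · rw [if_pos ⟨h', h'⟩, if_pos rfl, if_pos h']
          have := cloneCoeff_mul_self (k := k) i e.1
          rw [← Complex.ofReal_mul, this]
          push_cast
          ring
        · simp [h']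
      · rw [if_neg h, if_neg (fun h' => h (h'.1.trans h'.2.symm)), zero_mul]
    · intro i' _ hi'
      simp [Matrix.diagonal_apply_ne' _ hi']
    · simp
  rw [Finset.sum_congr rfl fun e _ => Finset.sum_congr rfl fun i _ => h1 e i,
    Matrix.diagonal_apply]
  by_cases h : b = b'
  · simp only [if_pos h, ← Finset.mul_sum]
    rw [Finset.sum_comm]
    simp only [← Finset.mul_sum, sum_addUnit]
  · simp only [if_neg h, Finset.sum_const_zero]

theorem envChan_cloner_diagonal (hk : 1 ≤ k) (p : Fin d → ℂ) :
    envChan (clonerIsometry d k) (Matrix.diagonal p)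
      = Matrix.diagonal fun j => (cloneAmp d k : ℂ) ^ 2 * ∑ i, p i * (j.1 i + 1) := by
  ext j j'
  rw [envChan_apply, Finset.sum_comm]
  have h1 : ∀ i, ∑ b, ∑ i', clonerIsometry d k (b, j) i * Matrix.diagonal p i i' *
      conj (clonerIsometry d k (b, j') i') = if j = j' then
        (cloneAmp d k : ℂ) ^ 2 * (p i * ((j.1 i : ℂ) + 1)) else 0 := by
    intro i
    have h2 : ∀ b, ∑ i', clonerIsometry d k (b, j) i * Matrix.diagonal p i i' *
      conj (clonerIsometry d k (b, j') i') = if b = addUnit hk i j then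
        if j = j' then (cloneAmp d k : ℂ) ^ 2 * (p i * ((j.1 i : ℂ) + 1)) else 0 else 0 := by
      intro b
      rw [Finset.sum_eq_single i]
      · rw [Matrix.diagonal_apply_eq, mul_right_comm, clonerIsometry_mul_conj hk]
        by_cases h : b = addUnit hk i j
        · subst h
          by_cases h' : j = j'
          · subst h'
            rw [if_pos ⟨rfl, rfl⟩, if_pos rfl, if_pos rfl]
            have := cloneCoeff_mul_self (k := k) i j.1
            rw [← Complex.ofReal_mul, this]
            push_cast
            ring
          · rw [if_neg fun hh => h' (addUnit_injective hk i hh.2), if_pos rfl, if_neg h', zero_mul]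
        · simp [h]
      · intro i' _ hi'
        simp [Matrix.diagonal_apply_ne' _ hi']
      · simp
    simp [h2]
  rw [Finset.sum_congr rfl fun i _ => h1 i, Matrix.diagonal_apply]
  by_cases h : j = j'
  · simp only [h, if_true, ← Finset.mul_sum]
  · simp [h]

/-- Counting `∑_b ∑_i b_i` in two ways. -/
theorem mul_card_occ (d m : ℕ) :
    (m + 1) * Fintype.card (Occ d (m + 1)) = (m + d) * Fintype.card (Occ d m) := by
  have h1 : ∑ b : Occ d (m + 1), ∑ i, b.1 i = (m + 1) * Fintype.card (Occ d (m + 1)) := by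
    simp [sum_occ, mul_comm]
  have h2 : ∑ b : Occ d (m + 1), ∑ i, b.1 i
      = ∑ j : Occ d m, ∑ i, (j.1 i + 1) := by
    rw [Finset.sum_comm, Finset.sum_comm (s := (Finset.univ : Finset (Occ d m)))]
    refine Finset.sum_congr rfl fun i _ => ?_
    have h3 : ∀ b : Occ d (m + 1), b.1 i
        = ∑ j : Occ d m, if b = addUnit (Nat.succ_pos m) i j then j.1 i + 1 else 0 := by
      intro b
      have := sum_addUnit (R := ℕ) (Nat.succ_pos m) i b
      exact this.symm
    simp only [fun b => h3 b]
    rw [Finset.sum_comm]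
    simp
  rw [← h1, h2]
  simp [Finset.sum_add_distrib, sum_occ, mul_comm]

theorem card_occ_zero (d : ℕ) : Fintype.card (Occ d 0) = 1 := by
  rw [Fintype.card_eq_one_iff]
  refine ⟨⟨0, mem_occ (by simp)⟩, fun b => Subtype.ext ?_⟩
  have := sum_occ b
  ext i
  simpa using (Finset.sum_eq_zero_iff.mp this) i (Finset.mem_univ i)

theorem card_occ_mul_factorial (hd : 1 ≤ d) (m : ℕ) :
    Fintype.card (Occ d m) * (m.factorial * (d - 1).factorial) = (m + d - 1).factorial := by
  induction m with
  | zero => rw [card_occ_zero]; simp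
  | succ m ih =>
    obtain ⟨d, rfl⟩ := Nat.exists_eq_add_of_le' hd
    have h := mul_card_occ (d + 1) m
    rw [show m + 1 + (d + 1) - 1 = (m + d) + 1 by omega, Nat.factorial_succ (m + d)]
    rw [show m + (d + 1) - 1 = m + d by omega] at ih
    rw [← ih, Nat.factorial_succ m]
    calc _ = ((m + 1) * Fintype.card (Occ (d + 1) (m + 1))) *
          (m.factorial * (d + 1 - 1).factorial) := by ring
      _ = _ := by rw [h]; ring

theorem cloneAmp_sq_mul_card (hd : 1 ≤ d) (hk : 1 ≤ k) :
    cloneAmp d k ^ 2 * k * Fintype.card (Occ d k) = d := by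
  have h := card_occ_mul_factorial hd k
  obtain ⟨d, rfl⟩ := Nat.exists_eq_add_of_le' hd
  obtain ⟨k, rfl⟩ := Nat.exists_eq_add_of_le' hk
  rw [cloneAmp, Real.sq_sqrt (by positivity), ← h,
    show 1 + (d + 1) - 1 = d + 1 by omega, Nat.factorial_succ, Nat.factorial_succ]
  have hc : 0 < Fintype.card (Occ (d + 1) (k + 1)) := by
    by_contra h0
    rw [Nat.pos_iff_ne_zero, not_not] at h0
    rw [h0, zero_mul] at h
    exact (Nat.factorial_ne_zero _) h.symm
  have hc' : (Fintype.card (Occ (d + 1) (k + 1)) : ℝ) ≠ 0 := by positivity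
  have h1 : ((k.factorial : ℕ) : ℝ) ≠ 0 := by positivity
  have h2 : ((d.factorial : ℕ) : ℝ) ≠ 0 := by positivity
  simp only [Nat.add_sub_cancel]
  push_cast
  field_simp

/-- The occupation numbers with the modes permuted. -/
def permOcc {m : ℕ} (g : Equiv.Perm (Fin d)) : Occ d m ≃ Occ d m where
  toFun b := ⟨b.1 ∘ g, mem_occ ((Equiv.sum_comp g b.1).trans (sum_occ b))⟩
  invFun b := ⟨b.1 ∘ g.symm, mem_occ ((Equiv.sum_comp g.symm b.1).trans (sum_occ b))⟩
  left_inv b := by ext; simp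
  right_inv b := by ext; simp

theorem sum_occ_apply {m : ℕ} (i i' : Fin d) :
    ∑ b : Occ d m, b.1 i = ∑ b : Occ d m, b.1 i' := by
  refine Fintype.sum_equiv (permOcc (Equiv.swap i i')) _ _ fun b => ?_
  simp [permOcc]

theorem clonerIsometry_isometry (hd : 1 ≤ d) (hk : 1 ≤ k) :
    (clonerIsometry d k)ᴴ * clonerIsometry d k = 1 := by
  ext i i'
  rw [Matrix.mul_apply, Fintype.sum_prod_type, Finset.sum_comm]
  have h1 : ∀ j : Occ d (k - 1), ∑ b, (clonerIsometry d k)ᴴ i (b, j) * clonerIsometry d k (b, j) i'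
      = if i = i' then ((cloneAmp d k ^ 2 * (j.1 i + 1) : ℝ) : ℂ) else 0 := by
    intro j
    simp only [Matrix.conjTranspose_apply, clonerIsometry_apply hk]
    rw [Finset.sum_eq_single (addUnit hk i j)]
    · by_cases h : i = i'
      · subst h
        rw [← cloneCoeff_mul_self]
        simp
      · have : addUnit hk i j ≠ addUnit hk i' j := fun h' => h (eq_of_addUnit_eq hk h')
        simp [h, this]
    · intro b _ hb
      simp [hb]
    · simp
  simp only [h1, Matrix.one_apply]
  by_cases h : i = i'
  · subst h
    simp only [if_true]
    rw [← Complex.ofReal_sum, ← Complex.ofReal_one]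
    congr 1
    rw [← Finset.mul_sum]
    have hs : (∑ j : Occ d (k - 1), ((j.1 i : ℝ) + 1)) = ∑ b : Occ d k, (b.1 i : ℝ) := by
      simp only [← fun b => sum_addUnit (R := ℝ) hk i b]
      rw [Finset.sum_comm]
      simp
    have hdd : (d : ℝ) * ∑ b : Occ d k, (b.1 i : ℝ) = k * Fintype.card (Occ d k) := by
      have h2 : ∑ i', ∑ b : Occ d k, (b.1 i' : ℝ) = d * ∑ b : Occ d k, (b.1 i : ℝ) := by
        have h3 : ∀ i', ∑ b : Occ d k, (b.1 i' : ℝ) = ∑ b : Occ d k, (b.1 i : ℝ) := fun i' => by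
          exact_mod_cast sum_occ_apply i' i
        simp only [h3, Finset.sum_const, Finset.card_univ, Fintype.card_fin, nsmul_eq_mul]
      rw [← h2, Finset.sum_comm]
      have h4 : ∀ b : Occ d k, ∑ i', (b.1 i' : ℝ) = k := fun b => by exact_mod_cast sum_occ b
      simp [h4, mul_comm]
    have h5 := cloneAmp_sq_mul_card hd hk
    have hd' : (d : ℝ) ≠ 0 := by positivity
    rw [hs]
    apply mul_left_cancel₀ hd'
    rw [mul_left_comm, hdd, mul_one, ← mul_assoc]
    exact h5
  · simp [h]

end Cloner

/-! ### Coherent vectors, the Hadamard property and covariance of the cloner -/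

section Coherent

variable {d k : ℕ}

/-- The coordinates of `ψ^{⊗ m} / √m!` in the occupation number basis of the symmetric subspace. -/
def coherent {m : ℕ} (ψ : Fin d → ℂ) (b : Occ d m) : ℂ :=
  (∏ i, ψ i ^ b.1 i) / ((√(∏ i, ((b.1 i).factorial : ℝ)) : ℝ) : ℂ)

theorem sqrt_mul_self_prod_factorial {m : ℕ} (b : Occ d m) :
    ((√(∏ i, ((b.1 i).factorial : ℝ)) : ℝ) : ℂ) * ((√(∏ i, ((b.1 i).factorial : ℝ)) : ℝ) : ℂ)
      = ((∏ i, (b.1 i).factorial : ℕ) : ℂ) := by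
  rw [← Complex.ofReal_mul, Real.mul_self_sqrt (by positivity)]
  push_cast
  rfl

theorem coherent_mul_conj {m : ℕ} (φ ψ : Fin d → ℂ) (b b' : Occ d m) :
    coherent φ b * conj (coherent ψ b')
      = (∏ i, φ i ^ b.1 i) * conj (∏ i, ψ i ^ b'.1 i) /
        (((√(∏ i, ((b.1 i).factorial : ℝ)) : ℝ) : ℂ) *
          ((√(∏ i, ((b'.1 i).factorial : ℝ)) : ℝ) : ℂ)) := by
  rw [coherent, coherent, map_div₀, Complex.conj_ofReal, div_mul_div_comm]

/-- The multinomial theorem: `⟨φ^{⊗ m}, ψ^{⊗ m}⟩ = ⟨φ, ψ⟩ ^ m`. -/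
theorem coherent_inner (m : ℕ) (φ ψ : Fin d → ℂ) :
    star (coherent φ : Occ d m → ℂ) ⬝ᵥ coherent ψ = (star φ ⬝ᵥ ψ) ^ m / m.factorial := by
  have h : ∀ b : Occ d m, star (coherent φ b) * coherent ψ b
      = (fun n : Fin d → ℕ => ((Nat.multinomial Finset.univ n : ℕ) : ℂ) *
        ∏ i, (star φ i * ψ i) ^ n i) b.1 / m.factorial := by
    intro b
    have hm := Nat.multinomial_spec Finset.univ b.1
    rw [sum_occ] at hm
    have hp : ((∏ i, (b.1 i).factorial : ℕ) : ℂ) ≠ 0 :=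
      Nat.cast_ne_zero.mpr (Finset.prod_ne_zero_iff.mpr fun i _ => Nat.factorial_ne_zero _)
    have hmn : ((Nat.multinomial Finset.univ b.1 : ℕ) : ℂ) ≠ 0 :=
      Nat.cast_ne_zero.mpr (Nat.multinomial_pos _ _).ne'
    rw [Complex.star_def, mul_comm, coherent_mul_conj, sqrt_mul_self_prod_factorial, ← hm]
    simp only [mul_pow, Finset.prod_mul_distrib, Pi.star_apply, Complex.star_def, map_prod, map_pow]
    rw [Nat.cast_mul]
    field_simp
  have h2 : star (coherent φ : Occ d m → ℂ) ⬝ᵥ coherent ψ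
      = ∑ b : Occ d m, (fun n : Fin d → ℕ => ((Nat.multinomial Finset.univ n : ℕ) : ℂ) *
        ∏ i, (star φ i * ψ i) ^ n i) b.1 / m.factorial := Finset.sum_congr rfl fun b _ => h b
  have h3 := Finset.sum_coe_sort (Finset.piAntidiag (Finset.univ : Finset (Fin d)) m)
    (fun n : Fin d → ℕ => ((Nat.multinomial Finset.univ n : ℕ) : ℂ) *
      ∏ i, (star φ i * ψ i) ^ n i)
  rw [h2, ← Finset.sum_div]
  refine congrArg (· / (m.factorial : ℂ)) (h3.trans ?_)
  rw [dotProduct, Finset.sum_pow_eq_sum_piAntidiag]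

/-- The coherent vectors intertwine the cloning isometry with the input. -/
theorem krausOps_conjTranspose_mulVec_coherent (hk : 1 ≤ k) (φ : Fin d → ℂ) (j : Occ d (k - 1)) :
    (krausOps (clonerIsometry d k) j)ᴴ *ᵥ coherent φ = ((cloneAmp d k : ℂ) * coherent φ j) • φ := by
  ext i
  have h1 : ∀ b : Occ d k, (krausOps (clonerIsometry d k) j)ᴴ i b * coherent φ b
      = if b = addUnit hk i j then
        (cloneCoeff d 1 k (Pi.single i 1) j.1 : ℂ) * coherent φ (addUnit hk i j) else 0 := by
    intro b
    rw [Matrix.conjTranspose_apply, krausOps, Matrix.of_apply, clonerIsometry_apply hk]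
    by_cases h : b = addUnit hk i j <;> simp [h]
  rw [Matrix.mulVec, dotProduct, Finset.sum_congr rfl fun b _ => h1 b, Finset.sum_ite_eq',
    if_pos (Finset.mem_univ _), cloneCoeff_eq, Pi.smul_apply, smul_eq_mul, coherent, coherent]
  have h2 : ∏ l, φ l ^ (addUnit hk i j).1 l = φ i * ∏ l, φ l ^ j.1 l := by
    simp only [addUnit, Pi.add_apply, pow_add, Finset.prod_mul_distrib]
    congr 1
    rw [Finset.prod_eq_single i]
    · simp
    · intro l _ hl; simp [Pi.single_eq_of_ne hl]
    · simp
  have h3 : √(∏ l, (((Pi.single i 1 : Fin d → ℕ) l + j.1 l).factorial : ℝ) / (j.1 l).factorial)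
      = √(∏ l, (((addUnit hk i j).1 l).factorial : ℝ)) / √(∏ l, ((j.1 l).factorial : ℝ)) := by
    rw [Finset.prod_div_distrib, Real.sqrt_div (by positivity)]
    rfl
  have h4 : ((√(∏ l, (((addUnit hk i j).1 l).factorial : ℝ)) : ℝ) : ℂ) ≠ 0 :=
    Complex.ofReal_ne_zero.mpr (Real.sqrt_ne_zero'.mpr (by positivity))
  have h5 : ((√(∏ l, ((j.1 l).factorial : ℝ)) : ℝ) : ℂ) ≠ 0 :=
    Complex.ofReal_ne_zero.mpr (Real.sqrt_ne_zero'.mpr (by positivity))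
  rw [h2, h3]
  push_cast
  field_simp

/-- The cloner tested on coherent vectors. -/
theorem coherent_dotProduct_cloner (hk : 1 ≤ k) (φ ψ : Fin d → ℂ) (ρ : Matrix (Fin d) (Fin d) ℂ) :
    star (coherent φ) ⬝ᵥ (cloner d k ρ *ᵥ coherent ψ)
      = (cloneAmp d k : ℂ) ^ 2 * ((star φ ⬝ᵥ ψ) ^ (k - 1) / (k - 1).factorial) *
        (star φ ⬝ᵥ (ρ *ᵥ ψ)) := by
  rw [cloner, chanOfIsometry_eq_krausMap, krausMap, Matrix.sum_mulVec, dotProduct_sum,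
    ← coherent_inner, dotProduct, Finset.mul_sum, Finset.sum_mul]
  refine Finset.sum_congr rfl fun j _ => ?_
  rw [← Matrix.mulVec_mulVec, ← Matrix.mulVec_mulVec, Matrix.dotProduct_mulVec]
  have h : star (coherent φ) ᵥ* krausOps (clonerIsometry d k) j
      = star (((cloneAmp d k : ℂ) * coherent φ j) • φ) := by
    rw [← krausOps_conjTranspose_mulVec_coherent hk, Matrix.star_mulVec,
      Matrix.conjTranspose_conjTranspose]
  rw [h, krausOps_conjTranspose_mulVec_coherent hk, Matrix.mulVec_smul, star_smul,
    smul_dotProduct, dotProduct_smul]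
  simp only [smul_eq_mul, Pi.star_apply, Complex.star_def, map_mul, Complex.conj_ofReal]
  ring

/-- The matrix whose rows are the bras of the coherent vectors `√(w y) ψ_y`. -/
def coherentRows {Y : Type*} (m : ℕ) (w : Y → ℝ) (ψ : Y → Fin d → ℂ) : Matrix Y (Occ d m) ℂ :=
  Matrix.of fun y b => (√(w y) : ℂ) * conj (coherent (ψ y) b)

theorem coherentRows_conj_apply {Y Z : Type*} {m : ℕ} (w : Y → ℝ) (ψ : Y → Fin d → ℂ) (w' : Z → ℝ)
    (ψ' : Z → Fin d → ℂ) (M : Matrix (Occ d m) (Occ d m) ℂ) (y : Y) (z : Z) :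
    (coherentRows m w ψ * M * (coherentRows m w' ψ')ᴴ) y z
      = (√(w y) : ℂ) * (√(w' z) : ℂ) * (star (coherent (ψ y)) ⬝ᵥ (M *ᵥ coherent (ψ' z))) := by
  rw [Matrix.mul_assoc, Matrix.mul_apply]
  simp only [Matrix.mul_apply, coherentRows, Matrix.conjTranspose_apply, Matrix.of_apply,
    dotProduct, Matrix.mulVec, Pi.star_apply, Complex.star_def, map_mul, Complex.conj_ofReal,
    Complex.conj_conj, Finset.mul_sum]
  exact Finset.sum_congr rfl fun b _ => Finset.sum_congr rfl fun b' _ => by ring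

/-- Finitely many coherent vectors resolve the identity of the symmetric subspace. -/
theorem exists_coherent_resolution (d k : ℕ) :
    ∃ (Y : Type) (_ : Fintype Y) (_ : DecidableEq Y) (w : Y → ℝ) (ψ : Y → Fin d → ℂ),
      (coherentRows k w ψ)ᴴ * coherentRows k w ψ = 1 := by
  obtain ⟨Y, _, _, w, ψ, hw, h⟩ := exists_gaussian_design d k
  refine ⟨Y, inferInstance, inferInstance, w, ψ, ?_⟩
  ext b b'
  have h1 : ∀ y, (coherentRows k w ψ)ᴴ b y * coherentRows k w ψ y b'
      = (w y : ℂ) * ((∏ i, ψ y i ^ b.1 i) * conj (∏ i, ψ y i ^ b'.1 i)) /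
        (((√(∏ i, ((b.1 i).factorial : ℝ)) : ℝ) : ℂ) *
          ((√(∏ i, ((b'.1 i).factorial : ℝ)) : ℝ) : ℂ)) := by
    intro y
    rw [mul_div_assoc, ← coherent_mul_conj]
    simp only [coherentRows, Matrix.conjTranspose_apply, Matrix.of_apply, Complex.star_def, map_mul,
      Complex.conj_ofReal, Complex.conj_conj]
    have : (√(w y) : ℂ) * (√(w y) : ℂ) = w y := by
      rw [← Complex.ofReal_mul, Real.mul_self_sqrt (hw y)]
    rw [← this]
    ring
  rw [Matrix.mul_apply, Finset.sum_congr rfl fun y _ => h1 y, ← Finset.sum_div,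
    h _ _ (occ_le b) (occ_le b'), Matrix.one_apply]
  by_cases hb : b = b'
  · subst hb
    rw [if_pos rfl, if_pos rfl, sqrt_mul_self_prod_factorial, div_self]
    exact Nat.cast_ne_zero.mpr (Finset.prod_ne_zero_iff.mpr fun i _ => Nat.factorial_ne_zero _)
  · rw [if_neg hb, if_neg fun h' => hb (Subtype.ext h'), zero_div]

/-- Measuring the clones in the coherent vectors `ψ_y` leaves the environment in the coherent state
of `ψ̄_y`. -/
theorem isHadamard_cloner (hd : 1 ≤ d) (hk : 1 ≤ k) : IsHadamard (clonerIsometry d k) := by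
  obtain ⟨Y, _, _, w, ψ, hW⟩ := exists_coherent_resolution d k
  set N : Y → ℝ := fun y => ∑ e : Occ d (k - 1), Complex.normSq (coherent (ψ y) e) with hN
  have hN0 : ∀ y, 0 ≤ N y := fun y => Finset.sum_nonneg fun _ _ => Complex.normSq_nonneg _
  -- where the coherent vector vanishes the outcome has probability zero: any unit vector will do
  set e₀ : Occ d (k - 1) := ⟨Pi.single ⟨0, hd⟩ (k - 1), mem_occ (by simp)⟩
  refine ⟨Y, inferInstance, inferInstance, coherentRows k w ψ,
    Matrix.of fun y i => (√(w y) : ℂ) * cloneAmp d k * conj (ψ y i) * (√(N y) : ℂ),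
    fun y e => if N y = 0 then if e = e₀ then 1 else 0
      else conj (coherent (ψ y) e) / (√(N y) : ℂ), hW, ?_, ?_⟩
  · intro y
    by_cases h : N y = 0
    · simp [h]
    · simp only [h, if_false, map_div₀, Complex.conj_conj, Complex.conj_ofReal, div_mul_div_comm,
        ← Complex.normSq_eq_conj_mul_self, ← Finset.sum_div]
      rw [← Complex.ofReal_mul, Real.mul_self_sqrt (hN0 y), ← Complex.ofReal_sum,
        ← Complex.ofReal_div, ← Complex.ofReal_one]
      congr 1
      exact div_self h
  · intro y e i
    have h1 := congrArg star
      (congrFun (krausOps_conjTranspose_mulVec_coherent hk (ψ y) e) i)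
    simp only [Matrix.mulVec, dotProduct, Matrix.conjTranspose_apply, star_sum, star_mul',
      krausOps, Matrix.of_apply, Pi.smul_apply, smul_eq_mul, Complex.star_def,
      Complex.conj_conj, Complex.conj_ofReal] at h1
    have h2 : ∑ b, coherentRows k w ψ y b * clonerIsometry d k (b, e) i
        = (√(w y) : ℂ) * (cloneAmp d k * conj (coherent (ψ y) e) * conj (ψ y i)) := by
      rw [← h1, Finset.mul_sum]
      refine Finset.sum_congr rfl fun b _ => ?_
      simp only [coherentRows, Matrix.of_apply]
      ring
    rw [h2, Matrix.of_apply]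
    by_cases h : N y = 0
    · have h3 : coherent (ψ y) e = 0 := by
        have := (Finset.sum_eq_zero_iff_of_nonneg fun _ _ => Complex.normSq_nonneg _).mp h e
          (Finset.mem_univ e)
        exact Complex.normSq_eq_zero.mp this
      simp [h, h3]
    · have h3 : (√(N y) : ℂ) ≠ 0 :=
        Complex.ofReal_ne_zero.mpr (Real.sqrt_ne_zero'.mpr (lt_of_le_of_ne (hN0 y) (Ne.symm h)))
      simp only [if_neg h]
      field_simp

/-- Covariance of the cloner: the representation `R` of `U` on the symmetric subspace maps the
coherent vector of `ψ` to that of `U ψ`. -/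
theorem exists_cloner_conj (hk : 1 ≤ k) {U : Matrix (Fin d) (Fin d) ℂ} (hU : Uᴴ * U = 1) :
    ∃ R : Matrix (Occ d k) (Occ d k) ℂ, Rᴴ * R = 1 ∧
      ∀ ρ, cloner d k (U * ρ * Uᴴ) = R * cloner d k ρ * Rᴴ := by
  obtain ⟨Y, _, _, w, ψ, hW⟩ := exists_coherent_resolution d k
  set W := coherentRows k w ψ with hWdef
  set W' := coherentRows k w fun y => U *ᵥ ψ y with hW'def
  have hinner : ∀ φ ψ : Fin d → ℂ, star (U *ᵥ φ) ⬝ᵥ (U *ᵥ ψ) = star φ ⬝ᵥ ψ := by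
    intro φ ψ
    rw [Matrix.star_mulVec, Matrix.dotProduct_mulVec, Matrix.vecMul_vecMul, hU, Matrix.vecMul_one]
  have hgram : W' * W'ᴴ = W * Wᴴ := by
    ext y y'
    have h1 := coherentRows_conj_apply (m := k) w (fun y => U *ᵥ ψ y) w (fun y => U *ᵥ ψ y) 1 y y'
    have h2 := coherentRows_conj_apply (m := k) w ψ w ψ 1 y y'
    rw [Matrix.mul_one, Matrix.one_mulVec, coherent_inner] at h1 h2
    rw [hWdef, hW'def, h1, h2, hinner]
  have hN : ∀ ρ, W' * cloner d k (U * ρ * Uᴴ) * W'ᴴ = W * cloner d k ρ * Wᴴ := by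
    intro ρ
    ext y y'
    rw [hWdef, hW'def, coherentRows_conj_apply, coherentRows_conj_apply,
      coherent_dotProduct_cloner hk, coherent_dotProduct_cloner hk, hinner]
    congr 2
    rw [Matrix.mulVec_mulVec, Matrix.mul_assoc, hU, Matrix.mul_one, ← Matrix.mulVec_mulVec]
    exact hinner _ _
  set R := W'ᴴ * W with hR
  have hRR : Rᴴ * R = 1 := by
    calc Rᴴ * R = Wᴴ * (W' * W'ᴴ) * W := by
          rw [hR, Matrix.conjTranspose_mul, Matrix.conjTranspose_conjTranspose]
          simp only [Matrix.mul_assoc]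
      _ = (Wᴴ * W) * (Wᴴ * W) := by rw [hgram]; simp only [Matrix.mul_assoc]
      _ = 1 := by rw [hW, Matrix.one_mul]
  -- `S = W'ᴴ W'` satisfies `S ^ 2 = R Rᴴ = 1` and `S ^ 3 = S ^ 2`, hence `S = 1`
  set S := W'ᴴ * W' with hS
  have hS2' : S * S = W'ᴴ * (W * Wᴴ) * W' := by
    rw [hS, ← hgram]; simp only [Matrix.mul_assoc]
  have hS2 : S * S = 1 := by
    rw [hS2', ← mul_eq_one_comm.mp hRR, hR, Matrix.conjTranspose_mul,
      Matrix.conjTranspose_conjTranspose]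
    simp only [Matrix.mul_assoc]
  have hS1 : S = 1 := by
    have h3 : S * (S * S) = S * S := by
      calc S * (S * S) = W'ᴴ * (W' * W'ᴴ) * (W' * W'ᴴ) * W' := by
            rw [hS]; simp only [Matrix.mul_assoc]
        _ = W'ᴴ * W * (Wᴴ * W) * Wᴴ * W' := by rw [hgram]; simp only [Matrix.mul_assoc]
        _ = S * S := by rw [hW, hS2']; simp only [Matrix.mul_assoc, Matrix.mul_one]
    rwa [hS2, Matrix.mul_one] at h3
  refine ⟨R, hRR, fun ρ => ?_⟩
  calc cloner d k (U * ρ * Uᴴ) = S * cloner d k (U * ρ * Uᴴ) * S := by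
        rw [hS1, Matrix.one_mul, Matrix.mul_one]
    _ = W'ᴴ * (W' * cloner d k (U * ρ * Uᴴ) * W'ᴴ) * W' := by
        rw [hS]; simp only [Matrix.mul_assoc]
    _ = R * cloner d k ρ * Rᴴ := by
        rw [hN, hR, Matrix.conjTranspose_mul, Matrix.conjTranspose_conjTranspose]
        simp only [Matrix.mul_assoc]

end Coherent

/-! ### Information quantities of an ensemble -/

section Ensembles

open scoped Kronecker

variable {X A ι κ ε : Type*} [Fintype X] [DecidableEq X] [Fintype A] [DecidableEq A]
  [Fintype ι] [DecidableEq ι] [Fintype κ] [DecidableEq κ] [Fintype ε] [DecidableEq ε]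

/-- The reduced state on `A'` of the (not necessarily normalized) pure state `φ` of `A A'`. -/
def reduced (φ : A × ι → ℂ) : Matrix ι ι ℂ :=
  Matrix.of fun i i' => ∑ a, φ (a, i) * conj (φ (a, i'))

/-- The state `(id_A ⊗ N)(φ)` of `A B`. -/
def jointOut (V : Matrix (κ × ε) ι ℂ) (φ : A × ι → ℂ) : Matrix (A × κ) (A × κ) ℂ :=
  Matrix.of fun u v => chanOfIsometry V (Matrix.of fun i i' => φ (u.1, i) * conj (φ (v.1, i')))
    u.2 v.2

/-- The amplitudes of `V φ` as a matrix between `A B` and the environment. -/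
def outAmplitudes (V : Matrix (κ × ε) ι ℂ) (φ : A × ι → ℂ) : Matrix (A × κ) ε ℂ :=
  Matrix.of fun u e => ∑ i, V (u.2, e) i * φ (u.1, i)

omit [Fintype A] [DecidableEq A] [DecidableEq ι] [Fintype κ] [DecidableEq κ] [DecidableEq ε] in
theorem jointOut_eq (V : Matrix (κ × ε) ι ℂ) (φ : A × ι → ℂ) :
    jointOut V φ = outAmplitudes V φ * (outAmplitudes V φ)ᴴ := by
  ext ⟨a, b⟩ ⟨a', b'⟩
  simp only [jointOut, Matrix.of_apply, chanOfIsometry_apply, outAmplitudes, Matrix.mul_apply,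
    Matrix.conjTranspose_apply, Complex.star_def, map_sum, map_mul, Finset.sum_mul_sum]
  exact Finset.sum_congr rfl fun e _ => Finset.sum_congr rfl fun i _ =>
    Finset.sum_congr rfl fun i' _ => by ring

omit [DecidableEq A] [DecidableEq ι] [DecidableEq κ] [Fintype ε] [DecidableEq ε] in
theorem envChan_reduced (V : Matrix (κ × ε) ι ℂ) (φ : A × ι → ℂ) :
    envChan V (reduced φ) = ((outAmplitudes V φ)ᴴ * outAmplitudes V φ)ᵀ := by
  ext e e'
  have h : ∀ b i i', V (b, e) i * (∑ a, φ (a, i) * conj (φ (a, i'))) * conj (V (b, e') i')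
      = ∑ a, conj (V (b, e') i' * φ (a, i')) * (V (b, e) i * φ (a, i)) := by
    intro b i i'
    rw [Finset.mul_sum, Finset.sum_mul]
    exact Finset.sum_congr rfl fun a _ => by rw [map_mul]; ring
  simp only [Matrix.transpose_apply, Matrix.mul_apply, Matrix.conjTranspose_apply, outAmplitudes,
    Matrix.of_apply, Fintype.sum_prod_type, envChan_apply, reduced, Complex.star_def, h]
  conv_rhs => rw [Finset.sum_comm]
  refine Finset.sum_congr rfl fun b _ => ?_
  have h2 : ∀ a, conj (∑ i, V (b, e') i * φ (a, i)) * ∑ i, V (b, e) i * φ (a, i)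
      = ∑ i, ∑ i', conj (V (b, e') i' * φ (a, i')) * (V (b, e) i * φ (a, i)) := fun a => by
    rw [map_sum, Finset.sum_mul_sum, Finset.sum_comm]
  simp only [h2]
  conv_rhs => rw [Finset.sum_comm]
  exact Finset.sum_congr rfl fun i _ => Finset.sum_comm

omit [DecidableEq ι] in
/-- The state of `A B E` is pure, so `A B` and `E` have the same entropy. -/
theorem entropy_jointOut (V : Matrix (κ × ε) ι ℂ) (φ : A × ι → ℂ) :
    entropy (jointOut V φ) = entropy (envChan V (reduced φ)) := by
  rw [jointOut_eq, envChan_reduced, entropy_transpose, entropy_mul_comm]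

omit [DecidableEq A] [DecidableEq ι] in
theorem posSemidef_reduced (φ : A × ι → ℂ) : (reduced φ).PosSemidef := by
  have e : reduced φ = (Matrix.of fun i a => φ (a, i) : Matrix ι A ℂ) *
      (Matrix.of fun i a => φ (a, i) : Matrix ι A ℂ)ᴴ := by
    ext i i'
    simp [reduced, Matrix.mul_apply]
  rw [e]
  exact Matrix.posSemidef_self_mul_conjTranspose _

omit [Fintype A] [DecidableEq A] [DecidableEq ε] in
theorem traceSnd_jointOut {V : Matrix (κ × ε) ι ℂ} (hV : Vᴴ * V = 1) (φ : A × ι → ℂ) :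
    traceSnd (jointOut V φ) = (Matrix.of fun a i => φ (a, i) : Matrix A ι ℂ) *
      (Matrix.of fun a i => φ (a, i) : Matrix A ι ℂ)ᴴ := by
  ext a a'
  have h := trace_chanOfIsometry hV (Matrix.of fun i i' => φ (a, i) * conj (φ (a', i')))
  simp only [Matrix.trace, Matrix.diag_apply, Matrix.of_apply] at h
  simp [traceSnd_apply, jointOut, h, Matrix.mul_apply]

omit [DecidableEq ε] in
theorem entropy_traceSnd_jointOut {V : Matrix (κ × ε) ι ℂ} (hV : Vᴴ * V = 1) (φ : A × ι → ℂ) :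
    entropy (traceSnd (jointOut V φ)) = entropy (reduced φ) := by
  have e : reduced φ = ((Matrix.of fun a i => φ (a, i) : Matrix A ι ℂ)ᴴ *
      (Matrix.of fun a i => φ (a, i) : Matrix A ι ℂ))ᵀ := by
    ext i i'
    simp [reduced, Matrix.mul_apply, mul_comm]
  rw [traceSnd_jointOut hV, e, entropy_transpose, entropy_mul_comm]

omit [DecidableEq A] [DecidableEq ι] [Fintype κ] [DecidableEq κ] [DecidableEq ε] in
theorem sum_jointOut (V : Matrix (κ × ε) ι ℂ) (φ : A × ι → ℂ) (b b' : κ) :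
    ∑ a, jointOut V φ (a, b) (a, b') = chanOfIsometry V (reduced φ) b b' := by
  have e : reduced φ = ∑ a, (Matrix.of fun i i' => φ (a, i) * conj (φ (a, i'))) := by
    ext i i'
    simp [reduced, Matrix.sum_apply]
  rw [e, map_sum, Matrix.sum_apply]
  rfl

namespace Ensemble

/-- The unnormalized vector `√p(x) φ_x`. -/
def scaled (s : Ensemble X A ι) (x : X) : A × ι → ℂ := fun v => (√(s.prob x) : ℂ) * s.state x v

/-- The unnormalized input state `p(x) Tr_A φ_x` of the channel. -/
def input (s : Ensemble X A ι) (x : X) : Matrix ι ι ℂ := reduced (s.scaled x)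

omit [DecidableEq X] [DecidableEq A] [DecidableEq ι] in
theorem posSemidef_input (s : Ensemble X A ι) (x : X) : (s.input x).PosSemidef :=
  posSemidef_reduced _

omit [DecidableEq X] [DecidableEq A] [DecidableEq ι] in
theorem scaled_mul_conj (s : Ensemble X A ι) (x : X) (u v : A × ι) :
    s.scaled x u * conj (s.scaled x v) = (s.prob x : ℂ) * (s.state x u * conj (s.state x v)) := by
  have : (√(s.prob x) : ℂ) * (√(s.prob x) : ℂ) = s.prob x := by
    rw [← Complex.ofReal_mul, Real.mul_self_sqrt (s.prob_mem.1 x)]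
  rw [scaled, scaled, map_mul, Complex.conj_ofReal, ← this]
  ring

omit [DecidableEq X] [DecidableEq A] [DecidableEq ι] in
theorem input_eq (s : Ensemble X A ι) (x : X) :
    s.input x = (s.prob x : ℂ) • reduced (s.state x) := by
  ext i i'
  simp [input, reduced, scaled_mul_conj, Finset.mul_sum]

omit [DecidableEq X] [DecidableEq A] [DecidableEq ι] in
theorem trace_input (s : Ensemble X A ι) (x : X) : (s.input x).trace = s.prob x := by
  have h : (reduced (s.state x)).trace = ((∑ v, ‖s.state x v‖ ^ 2 : ℝ) : ℂ) := by
    rw [Fintype.sum_prod_type, Finset.sum_comm]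
    push_cast
    simp only [Matrix.trace, Matrix.diag_apply, reduced, Matrix.of_apply, Complex.mul_conj,
      Complex.normSq_eq_norm_sq]
    push_cast
    rfl
  rw [input_eq, Matrix.trace_smul, h, s.state_norm]
  simp

omit [DecidableEq X] [DecidableEq A] [DecidableEq ι] in
theorem sum_trace_input (s : Ensemble X A ι) : ∑ x, (s.input x).trace = 1 := by
  simp only [trace_input]
  exact_mod_cast s.prob_mem.2

omit [Fintype κ] [DecidableEq κ] [DecidableEq ε] [DecidableEq A] [DecidableEq ι] in
theorem outState_eq (V : Matrix (κ × ε) ι ℂ) (s : Ensemble X A ι) :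
    outState (chanOfIsometry V) s = blocks fun x => jointOut V (s.scaled x) := by
  ext ⟨x, a, b⟩ ⟨x', a', b'⟩
  simp only [outState, Matrix.of_apply, blocks, jointOut, scaled_mul_conj]
  by_cases h : x = x'
  · rw [if_pos h, if_pos h]
    have e : (Matrix.of fun i i' => (s.prob x : ℂ) * (s.state x (a, i) * conj (s.state x (a', i'))))
        = (s.prob x : ℂ) •
          (Matrix.of fun i i' => s.state x (a, i) * conj (s.state x (a', i'))) := by
      ext; simp
    rw [e, map_smul]
    rfl
  · rw [if_neg h, if_neg h]

end Ensemble

/-- The vector of the three information quantities that bound the rates of an ensemble. -/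
def infoVec (N : Chan ι κ) (s : Ensemble X A ι) : ℝ × ℝ × ℝ :=
  (infoAXB N s, cohInfo N s, infoXB N s + cohInfo N s)

/-- The three information quantities as a function of the unnormalized input states alone. -/
def inputInfo (V : Matrix (κ × ε) ι ℂ) (ρ : X → Matrix ι ι ℂ) : ℝ × ℝ × ℝ :=
  (entropy (chanOfIsometry V (∑ x, ρ x)) + ∑ x, (entropy (ρ x) - entropy (envChan V (ρ x))),
    ∑ x, (entropy (chanOfIsometry V (ρ x)) - entropy (envChan V (ρ x))),
    entropy (chanOfIsometry V (∑ x, ρ x))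
      + ∑ x, (Real.negMulLog (ρ x).trace.re - entropy (envChan V (ρ x))))

/-- All entropies of the output state are sums over the letters `x`, and the purity of the state of
`A B E` for each letter removes the system `A`. -/
theorem infoVec_eq_inputInfo {V : Matrix (κ × ε) ι ℂ} (hV : Vᴴ * V = 1) (s : Ensemble X A ι) :
    infoVec (chanOfIsometry V) s = inputInfo V s.input := by
  have hps : ∀ x, (jointOut V (s.scaled x)).PosSemidef := fun x => by
    rw [jointOut_eq]; exact Matrix.posSemidef_self_mul_conjTranspose _
  have h0 : entropy (outState (chanOfIsometry V) s) = ∑ x, entropy (envChan V (s.input x)) := by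
    rw [s.outState_eq, entropy_blocks _ fun x => (hps x).1]
    exact Finset.sum_congr rfl fun x _ => entropy_jointOut V _
  have h1 : entropy (margXA (outState (chanOfIsometry V) s)) = ∑ x, entropy (s.input x) := by
    have e : margXA (outState (chanOfIsometry V) s)
        = blocks fun x => traceSnd (jointOut V (s.scaled x)) := by
      ext ⟨x, a⟩ ⟨x', a'⟩
      rw [s.outState_eq]
      by_cases h : x = x' <;> simp [margXA, blocks, traceSnd_apply, h]
    rw [e, entropy_blocks _ fun x => (posSemidef_traceSnd (hps x)).1]
    exact Finset.sum_congr rfl fun x _ => entropy_traceSnd_jointOut hV _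
  have h2 : entropy (margXB (outState (chanOfIsometry V) s))
      = ∑ x, entropy (chanOfIsometry V (s.input x)) := by
    have e : margXB (outState (chanOfIsometry V) s)
        = blocks fun x => chanOfIsometry V (s.input x) := by
      ext ⟨x, b⟩ ⟨x', b'⟩
      rw [s.outState_eq]
      by_cases h : x = x' <;> simp [margXB, blocks, Ensemble.input, ← sum_jointOut, h]
    rw [e, entropy_blocks _ fun x => (posSemidef_chanOfIsometry V (s.posSemidef_input x)).1]
  have h3 : entropy (margX (outState (chanOfIsometry V) s))
      = ∑ x, Real.negMulLog (s.input x).trace.re := by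
    have e : margX (outState (chanOfIsometry V) s)
        = Matrix.diagonal fun x => (s.input x).trace := by
      ext x x'
      rw [s.outState_eq, Matrix.diagonal_apply, ← trace_chanOfIsometry hV]
      by_cases h : x = x'
      · subst h
        simp only [margX, blocks, Matrix.of_apply, if_true, Matrix.trace, Matrix.diag_apply,
          Ensemble.input, ← sum_jointOut]
        exact Finset.sum_comm
      · simp [margX, blocks, h]
    rw [e, entropy_diagonal_trace fun x => s.posSemidef_input x]
  have h4 : margB (outState (chanOfIsometry V) s) = chanOfIsometry V (∑ x, s.input x) := by
    ext b b'
    rw [s.outState_eq, map_sum, Matrix.sum_apply]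
    simp [margB, blocks, Ensemble.input, ← sum_jointOut]
  simp only [infoVec, inputInfo, infoAXB, cohInfo, infoXB, h0, h1, h2, h3, h4,
    Finset.sum_sub_distrib]
  refine Prod.ext ?_ (Prod.ext ?_ ?_) <;> simp only <;> ring

theorem weightedInfo_eq {V : Matrix (κ × ε) ι ℂ} (hV : Vᴴ * V = 1) (ν lam μ : ℝ)
    (s : Ensemble X A ι) :
    weightedInfo (chanOfIsometry V) ν lam μ s
      = (ν + μ) * entropy (chanOfIsometry V (∑ x, s.input x))
        + ∑ x, condInfo V ν lam μ (s.input x) := by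
  have h := infoVec_eq_inputInfo hV s
  have h1 : infoAXB (chanOfIsometry V) s = (inputInfo V s.input).1 := congrArg Prod.fst h
  have h2 : cohInfo (chanOfIsometry V) s = (inputInfo V s.input).2.1 :=
    congrArg (fun v => v.2.1) h
  have h3 : infoXB (chanOfIsometry V) s + cohInfo (chanOfIsometry V) s
      = (inputInfo V s.input).2.2 := congrArg (fun v => v.2.2) h
  rw [weightedInfo, h3, h1, h2]
  simp only [inputInfo, condInfo, Finset.sum_add_distrib, Finset.sum_sub_distrib, ← Finset.mul_sum]
  ring

omit [DecidableEq X] [DecidableEq A] [DecidableEq ι] in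
theorem posSemidef_sum_input (s : Ensemble X A ι) : (∑ x, s.input x).PosSemidef :=
  Matrix.posSemidef_sum _ fun x _ => s.posSemidef_input x

/-- A bound on `condInfo` per input bounds the weighted sum of any ensemble. -/
theorem weightedInfo_le {V : Matrix (κ × ε) ι ℂ} (hV : Vᴴ * V = 1) {ν lam μ γ : ℝ}
    (hν : 0 ≤ ν) (hμ : 0 ≤ μ)
    (hγ : ∀ ρ : Matrix ι ι ℂ, ρ.PosSemidef → condInfo V ν lam μ ρ ≤ γ * ρ.trace.re)
    (s : Ensemble X A ι) :
    weightedInfo (chanOfIsometry V) ν lam μ s ≤ (ν + μ) * Real.log (Fintype.card κ) + γ := by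
  rw [weightedInfo_eq hV]
  have ht : (∑ x, s.input x).trace = 1 := by rw [Matrix.trace_sum, s.sum_trace_input]
  have h1 := entropy_le_log_card (posSemidef_chanOfIsometry V (posSemidef_sum_input s))
    (by rw [trace_chanOfIsometry hV, ht])
  have h2 : ∑ x, condInfo V ν lam μ (s.input x) ≤ γ := by
    refine (Finset.sum_le_sum fun x _ => hγ _ (s.posSemidef_input x)).trans_eq ?_
    rw [← Finset.mul_sum, ← Complex.re_sum, s.sum_trace_input, Complex.one_re, mul_one]
  exact add_le_add (mul_le_mul_of_nonneg_left h1 (add_nonneg hν hμ)) h2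

/-- The entropies of a covariant channel are invariant under the group action. -/
theorem condInfo_conj {V : Matrix (κ × ε) ι ℂ} {U : Matrix ι ι ℂ} {R : Matrix κ κ ℂ}
    (hU : Uᴴ * U = 1) (hR : Rᴴ * R = 1)
    (h : ∀ ρ, chanOfIsometry V (U * ρ * Uᴴ) = R * chanOfIsometry V ρ * Rᴴ) (ν lam μ : ℝ)
    {ρ : Matrix ι ι ℂ} (hρ : ρ.PosSemidef) :
    condInfo V ν lam μ (U * ρ * Uᴴ) = condInfo V ν lam μ ρ := by
  -- the environment has the entropy of the output together with a purification of the input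
  have hE : entropy (envChan V (U * ρ * Uᴴ)) = entropy (envChan V ρ) := by
    obtain ⟨S, rfl⟩ := exists_eq_mul_conjTranspose hρ
    have e1 : ∀ S : Matrix ι ι ℂ, S * Sᴴ = reduced fun v => S v.2 v.1 := by
      intro S
      ext i i'
      simp [reduced, Matrix.mul_apply]
    have e2 : U * (S * Sᴴ) * Uᴴ = (U * S) * (U * S)ᴴ := by
      rw [Matrix.conjTranspose_mul]; simp only [Matrix.mul_assoc]
    rw [e2, e1, e1, ← entropy_jointOut, ← entropy_jointOut]
    have e3 : jointOut V (fun v : ι × ι => (U * S) v.2 v.1)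
        = ((1 : Matrix ι ι ℂ) ⊗ₖ R) * jointOut V (fun v : ι × ι => S v.2 v.1)
          * ((1 : Matrix ι ι ℂ) ⊗ₖ R)ᴴ := by
      ext ⟨a, b⟩ ⟨a', b'⟩
      have e4 : (Matrix.of fun i i' => (U * S) i a * conj ((U * S) i' a'))
          = U * (Matrix.of fun i i' => S i a * conj (S i' a')) * Uᴴ := by
        ext i i'
        simp only [Matrix.mul_apply, Matrix.of_apply, Matrix.conjTranspose_apply, map_sum, map_mul,
          Finset.sum_mul, Complex.star_def]
        rw [Finset.sum_comm]
        refine Finset.sum_congr rfl fun j _ => ?_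
        rw [Finset.mul_sum]
        exact Finset.sum_congr rfl fun j' _ => by ring
      simp only [jointOut, Matrix.of_apply, e4, h]
      simp only [Matrix.mul_apply, Fintype.sum_prod_type, Matrix.kroneckerMap_apply,
        Matrix.one_apply, Matrix.conjTranspose_apply, Matrix.of_apply, ite_mul, one_mul, zero_mul,
        apply_ite star, star_zero, mul_ite, mul_zero, Finset.sum_ite_irrel, Finset.sum_const_zero,
        Finset.sum_ite_eq, Finset.mem_univ, if_true]
    rw [e3, entropy_conj_isometry]
    rw [Matrix.conjTranspose_kronecker, ← Matrix.mul_kronecker_mul, hR]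
    simp
  have hT : (U * ρ * Uᴴ).trace = ρ.trace := by
    rw [Matrix.trace_mul_comm, ← Matrix.mul_assoc, hU, Matrix.one_mul]
  rw [condInfo, h, entropy_conj_isometry _ hR, entropy_conj_isometry _ hU, hE, hT, condInfo]

theorem condInfo_smul {V : Matrix (κ × ε) ι ℂ} (hV : Vᴴ * V = 1) (ν lam μ t : ℝ)
    {ρ : Matrix ι ι ℂ} (hρ : ρ.PosSemidef) :
    condInfo V ν lam μ ((t : ℂ) • ρ) = t * condInfo V ν lam μ ρ := by
  simp only [condInfo, map_smul, Matrix.trace_smul, smul_eq_mul, Complex.re_ofReal_mul,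
    Real.negMulLog_mul]
  rw [entropy_smul t hρ.1, entropy_smul t (posSemidef_chanOfIsometry V hρ).1,
    entropy_smul t (posSemidef_envChan V hρ).1, trace_chanOfIsometry hV, trace_envChan hV]
  ring

omit [DecidableEq X] in
theorem inputInfo_submatrix {κ₁ ε₁ ι₁ : Type*} [Fintype κ₁] [DecidableEq κ₁] [Fintype ε₁]
    [DecidableEq ε₁] [Fintype ι₁] [DecidableEq ι₁] (V : Matrix (κ × ε) ι ℂ) (f : κ₁ ≃ κ)
    (g : ε₁ ≃ ε) (h : ι₁ ≃ ι) (ρ : X → Matrix ι ι ℂ) :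
    inputInfo (V.submatrix (Prod.map f g) h) (fun x => (ρ x).submatrix h h) = inputInfo V ρ := by
  have hs : ∑ x, (ρ x).submatrix h h = (∑ x, ρ x).submatrix h h := by
    ext i i'
    simp [Matrix.sum_apply]
  have hT : ∀ ρ : Matrix ι ι ℂ, (ρ.submatrix h h).trace = ρ.trace :=
    fun ρ => h.sum_comp fun i => ρ i i
  simp only [inputInfo, hs, chanOfIsometry_submatrix, envChan_submatrix, hT,
    entropy_submatrix_equiv]

omit [Fintype ι] [DecidableEq ι] [Fintype κ] [DecidableEq κ] [Fintype ε] [DecidableEq ε] in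
theorem powIso_one (V : Matrix (κ × ε) ι ℂ) :
    powIso V 1 = V.submatrix (Prod.map (Equiv.funUnique (Fin 1) κ) (Equiv.funUnique (Fin 1) ε))
      (Equiv.funUnique (Fin 1) ι) := by
  ext ⟨b, e⟩ i
  simp [powIso]

/-- An ensemble for a channel gives one for its first tensor power. -/
def Ensemble.onPowOne (s : Ensemble X A ι) : Ensemble X A (Fin 1 → ι) where
  prob := s.prob
  prob_mem := s.prob_mem
  state x v := s.state x (v.1, v.2 0)
  state_norm x := by
    rw [← s.state_norm x]
    exact ((Equiv.refl A).prodCongr (Equiv.funUnique (Fin 1) ι)).sum_comp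
      fun v => ‖s.state x v‖ ^ 2

theorem infoVec_onPowOne {V : Matrix (κ × ε) ι ℂ} (hV : Vᴴ * V = 1) (s : Ensemble X A ι) :
    infoVec (chanPow (chanOfIsometry V) 1) s.onPowOne = infoVec (chanOfIsometry V) s := by
  rw [chanPow_chanOfIsometry, infoVec_eq_inputInfo (isometry_powIso hV 1),
    infoVec_eq_inputInfo hV, powIso_one]
  exact inputInfo_submatrix V _ _ (Equiv.funUnique (Fin 1) ι) s.input

end Ensembles

/-! ### Information quantities of the cloner -/

section ClonerInfo

variable {d k : ℕ}

/-- The output entropy of the cloner on the diagonal state with eigenvalues `p`. -/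
def outEntropy (k : ℕ) (p : Fin d → ℝ) : ℝ :=
  ∑ b : Occ d k, Real.negMulLog (cloneAmp d k ^ 2 * ∑ i, p i * b.1 i)

/-- The environment entropy of the cloner on the diagonal state with eigenvalues `p`. -/
def envEntropy (k : ℕ) (p : Fin d → ℝ) : ℝ :=
  ∑ j : Occ d (k - 1), Real.negMulLog (cloneAmp d k ^ 2 * ∑ i, p i * (j.1 i + 1))

theorem entropy_cloner_diagonal (hk : 1 ≤ k) (p : Fin d → ℝ) :
    entropy (cloner d k (Matrix.diagonal fun i => (p i : ℂ))) = outEntropy k p := by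
  rw [cloner_diagonal hk, outEntropy, ← entropy_diagonal]
  congr 2
  funext b
  push_cast
  rfl

theorem entropy_envChan_cloner_diagonal (hk : 1 ≤ k) (p : Fin d → ℝ) :
    entropy (envChan (clonerIsometry d k) (Matrix.diagonal fun i => (p i : ℂ)))
      = envEntropy k p := by
  rw [envChan_cloner_diagonal hk, envEntropy, ← entropy_diagonal]
  congr 2
  funext b
  push_cast
  rfl

theorem outEntropy_perm (g : Equiv.Perm (Fin d)) (p : Fin d → ℝ) :
    outEntropy k (fun i => p (g i)) = outEntropy k p := by
  refine Fintype.sum_equiv (permOcc g.symm) _ _ fun b => ?_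
  rw [← Equiv.sum_comp g fun i => p i * ((permOcc g.symm b).1 i : ℝ)]
  simp [permOcc]

theorem envEntropy_perm (g : Equiv.Perm (Fin d)) (p : Fin d → ℝ) :
    envEntropy k (fun i => p (g i)) = envEntropy k p := by
  refine Fintype.sum_equiv (permOcc g.symm) _ _ fun b => ?_
  rw [← Equiv.sum_comp g fun i => p i * ((permOcc g.symm b).1 i + 1 : ℝ)]
  simp [permOcc]

/-- The three information quantities shared by all cyclic ensembles with parameters `p`. -/
def cyclicInfo (k : ℕ) (p : Fin d → ℝ) : ℝ × ℝ × ℝ :=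
  (Real.log (Fintype.card (Occ d k)) + ∑ i, Real.negMulLog (p i) - envEntropy k p,
    outEntropy k p - envEntropy k p,
    Real.log (Fintype.card (Occ d k)) - envEntropy k p)

theorem continuous_cyclicInfo (d k : ℕ) : Continuous (cyclicInfo k : (Fin d → ℝ) → _) := by
  have h1 : Continuous (outEntropy k : (Fin d → ℝ) → ℝ) :=
    continuous_finsetSum _ fun b _ => Real.continuous_negMulLog.comp (by fun_prop)
  have h2 : Continuous (envEntropy k : (Fin d → ℝ) → ℝ) :=
    continuous_finsetSum _ fun b _ => Real.continuous_negMulLog.comp (by fun_prop)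
  have h3 : Continuous fun p : Fin d → ℝ => ∑ i, Real.negMulLog (p i) :=
    continuous_finsetSum _ fun b _ => Real.continuous_negMulLog.comp (by fun_prop)
  exact ((continuous_const.add h3).sub h2).prodMk ((h1.sub h2).prodMk (continuous_const.sub h2))

theorem cyclicInfo_perm (g : Equiv.Perm (Fin d)) (p : Fin d → ℝ) :
    cyclicInfo k (fun i => p (g i)) = cyclicInfo k p := by
  rw [cyclicInfo, outEntropy_perm, envEntropy_perm,
    Equiv.sum_comp g fun i => Real.negMulLog (p i), cyclicInfo]

/-- The weighted sum of the components of a vector of three information quantities. -/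
def weigh (ν lam μ : ℝ) (v : ℝ × ℝ × ℝ) : ℝ := ν * v.1 + lam * v.2.1 + μ * v.2.2

theorem weightedInfo_eq_weigh {X A ι κ : Type*} [Fintype X] [DecidableEq X] [Fintype A]
    [DecidableEq A] [Fintype ι] [Fintype κ] [DecidableEq κ] (N : Chan ι κ) (ν lam μ : ℝ)
    (s : Ensemble X A ι) : weightedInfo N ν lam μ s = weigh ν lam μ (infoVec N s) := rfl

theorem condInfo_cloner_diagonal (hk : 1 ≤ k) (ν lam μ : ℝ) {p : Fin d → ℝ}
    (hp : ∑ i, p i = 1) :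
    condInfo (clonerIsometry d k) ν lam μ (Matrix.diagonal fun i => (p i : ℂ))
      = weigh ν lam μ (cyclicInfo k p) - (ν + μ) * Real.log (Fintype.card (Occ d k)) := by
  have ht : (Matrix.diagonal fun i => (p i : ℂ)).trace.re = 1 := by
    rw [Matrix.trace_diagonal, ← Complex.ofReal_sum, hp]; simp
  have h := entropy_cloner_diagonal (d := d) hk p
  rw [cloner] at h
  rw [condInfo, ht, h, entropy_envChan_cloner_diagonal hk, entropy_diagonal, weigh, cyclicInfo,
    Real.negMulLog_one]
  ring

/-- By covariance and homogeneity, a bound on the cyclic ensembles controls `condInfo` on every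
input. -/
theorem condInfo_cloner_le (hd : 1 ≤ d) (hk : 1 ≤ k) {ν lam μ M : ℝ}
    (hM : ∀ p ∈ stdSimplex ℝ (Fin d), weigh ν lam μ (cyclicInfo k p) ≤ M)
    (ρ : Matrix (Fin d) (Fin d) ℂ) (hρ : ρ.PosSemidef) :
    condInfo (clonerIsometry d k) ν lam μ ρ
      ≤ (M - (ν + μ) * Real.log (Fintype.card (Occ d k))) * ρ.trace.re := by
  have hV := clonerIsometry_isometry hd hk
  obtain ⟨U, q, hU, -, hq, rfl⟩ := exists_spectral_posSemidef hρ
  obtain ⟨R, hR, hc⟩ := exists_cloner_conj (k := k) hk hU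
  have hps : ∀ q : Fin d → ℝ, (∀ i, 0 ≤ q i) →
      (Matrix.diagonal fun i => (q i : ℂ)).PosSemidef := fun q hq =>
    Matrix.PosSemidef.diagonal fun i => Complex.zero_le_real.2 (hq i)
  rw [condInfo_conj hU hR hc _ _ _ (hps q hq), trace_conj_diagonal hU, Complex.ofReal_re]
  rcases (Finset.sum_nonneg fun i _ => hq i : 0 ≤ ∑ i, q i).eq_or_lt' with h0 | h0
  · have hq0 : q = 0 := funext fun i =>
      (Finset.sum_eq_zero_iff_of_nonneg fun i _ => hq i).1 h0 i (Finset.mem_univ i)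
    have e : (Matrix.diagonal fun i => (q i : ℂ))
        = ((0 : ℝ) : ℂ) • (0 : Matrix (Fin d) (Fin d) ℂ) := by
      rw [hq0]; ext; simp [Matrix.diagonal_apply]
    rw [e, condInfo_smul hV _ _ _ _ Matrix.PosSemidef.zero, h0]
    simp
  · set t := ∑ i, q i with ht
    have hsum : ∑ i, q i / t = 1 := by rw [← Finset.sum_div, div_self h0.ne']
    have e : (Matrix.diagonal fun i => (q i : ℂ))
        = ((t : ℝ) : ℂ) • Matrix.diagonal fun i => ((q i / t : ℝ) : ℂ) := by
      rw [← Matrix.diagonal_smul]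
      congr 1
      funext i
      rw [Pi.smul_apply, smul_eq_mul, ← Complex.ofReal_mul, mul_div_cancel₀ _ h0.ne']
    rw [e, condInfo_smul hV _ _ _ _ (hps _ fun i => div_nonneg (hq i) h0.le),
      condInfo_cloner_diagonal hk _ _ _ hsum, mul_comm t]
    refine mul_le_mul_of_nonneg_right (sub_le_sub_right (hM _ ⟨fun i => ?_, hsum⟩) _) h0.le
    exact div_nonneg (hq i) h0.le

/-- A bound on the weighted sum of the cyclic ensembles holds for every ensemble. -/
theorem weightedInfo_cloner_le (hd : 1 ≤ d) (hk : 1 ≤ k) {ν lam μ M : ℝ} (hν : 0 ≤ ν) (hμ : 0 ≤ μ)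
    (hM : ∀ p ∈ stdSimplex ℝ (Fin d), weigh ν lam μ (cyclicInfo k p) ≤ M)
    {X A : Type*} [Fintype X] [DecidableEq X] [Fintype A] [DecidableEq A]
    (s : Ensemble X A (Fin d)) : weightedInfo (cloner d k) ν lam μ s ≤ M := by
  have h := weightedInfo_le (clonerIsometry_isometry hd hk) hν hμ (condInfo_cloner_le hd hk hM) s
  rwa [add_sub_cancel] at h

/-- The bound on the weighted sum is additive over tensor powers of the cloner. -/
theorem weightedInfo_chanPow_cloner_le (hd : 1 ≤ d) (hk : 1 ≤ k) {ν lam μ M : ℝ} (hν : 0 ≤ ν)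
    (hlam : 0 ≤ lam) (hμ : 0 ≤ μ)
    (hM : ∀ p ∈ stdSimplex ℝ (Fin d), weigh ν lam μ (cyclicInfo k p) ≤ M) (n : ℕ)
    {X A : Type*} [Fintype X] [DecidableEq X] [Fintype A] [DecidableEq A]
    (s : Ensemble X A (Fin n → Fin d)) :
    weightedInfo (chanPow (cloner d k) n) ν lam μ s ≤ n * M := by
  have hV := clonerIsometry_isometry hd hk
  rw [cloner, chanPow_chanOfIsometry]
  refine (weightedInfo_le (isometry_powIso hV n) hν hμ (condInfo_powIso_le hV
    (isHadamard_cloner hd hk) hν hlam hμ (condInfo_cloner_le hd hk hM) n) s).trans_eq ?_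
  rw [Fintype.card_fun, Fintype.card_fin, Nat.cast_pow, Real.log_pow]
  ring

theorem card_occ_pos (hd : 1 ≤ d) (hk : 1 ≤ k) : (0 : ℝ) < Fintype.card (Occ d k) := by
  have h := cloneAmp_sq_mul_card hd hk
  have hd' : (0 : ℝ) < d := by exact_mod_cast hd
  rcases (Nat.cast_nonneg (Fintype.card (Occ d k)) : (0 : ℝ) ≤ _).eq_or_lt' with h0 | h0
  · rw [h0, mul_zero] at h; exact absurd h hd'.ne
  · exact h0

/-- The maximally mixed input of the cloner has a maximally mixed output. -/
theorem outEntropy_const (hd : 1 ≤ d) (hk : 1 ≤ k) :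
    outEntropy k (fun _ : Fin d => 1 / (d : ℝ)) = Real.log (Fintype.card (Occ d k)) := by
  have hD := card_occ_pos hd hk
  have hd' : (0 : ℝ) < d := by exact_mod_cast hd
  have h : ∀ b : Occ d k, Real.negMulLog (cloneAmp d k ^ 2 * ∑ i, 1 / (d : ℝ) * b.1 i)
      = (Fintype.card (Occ d k) : ℝ)⁻¹ * Real.log (Fintype.card (Occ d k)) := by
    intro b
    have e : cloneAmp d k ^ 2 * ∑ i, 1 / (d : ℝ) * b.1 i = (Fintype.card (Occ d k) : ℝ)⁻¹ := by
      rw [← Finset.mul_sum, ← Nat.cast_sum, sum_occ]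
      refine eq_inv_of_mul_eq_one_left ?_
      have := cloneAmp_sq_mul_card hd hk
      field_simp
      linarith
    rw [e, Real.negMulLog, Real.log_inv]
    ring
  rw [outEntropy, Finset.sum_congr rfl fun b _ => h b, Finset.sum_const, Finset.card_univ,
    nsmul_eq_mul, mul_inv_cancel_left₀ hD.ne']

/-- If the reduced input states are diagonal and average to the maximally mixed state, the three
information quantities are averages of those of the cyclic ensembles. -/
theorem infoVec_eq_sum_cyclicInfo (hd : 1 ≤ d) (hk : 1 ≤ k) {X A : Type*} [Fintype X]
    [DecidableEq X] [Fintype A] [DecidableEq A] (s : Ensemble X A (Fin d)) (P : X → Fin d → ℝ)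
    (hs : ∀ x, reduced (s.state x) = Matrix.diagonal fun i => (P x i : ℂ))
    (hP : ∀ x, ∑ i, P x i = 1) (havg : ∀ i, ∑ x, s.prob x * P x i = 1 / (d : ℝ)) :
    infoVec (cloner d k) s = ∑ x, s.prob x • cyclicInfo k (P x) := by
  have hV := clonerIsometry_isometry hd hk
  have hps : ∀ x, (Matrix.diagonal fun i => (P x i : ℂ)).PosSemidef := fun x => by
    rw [← hs]; exact posSemidef_reduced _
  have hT : ∀ x, (Matrix.diagonal fun i => (P x i : ℂ)).trace = 1 := fun x => by
    rw [Matrix.trace_diagonal, ← Complex.ofReal_sum, hP, Complex.ofReal_one]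
  have hin : ∀ x, s.input x = (s.prob x : ℂ) • Matrix.diagonal fun i => (P x i : ℂ) := fun x => by
    rw [s.input_eq, hs]
  have hsum : ∑ x, s.input x = Matrix.diagonal fun _ => ((1 / (d : ℝ) : ℝ) : ℂ) := by
    ext i i'
    rw [Matrix.sum_apply, Matrix.diagonal_apply]
    split_ifs with h
    · subst h
      rw [← havg i]
      push_cast
      exact Finset.sum_congr rfl fun x _ => by simp [hin]
    · exact Finset.sum_eq_zero fun x _ => by simp [hin, h]
  have e1 : ∀ x, entropy (s.input x)
      = s.prob x * ∑ i, Real.negMulLog (P x i) + Real.negMulLog (s.prob x) := fun x => by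
    rw [hin, entropy_smul _ (hps x).1, hT, entropy_diagonal]; simp
  have e2 : ∀ x, entropy (chanOfIsometry (clonerIsometry d k) (s.input x))
      = s.prob x * outEntropy k (P x) + Real.negMulLog (s.prob x) := fun x => by
    rw [hin, map_smul, entropy_smul _ (posSemidef_chanOfIsometry _ (hps x)).1,
      trace_chanOfIsometry hV, hT, ← entropy_cloner_diagonal hk, cloner]; simp
  have e3 : ∀ x, entropy (envChan (clonerIsometry d k) (s.input x))
      = s.prob x * envEntropy k (P x) + Real.negMulLog (s.prob x) := fun x => by
    rw [hin, map_smul, entropy_smul _ (posSemidef_envChan _ (hps x)).1,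
      trace_envChan hV, hT, entropy_envChan_cloner_diagonal hk]; simp
  have e4 : entropy (chanOfIsometry (clonerIsometry d k) (∑ x, s.input x))
      = ∑ x, s.prob x * Real.log (Fintype.card (Occ d k)) := by
    rw [← Finset.sum_mul, s.prob_mem.2, one_mul, hsum, ← outEntropy_const hd hk,
      ← entropy_cloner_diagonal hk, cloner]
  rw [cloner, infoVec_eq_inputInfo hV]
  simp only [inputInfo, e1, e2, e3, e4, s.trace_input, Complex.ofReal_re, ← Finset.sum_add_distrib]
  refine Prod.ext ?_ (Prod.ext ?_ ?_) <;>
    simp only [Prod.fst_sum, Prod.snd_sum, Prod.smul_fst, Prod.smul_snd, cyclicInfo,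
      smul_eq_mul] <;>
    exact Finset.sum_congr rfl fun x _ => by ring

/-- The ensemble of the pure states `∑ i, √(P x i) |i⟩ ⊗ |i⟩`. -/
def diagEnsemble {X : Type*} [Fintype X] {t : X → ℝ} (ht : t ∈ stdSimplex ℝ X) (P : X → Fin d → ℝ)
    (hP : ∀ x, P x ∈ stdSimplex ℝ (Fin d)) : Ensemble X (Fin d) (Fin d) where
  prob := t
  prob_mem := ht
  state x v := if v.1 = v.2 then (√(P x v.2) : ℂ) else 0
  state_norm x := by
    rw [← (hP x).2, Fintype.sum_prod_type]
    refine Finset.sum_congr rfl fun a _ => ?_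
    rw [Finset.sum_eq_single a (fun i _ h => by simp [Ne.symm h]) (by simp)]
    rw [if_pos rfl, Complex.norm_real, Real.norm_eq_abs, sq_abs, Real.sq_sqrt ((hP x).1 a)]

theorem reduced_diagEnsemble {X : Type*} [Fintype X] {t : X → ℝ} (ht : t ∈ stdSimplex ℝ X)
    (P : X → Fin d → ℝ) (hP : ∀ x, P x ∈ stdSimplex ℝ (Fin d)) (x : X) :
    reduced ((diagEnsemble ht P hP).state x) = Matrix.diagonal fun i => (P x i : ℂ) := by
  ext i i'
  rw [reduced, Matrix.of_apply, Matrix.diagonal_apply, Finset.sum_eq_single i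
    (fun a _ h => by simp [diagEnsemble, h]) (by simp)]
  simp only [diagEnsemble, if_true]
  split_ifs with h
  · subst h
    rw [Complex.conj_ofReal, ← Complex.ofReal_mul, Real.mul_self_sqrt ((hP x).1 i)]
  · simp

theorem shift_mem_stdSimplex {p : Fin d → ℝ} (hp : p ∈ stdSimplex ℝ (Fin d)) (x : Fin d) :
    (fun i => p (i - x)) ∈ stdSimplex ℝ (Fin d) := by
  have : NeZero d := ⟨fun h => by subst h; exact x.elim0⟩
  exact ⟨fun i => hp.1 _, ((Equiv.subRight x).sum_comp p).trans hp.2⟩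

theorem sum_shift {p : Fin d → ℝ} (hp : p ∈ stdSimplex ℝ (Fin d)) (i : Fin d) :
    ∑ x, p (i - x) = 1 := by
  have : NeZero d := ⟨fun h => by subst h; exact i.elim0⟩
  exact ((Equiv.subLeft i).sum_comp p).trans hp.2

theorem cyclicInfo_shift (p : Fin d → ℝ) (x : Fin d) :
    cyclicInfo k (fun i => p (i - x)) = cyclicInfo k p := by
  have : NeZero d := ⟨fun h => by subst h; exact x.elim0⟩
  exact cyclicInfo_perm (Equiv.subRight x) p

theorem IsCyclic.infoVec_eq (hd : 1 ≤ d) (hk : 1 ≤ k) {A : Type*} [Fintype A] [DecidableEq A]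
    {p : Fin d → ℝ} (hp : p ∈ stdSimplex ℝ (Fin d)) {s : Ensemble (Fin d) A (Fin d)}
    (hs : IsCyclic p s) : infoVec (cloner d k) s = cyclicInfo k p := by
  rw [infoVec_eq_sum_cyclicInfo hd hk s (fun x i => p (i - x))]
  · simp only [cyclicInfo_shift, ← Finset.sum_smul, s.prob_mem.2, one_smul]
  · intro x
    ext i i'
    rw [reduced, Matrix.of_apply, hs.2, Matrix.diagonal_apply]
  · exact fun x => (shift_mem_stdSimplex hp x).2
  · intro i
    simp only [hs.1, ← Finset.mul_sum, sum_shift hp, mul_one]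

theorem exists_isCyclic (hd : 1 ≤ d) {p : Fin d → ℝ} (hp : p ∈ stdSimplex ℝ (Fin d)) :
    ∃ s : Ensemble (Fin d) (Fin d) (Fin d), IsCyclic p s := by
  have hd' : (0 : ℝ) < d := by exact_mod_cast hd
  have ht : (fun _ => 1 / (d : ℝ)) ∈ stdSimplex ℝ (Fin d) :=
    ⟨fun _ => by positivity, by simp [hd'.ne']⟩
  refine ⟨diagEnsemble ht (fun x i => p (i - x)) (shift_mem_stdSimplex hp), fun _ => rfl,
    fun x i i' => ?_⟩
  have h := congrFun (congrFun (reduced_diagEnsemble ht _ (shift_mem_stdSimplex hp) x) i) i'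
  rwa [Matrix.diagonal_apply] at h

/-- Time sharing between cyclic ensembles is realized by a single ensemble, because they all have
the maximally mixed state as their average input. -/
theorem exists_infoVec_eq_sum (hd : 1 ≤ d) (hk : 1 ≤ k) {Y : Type*} [Fintype Y] {w : Y → ℝ}
    (hw : w ∈ stdSimplex ℝ Y) (p : Y → Fin d → ℝ) (hp : ∀ y, p y ∈ stdSimplex ℝ (Fin d)) :
    ∃ (m : ℕ) (s : Ensemble (Fin m) (Fin d) (Fin d)),
      infoVec (cloner d k) s = ∑ y, w y • cyclicInfo k (p y) := by
  have hd' : (0 : ℝ) < d := by exact_mod_cast hd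
  let e := (Fintype.equivFin (Y × Fin d)).symm
  have ht : (fun x => w (e x).1 / (d : ℝ)) ∈ stdSimplex ℝ (Fin (Fintype.card (Y × Fin d))) := by
    refine ⟨fun x => div_nonneg (hw.1 _) hd'.le, ?_⟩
    rw [e.sum_comp fun v => w v.1 / (d : ℝ), Fintype.sum_prod_type]
    simp [mul_div_cancel₀ _ hd'.ne', hw.2]
  have hP : ∀ x, (fun i => p (e x).1 (i - (e x).2)) ∈ stdSimplex ℝ (Fin d) := fun x =>
    shift_mem_stdSimplex (hp _) _
  -- the letters are the pairs of a cyclic ensemble `y` and one of its `d` shifts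
  refine ⟨_, diagEnsemble ht _ hP, ?_⟩
  rw [infoVec_eq_sum_cyclicInfo hd hk _ _ (reduced_diagEnsemble ht _ hP) (fun x => (hP x).2)]
  · simp only [cyclicInfo_shift, diagEnsemble]
    rw [e.sum_comp fun v => (w v.1 / (d : ℝ)) • cyclicInfo k (p v.1), Fintype.sum_prod_type]
    refine Finset.sum_congr rfl fun y _ => ?_
    simp only
    rw [Finset.sum_const, Finset.card_univ, Fintype.card_fin, ← Nat.cast_smul_eq_nsmul ℝ, smul_smul,
      mul_div_cancel₀ _ hd'.ne']
  · intro i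
    simp only [diagEnsemble]
    rw [e.sum_comp fun v => w v.1 / (d : ℝ) * p v.1 (i - v.2), Fintype.sum_prod_type]
    simp only [← Finset.mul_sum, sum_shift (hp _), mul_one, ← Finset.sum_div, hw.2]

end ClonerInfo

/-! ### Convex geometry of the rate region -/

section Convexity

/-- By Carathéodory's theorem the convex hull of a compact set in finite dimension is the union of
finitely many continuous images of compact sets. -/
theorem isCompact_convexHull {E : Type*} [NormedAddCommGroup E] [NormedSpace ℝ E]
    [FiniteDimensional ℝ E] {s : Set E} (hs : IsCompact s) : IsCompact (convexHull ℝ s) := by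
  have h : convexHull ℝ s = ⋃ n ∈ Finset.range (Module.finrank ℝ E + 2),
      (fun v : (Fin n → ℝ) × (Fin n → E) => ∑ i, v.1 i • v.2 i) ''
        (stdSimplex ℝ (Fin n) ×ˢ Set.univ.pi fun _ => s) := by
    ext x
    simp only [Set.mem_iUnion, Finset.mem_range]
    constructor
    · intro hx
      obtain ⟨ι, _, z, w, hz, hind, hw, hw1, hx⟩ := eq_pos_convex_span_of_mem_convexHull hx
      let e := (Fintype.equivFin ι).symm
      refine ⟨Fintype.card ι, ?_, (w ∘ e, z ∘ e),
        ⟨⟨fun i => (hw _).le, (e.sum_comp w).trans hw1⟩, fun i _ => hz ⟨_, rfl⟩⟩,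
        (e.sum_comp fun i => w i • z i).trans hx⟩
      have := hind.card_le_finrank_succ
      have := Submodule.finrank_le (vectorSpan ℝ (Set.range z))
      omega
    · rintro ⟨n, -, ⟨w, z⟩, ⟨hw, hz⟩, rfl⟩
      exact (convex_convexHull ℝ s).sum_mem (fun i _ => hw.1 i) hw.2
        fun i _ => subset_convexHull ℝ s (hz i trivial)
  rw [h]
  refine Finset.isCompact_biUnion _ fun n _ => IsCompact.image ?_ (by fun_prop)
  exact (isCompact_stdSimplex ℝ (Fin n)).prod (isCompact_univ_pi fun _ => hs)

theorem nonneg_of_forall_lt_add_mul {a b c : ℝ} (h : ∀ t, 0 ≤ t → c < a + t * b) : 0 ≤ b := by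
  by_contra! hb
  have h0 := h 0 le_rfl
  have h1 := h ((a - c) / -b) (div_nonneg (by linarith) (by linarith))
  have h2 : (a - c) / -b * b = c - a := by rw [div_neg, neg_mul, div_mul_cancel₀ _ hb.ne, neg_sub]
  linarith

theorem map_eq_weigh (f : ℝ × ℝ × ℝ →L[ℝ] ℝ) (v : ℝ × ℝ × ℝ) :
    f v = weigh (f (1, 0, 0)) (f (0, 1, 0)) (f (0, 0, 1)) v := by
  have e : v = v.1 • (1, 0, 0) + v.2.1 • (0, 1, 0) + v.2.2 • ((0, 0, 1) : ℝ × ℝ × ℝ) := by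
    ext <;> simp
  conv_lhs => rw [e]
  simp only [map_add, map_smul, smul_eq_mul, weigh]
  ring

theorem continuous_weigh (ν lam μ : ℝ) : Continuous (weigh ν lam μ) := by
  unfold weigh
  fun_prop

theorem weigh_mono {ν lam μ : ℝ} (hν : 0 ≤ ν) (hlam : 0 ≤ lam) (hμ : 0 ≤ μ) {v w : ℝ × ℝ × ℝ}
    (h : v ≤ w) : weigh ν lam μ v ≤ weigh ν lam μ w := by
  have h1 := mul_le_mul_of_nonneg_left h.1 hν
  have h2 := mul_le_mul_of_nonneg_left h.2.1 hlam
  have h3 := mul_le_mul_of_nonneg_left h.2.2 hμ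
  exact add_le_add (add_le_add h1 h2) h3

/-- The three combinations of the rates that are bounded by information quantities. -/
def rateSums : (ℝ × ℝ × ℝ) ≃ₗ[ℝ] ℝ × ℝ × ℝ where
  toFun r := (r.1 + 2 * r.2.1, r.2.1 + r.2.2, r.1 + r.2.1 + r.2.2)
  invFun v := (v.2.2 - v.2.1, (v.1 + v.2.1 - v.2.2) / 2, (v.2.1 + v.2.2 - v.1) / 2)
  map_add' r s := by ext <;> simp <;> ring
  map_smul' c r := by ext <;> simp <;> ring
  left_inv r := by ext <;> simp <;> ring
  right_inv r := by ext <;> simp <;> ring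

theorem mem_stateRegion_iff {X A ι κ : Type*} [Fintype X] [DecidableEq X] [Fintype A]
    [DecidableEq A] [Fintype ι] [Fintype κ] [DecidableEq κ] {N : Chan ι κ} {s : Ensemble X A ι}
    {r : ℝ × ℝ × ℝ} : r ∈ stateRegion N s ↔ rateSums r ≤ infoVec N s := Iff.rfl

variable {d k : ℕ}

/-- The information vectors obtained by time sharing between cyclic ensembles. -/
def cyclicHull (d k : ℕ) : Set (ℝ × ℝ × ℝ) := convexHull ℝ (cyclicInfo k '' stdSimplex ℝ (Fin d))

theorem isCompact_cyclicHull (d k : ℕ) : IsCompact (cyclicHull d k) :=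
  isCompact_convexHull ((isCompact_stdSimplex ℝ (Fin d)).image (continuous_cyclicInfo d k))

theorem mem_cyclicRegion_iff (hd : 1 ≤ d) (hk : 1 ≤ k) {p : Fin d → ℝ}
    (hp : p ∈ stdSimplex ℝ (Fin d)) {r : ℝ × ℝ × ℝ} :
    r ∈ cyclicRegion (cloner d k) p ↔ rateSums r ≤ cyclicInfo k p := by
  simp only [cyclicRegion, Set.mem_iUnion, mem_stateRegion_iff]
  constructor
  · rintro ⟨a, s, hs, h⟩
    rwa [hs.infoVec_eq hd hk hp] at h
  · intro h
    obtain ⟨s, hs⟩ := exists_isCyclic hd hp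
    exact ⟨d, s, hs, by rwa [hs.infoVec_eq hd hk hp]⟩

/-- Slack in the bounds of a convex combination can be moved to each of its members. -/
theorem mem_convexHull_cyclicRegion (hd : 1 ≤ d) (hk : 1 ≤ k) {S : Set (Fin d → ℝ)}
    (hS : S ⊆ stdSimplex ℝ (Fin d)) {y r : ℝ × ℝ × ℝ} (hy : y ∈ convexHull ℝ (cyclicInfo k '' S))
    (hr : rateSums r ≤ y) :
    r ∈ convexHull ℝ (⋃ p ∈ S, cyclicRegion (cloner d k) p) := by
  set C := convexHull ℝ (⋃ p ∈ S, cyclicRegion (cloner d k) p)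
  have hC : Convex ℝ C := convex_convexHull ℝ _
  set q := y - rateSums r with hq
  have hconv : Convex ℝ {v | rateSums.symm (v - q) ∈ C} := by
    intro v hv w hw a b ha hb hab
    have e : a • v + b • w - q = a • (v - q) + b • (w - q) := by
      rw [← eq_sub_iff_add_eq'] at hab
      rw [hab]
      module
    simp only [Set.mem_ofPred_eq, e, map_add, map_smul]
    exact hC hv hw ha hb hab
  have h := convexHull_min (s := cyclicInfo k '' S) ?_ hconv hy
  · simpa [hq] using h
  · rintro _ ⟨p, hp, rfl⟩
    refine subset_convexHull ℝ _ (Set.mem_biUnion hp ((mem_cyclicRegion_iff hd hk (hS hp)).2 ?_))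
    rw [LinearEquiv.apply_symm_apply]
    exact sub_le_self _ (sub_nonneg.2 hr)

theorem exists_le_of_mem_convexHull_cyclicRegion (hd : 1 ≤ d) (hk : 1 ≤ k) {r : ℝ × ℝ × ℝ}
    (hr : r ∈ convexHull ℝ (⋃ p ∈ stdSimplex ℝ (Fin d), cyclicRegion (cloner d k) p)) :
    ∃ y ∈ cyclicHull d k, rateSums r ≤ y := by
  have hconv : Convex ℝ {r | ∃ y ∈ cyclicHull d k, rateSums r ≤ y} := by
    rintro v ⟨y, hy, hvy⟩ w ⟨z, hz, hwz⟩ a b ha hb hab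
    refine ⟨a • y + b • z, convex_convexHull ℝ _ hy hz ha hb hab, ?_⟩
    rw [map_add, map_smul, map_smul]
    exact add_le_add (smul_le_smul_of_nonneg_left hvy ha) (smul_le_smul_of_nonneg_left hwz hb)
  refine convexHull_min (fun r hr => ?_) hconv hr
  obtain ⟨p, hp, hr⟩ := Set.mem_iUnion₂.1 hr
  exact ⟨_, subset_convexHull ℝ _ ⟨p, hp, rfl⟩, (mem_cyclicRegion_iff hd hk hp).1 hr⟩

theorem mem_cqeRegion_of_le (hd : 1 ≤ d) (hk : 1 ≤ k) {y r : ℝ × ℝ × ℝ} (hy : y ∈ cyclicHull d k)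
    (hr : rateSums r ≤ y) : r ∈ cqeRegion (cloner d k) := by
  obtain ⟨ι, _, z, w, hz, -, hw, hw1, rfl⟩ := eq_pos_convex_span_of_mem_convexHull hy
  choose p hp hpz using fun i => hz ⟨i, rfl⟩
  obtain ⟨m, s, hs⟩ := exists_infoVec_eq_sum hd hk (w := w) ⟨fun i => (hw i).le, hw1⟩ p hp
  simp only [hpz] at hs
  refine subset_closure (Set.mem_biUnion (Set.mem_Ici.2 le_rfl) ?_)
  rw [Nat.cast_one, div_one, one_smul]
  refine Set.mem_iUnion₂.2 ⟨m, d, Set.mem_iUnion.2 ⟨s.onPowOne, mem_stateRegion_iff.2 ?_⟩⟩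
  rw [cloner, infoVec_onPowOne (clonerIsometry_isometry hd hk)]
  exact hr.trans_eq hs.symm

/-- Every linear bound with nonnegative weights on the cyclic ensembles holds on the whole capacity
region. -/
theorem weigh_le_of_mem_cqeRegion (hd : 1 ≤ d) (hk : 1 ≤ k) {ν lam μ M : ℝ} (hν : 0 ≤ ν)
    (hlam : 0 ≤ lam) (hμ : 0 ≤ μ)
    (hM : ∀ p ∈ stdSimplex ℝ (Fin d), weigh ν lam μ (cyclicInfo k p) ≤ M) {r : ℝ × ℝ × ℝ}
    (hr : r ∈ cqeRegion (cloner d k)) : weigh ν lam μ (rateSums r) ≤ M := by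
  have hcl : IsClosed {r | weigh ν lam μ (rateSums r) ≤ M} :=
    isClosed_le ((continuous_weigh ν lam μ).comp
      rateSums.toLinearMap.continuous_of_finiteDimensional) continuous_const
  refine closure_minimal (Set.iUnion₂_subset fun n hn => ?_) hcl hr
  rintro _ ⟨r, hr, rfl⟩
  simp only [oneShotRegion, Set.mem_iUnion, mem_stateRegion_iff] at hr
  obtain ⟨m, a, s, hs⟩ := hr
  have hn' : (0 : ℝ) < n := by exact_mod_cast (Set.mem_Ici.1 hn : 1 ≤ n)
  have h := (weigh_mono hν hlam hμ hs).trans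
    (weightedInfo_chanPow_cloner_le hd hk hν hlam hμ hM n s)
  have e : weigh ν lam μ (rateSums ((1 / (n : ℝ)) • r))
      = weigh ν lam μ (rateSums r) / n := by
    rw [map_smul]
    simp only [weigh, Prod.smul_fst, Prod.smul_snd, smul_eq_mul]
    ring
  simp only [Set.mem_ofPred_eq, e]
  exact (div_le_iff₀' hn').2 h

/-- A vector that is not below the compact convex set `cyclicHull` is separated from it, together
with all larger vectors, by a functional with nonnegative weights. -/
theorem exists_le_of_mem_cqeRegion (hd : 1 ≤ d) (hk : 1 ≤ k) {r : ℝ × ℝ × ℝ}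
    (hr : r ∈ cqeRegion (cloner d k)) : ∃ y ∈ cyclicHull d k, rateSums r ≤ y := by
  by_contra! hno
  obtain ⟨f, u, v, hu, huv, hv⟩ := geometric_hahn_banach_compact_closed
    (convex_convexHull ℝ _ : Convex ℝ (cyclicHull d k)) (isCompact_cyclicHull d k)
    (convex_Ici (𝕜 := ℝ) (rateSums r)) isClosed_Ici (Set.disjoint_left.2 fun y hy h => hno y hy h)
  have hpos : ∀ e : ℝ × ℝ × ℝ, 0 ≤ e → 0 ≤ f e := fun e he =>
    nonneg_of_forall_lt_add_mul (a := f (rateSums r)) (c := v) fun t ht => by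
      have := hv (rateSums r + t • e) (le_add_of_nonneg_right (smul_nonneg ht he))
      rwa [map_add, map_smul, smul_eq_mul] at this
  have h := weigh_le_of_mem_cqeRegion hd hk (hpos (1, 0, 0) (by simp [Prod.le_def]))
    (hpos (0, 1, 0) (by simp [Prod.le_def])) (hpos (0, 0, 1) (by simp [Prod.le_def])) (M := u)
    (fun p hp => by
      rw [← map_eq_weigh]
      exact (hu _ (subset_convexHull ℝ _ ⟨p, hp, rfl⟩)).le) hr
  rw [← map_eq_weigh] at h
  have := hv _ (Set.mem_Ici.2 (le_refl (rateSums r)))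
  linarith

theorem cqeRegion_cloner (hd : 1 ≤ d) (hk : 1 ≤ k) :
    cqeRegion (cloner d k)
      = convexHull ℝ (⋃ p ∈ stdSimplex ℝ (Fin d), cyclicRegion (cloner d k) p) := by
  refine Set.Subset.antisymm (fun r hr => ?_) fun r hr => ?_
  · obtain ⟨y, hy, h⟩ := exists_le_of_mem_cqeRegion hd hk hr
    exact mem_convexHull_cyclicRegion hd hk subset_rfl hy h
  · obtain ⟨y, hy, h⟩ := exists_le_of_mem_convexHull_cyclicRegion hd hk hr
    exact mem_cqeRegion_of_le hd hk hy h

theorem cyclicMaximizes_of_forall_le (hd : 1 ≤ d) (hk : 1 ≤ k) {ν lam μ : ℝ} (hν : 0 ≤ ν)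
    (hμ : 0 ≤ μ) {p : Fin d → ℝ} (hp : p ∈ stdSimplex ℝ (Fin d))
    (hmax : ∀ q ∈ stdSimplex ℝ (Fin d),
      weigh ν lam μ (cyclicInfo k q) ≤ weigh ν lam μ (cyclicInfo k p)) :
    CyclicMaximizes (cloner d k) ν lam μ p := by
  refine ⟨⟨d, exists_isCyclic hd hp⟩, fun a s hs => ⟨⟨d, a, s, rfl⟩, ?_⟩⟩
  rintro _ ⟨m, b, s', rfl⟩
  rw [weightedInfo_eq_weigh _ _ _ _ s, hs.infoVec_eq hd hk hp]
  exact weightedInfo_cloner_le hd hk hν hμ hmax s'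

theorem exists_cyclicMaximizes (hd : 1 ≤ d) (hk : 1 ≤ k) {ν lam μ : ℝ} (hν : 0 ≤ ν) (hμ : 0 ≤ μ) :
    ∃ p ∈ stdSimplex ℝ (Fin d), CyclicMaximizes (cloner d k) ν lam μ p := by
  have hc : Continuous fun p : Fin d → ℝ => weigh ν lam μ (cyclicInfo k p) :=
    (continuous_weigh ν lam μ).comp (continuous_cyclicInfo d k)
  obtain ⟨p, hp, hmax⟩ := (isCompact_stdSimplex ℝ (Fin d)).exists_isMaxOn
    ⟨_, single_mem_stdSimplex ℝ (⟨0, hd⟩ : Fin d)⟩ hc.continuousOn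
  exact ⟨p, hp, cyclicMaximizes_of_forall_le hd hk hν hμ hp hmax⟩

/-- The vectors strictly below some time-shared information vector in all three components. -/
def strictLower (d k : ℕ) : Set (ℝ × ℝ × ℝ) :=
  {v | ∃ y ∈ cyclicHull d k, v.1 < y.1 ∧ v.2.1 < y.2.1 ∧ v.2.2 < y.2.2}

theorem convex_strictLower (d k : ℕ) : Convex ℝ (strictLower d k) := by
  have key : ∀ {a b x y x' y' : ℝ}, 0 ≤ a → 0 ≤ b → a + b = 1 → x < x' → y < y' →
      a * x + b * y < a * x' + b * y' := by
    intro a b x y x' y' ha hb hab hx hy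
    rcases ha.eq_or_lt with rfl | ha
    · rw [zero_add] at hab
      simp [hab, hy]
    · exact add_lt_add_of_lt_of_le (mul_lt_mul_of_pos_left hx ha)
        (mul_le_mul_of_nonneg_left hy.le hb)
  rintro v ⟨y, hy, h1, h2, h3⟩ w ⟨z, hz, h4, h5, h6⟩ a b ha hb hab
  exact ⟨a • y + b • z, convex_convexHull ℝ _ hy hz ha hb hab, key ha hb hab h1 h4,
    key ha hb hab h2 h5, key ha hb hab h3 h6⟩

theorem isOpen_strictLower (d k : ℕ) : IsOpen (strictLower d k) := by
  have e : strictLower d k = ⋃ y ∈ cyclicHull d k,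
      {v : ℝ × ℝ × ℝ | v.1 < y.1 ∧ v.2.1 < y.2.1 ∧ v.2.2 < y.2.2} := by
    ext v
    simp only [strictLower, Set.mem_iUnion, exists_prop]
    rfl
  rw [e]
  refine isOpen_biUnion fun y _ => ?_
  exact (isOpen_lt continuous_fst continuous_const).inter
    ((isOpen_lt (continuous_fst.comp continuous_snd) continuous_const).inter
      (isOpen_lt (continuous_snd.comp continuous_snd) continuous_const))

theorem rateSums_notMem_strictLower (hd : 1 ≤ d) (hk : 1 ≤ k) {r : ℝ × ℝ × ℝ}
    (hr : Maximal (· ∈ cqeRegion (cloner d k)) r) : rateSums r ∉ strictLower d k := by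
  rintro ⟨y, hy, h1, h2, h3⟩
  -- raising all three rates by `δ` raises the three sums by at most `3 δ`
  obtain ⟨δ, hδ, h1', h2', h3'⟩ : ∃ δ : ℝ, 0 < δ ∧ (rateSums r).1 + 3 * δ ≤ y.1 ∧
      (rateSums r).2.1 + 3 * δ ≤ y.2.1 ∧ (rateSums r).2.2 + 3 * δ ≤ y.2.2 := by
    refine ⟨min (y.1 - (rateSums r).1) (min (y.2.1 - (rateSums r).2.1)
      (y.2.2 - (rateSums r).2.2)) / 3, by simp [h1, h2, h3], ?_, ?_, ?_⟩ <;> grind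
  have hmem : r + (δ, δ, δ) ∈ cqeRegion (cloner d k) := by
    refine mem_cqeRegion_of_le hd hk hy ⟨?_, ?_, ?_⟩ <;>
      simp only [rateSums, LinearEquiv.coe_mk, LinearMap.coe_mk, AddHom.coe_mk, Prod.fst_add,
        Prod.snd_add] at h1' h2' h3' ⊢ <;> linarith
  have h := (hr.2 hmem ⟨by simpa using hδ.le, by simpa using hδ.le, by simpa using hδ.le⟩).1
  simp only [Prod.fst_add] at h
  linarith

/-- A Pareto-optimal point maximizes a linear functional, given by a hyperplane that supports the
set of achievable information vectors. Only cyclic ensembles that maximize the same functional can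
take part in a convex combination that reaches the maximum. -/
theorem exists_weights_of_maximal (hd : 1 ≤ d) (hk : 1 ≤ k) {r : ℝ × ℝ × ℝ}
    (hr : Maximal (· ∈ cqeRegion (cloner d k)) r) :
    ∃ ν lam μ : ℝ, 0 ≤ ν ∧ 0 ≤ lam ∧ 0 ≤ μ ∧ 0 < ν + lam + μ ∧
      r ∈ convexHull ℝ (⋃ p ∈ {p | p ∈ stdSimplex ℝ (Fin d) ∧
        CyclicMaximizes (cloner d k) ν lam μ p}, cyclicRegion (cloner d k) p) := by
  obtain ⟨y, hy, hry⟩ := exists_le_of_mem_cqeRegion hd hk hr.1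
  obtain ⟨f, hf⟩ := geometric_hahn_banach_open_point (convex_strictLower d k)
    (isOpen_strictLower d k) (rateSums_notMem_strictLower hd hk hr)
  have hlow : ∀ z ∈ cyclicHull d k, ∀ e : ℝ × ℝ × ℝ, 0 ≤ e → ∀ δ : ℝ, 0 < δ →
      f z - f e - δ * f (1, 1, 1) < f (rateSums r) := by
    intro z hz e he δ hδ
    have := hf (z - e - δ • (1, 1, 1)) ⟨z, hz, by
      have h1 := he.1
      have h2 := he.2.1
      have h3 := he.2.2
      simp only [Prod.fst_zero, Prod.snd_zero] at h1 h2 h3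
      refine ⟨?_, ?_, ?_⟩ <;>
        simp only [Prod.fst_sub, Prod.snd_sub, Prod.smul_fst, Prod.smul_snd, smul_eq_mul] <;>
        linarith⟩
    simpa only [map_sub, map_smul, smul_eq_mul] using this
  have hpos : ∀ e : ℝ × ℝ × ℝ, 0 ≤ e → 0 ≤ f e := fun e he =>
    nonneg_of_forall_lt_add_mul (a := f (rateSums r)) (c := f y - f (1, 1, 1)) fun t ht => by
      have := hlow y hy (t • e) (smul_nonneg ht he) 1 one_pos
      rw [map_smul, smul_eq_mul] at this
      linarith
  have h1 := hpos (1, 0, 0) (by simp [Prod.le_def])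
  have h2 := hpos (0, 1, 0) (by simp [Prod.le_def])
  have h3 := hpos (0, 0, 1) (by simp [Prod.le_def])
  have hle : ∀ z ∈ cyclicHull d k, f z ≤ f (rateSums r) := by
    intro z hz
    have h111 := hpos (1, 1, 1) (by simp [Prod.le_def])
    refine le_of_forall_pos_lt_add fun η hη => ?_
    have h := hlow z hz 0 le_rfl (η / (f (1, 1, 1) + 1)) (by positivity)
    have h' : η / (f (1, 1, 1) + 1) * f (1, 1, 1) ≤ η := by
      rw [div_mul_eq_mul_div, div_le_iff₀ (by positivity)]
      nlinarith
    rw [map_zero] at h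
    linarith
  have hfy : f y = f (rateSums r) := le_antisymm (hle y hy) (by
    rw [map_eq_weigh f y, map_eq_weigh f (rateSums r)]
    exact weigh_mono h1 h2 h3 hry)
  refine ⟨_, _, _, h1, h2, h3, ?_, ?_⟩
  · refine lt_of_le_of_ne (by positivity) fun h0 => ?_
    have e1 : f (1, 0, 0) = 0 := by linarith
    have e2 : f (0, 1, 0) = 0 := by linarith
    have e3 : f (0, 0, 1) = 0 := by linarith
    have h := hlow y hy 0 le_rfl 1 one_pos
    rw [map_eq_weigh f (1, 1, 1), e1, e2, e3, hfy] at h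
    simp [weigh] at h
  · obtain ⟨ι, _, z, w, hz, -, hw, hw1, hyz⟩ := eq_pos_convex_span_of_mem_convexHull hy
    have hzK : ∀ i, z i ∈ cyclicHull d k := fun i => subset_convexHull ℝ _ (hz ⟨i, rfl⟩)
    -- a convex combination with positive weights is maximal only if all its members are
    have heq : ∀ i, f (z i) = f (rateSums r) := by
      have h : ∑ i, w i * (f (rateSums r) - f (z i)) = 0 := by
        simp only [mul_sub, Finset.sum_sub_distrib, ← Finset.sum_mul, hw1, one_mul]
        rw [← hfy, ← hyz, map_sum]
        simp
      intro i
      have h' := (Finset.sum_eq_zero_iff_of_nonneg fun i _ =>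
        mul_nonneg (hw i).le (sub_nonneg.2 (hle _ (hzK i)))).1 h i (Finset.mem_univ i)
      rcases mul_eq_zero.1 h' with h' | h'
      · exact absurd h' (hw i).ne'
      · linarith
    refine mem_convexHull_cyclicRegion hd hk (fun p hp => hp.1) (y := y) ?_ hry
    rw [← hyz]
    refine (convex_convexHull ℝ _).sum_mem (fun i _ => (hw i).le) hw1
      fun i _ => subset_convexHull ℝ _ ?_
    obtain ⟨p, hp, hpz⟩ := hz ⟨i, rfl⟩
    refine ⟨p, ⟨hp, cyclicMaximizes_of_forall_le hd hk h1 h3 hp fun q hq => ?_⟩, hpz⟩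
    rw [← map_eq_weigh, ← map_eq_weigh, hpz, heq i]
    exact hle _ (subset_convexHull ℝ _ ⟨q, hq, rfl⟩)

end Convexity

end

end QCloner

theorem theorem3 (d k : ℕ) (hd : 1 ≤ d) (hk : 1 ≤ k) :
    -- cyclic ensembles maximize the quantum dynamic capacity formula
    (∀ lam μ : ℝ, 0 ≤ lam → 0 ≤ μ → ∃ p ∈ stdSimplex ℝ (Fin d),
      QCloner.CyclicMaximizes (QCloner.cloner d k) 1 lam μ p) ∧
    -- they give the whole capacity region, up to time sharing
    QCloner.cqeRegion (QCloner.cloner d k) =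
      convexHull ℝ (⋃ p ∈ stdSimplex ℝ (Fin d), QCloner.cyclicRegion (QCloner.cloner d k) p) ∧
    -- every Pareto-optimal point comes from cyclic ensembles with the same optimal weighted sum
    (∀ r : ℝ × ℝ × ℝ, Maximal (· ∈ QCloner.cqeRegion (QCloner.cloner d k)) r →
      ∃ ν lam μ : ℝ, 0 ≤ ν ∧ 0 ≤ lam ∧ 0 ≤ μ ∧ 0 < ν + lam + μ ∧
        r ∈ convexHull ℝ
          (⋃ p ∈ {p | p ∈ stdSimplex ℝ (Fin d) ∧
              QCloner.CyclicMaximizes (QCloner.cloner d k) ν lam μ p},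
            QCloner.cyclicRegion (QCloner.cloner d k) p)) := by
  refine ⟨fun lam μ _ hμ => QCloner.exists_cyclicMaximizes hd hk zero_le_one hμ,
    QCloner.cqeRegion_cloner hd hk, fun r hr => QCloner.exists_weights_of_maximal hd hk hr⟩
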